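/- Let $r\ge 0$ and let $F$ be the free group with basis $x_0,\dots,x_{r-1}$. The simultaneous conjugacy search problem relative to a subgroup (SCSP*) in $F$ is the following search problem. An input consists of finitely many words $a_1,\dots,a_k$ and finitely many pairs of words $(u_1,v_1),\dots,(u_m,v_m)$ in the letters $x_j^{\pm1}$, such that the system $u_i^x=v_i$ $(i=1,\dots,m)$, where $u^x=x^{-1}ux$, has a solution $x$ in the subgroup $A=\langle a_1,\dots,a_k\rangle$ of $F$. The task is to find a word in the letters $x_j^{\pm1}$ that represents such a solution $x\in A$. The size of an input is $N=\sum_i(|a_i|+1)+\sum_i(|u_i|+|v_i|+2)+2$, the length of its encoding as a string (a separator after every word and after each of the two lists). Then SCSP* in $F$ is decidable in at most quadratic time: there are a program for a random access machine and a constant $C$, both depending only on $r$, such that on every input of SCSP* of size $N$ the program halts after at most $C N^2$ steps with a word representing a solution $x\in A$ as its output. Here the machine has registers and arrays of natural numbers, and its unit-cost instructions are: assigning a constant, copying a register, adding or subtracting $1$, reading and writing an array entry at an address held in a register, and comparing two registers. -/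

import Mathlib

/-! ### Random access machines

A state consists of registers and arrays of natural numbers (a program mentions only finitely many
of both). The only arithmetic is adding and subtracting one, so after `t` steps no number exceeds
the largest number in the input and in the program by more than `t`: numbers stay of logarithmic
bit size in polynomial time, and the uniform cost of one unit per instruction is realistic. -/

namespace RAM

structure State where
  reg : ℕ → ℕ
  arr : ℕ → ℕ → ℕ

inductive Instr where
  /-- `x := c` -/
  | const (x c : ℕ)
  /-- `x := y` -/
  | copy (x y : ℕ)
  /-- `x := x + 1` -/
  | inc (x : ℕ)
  /-- `x := x - 1`, where `0 - 1 = 0` -/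
  | dec (x : ℕ)
  /-- `x := a[y]` -/
  | load (x a y : ℕ)
  /-- `a[x] := y` -/
  | store (a x y : ℕ)

def Instr.exec (s : State) : Instr → State
  | .const x c => { s with reg := Function.update s.reg x c }
  | .copy x y => { s with reg := Function.update s.reg x (s.reg y) }
  | .inc x => { s with reg := Function.update s.reg x (s.reg x + 1) }
  | .dec x => { s with reg := Function.update s.reg x (s.reg x - 1) }
  | .load x a y => { s with reg := Function.update s.reg x (s.arr a (s.reg y)) }
  | .store a x y =>
      { s with arr := Function.update s.arr a (Function.update (s.arr a) (s.reg x) (s.reg y)) }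

/-- Comparisons of the contents of two registers. -/
inductive Test where
  | eq (x y : ℕ)
  | lt (x y : ℕ)

def Test.Holds (s : State) : Test → Prop
  | .eq x y => s.reg x = s.reg y
  | .lt x y => s.reg x < s.reg y

/-- Programs, with structured control flow. -/
inductive Prog where
  | skip
  | instr (i : Instr)
  | seq (p q : Prog)
  | ite (b : Test) (p q : Prog)
  | while (b : Test) (p : Prog)

/-- `Run p s t s'`: the program `p`, started in the state `s`, halts in the state `s'` after exactly
`t` steps, where every instruction and every evaluation of a test is one step. -/
inductive Run : Prog → State → ℕ → State → Prop where
  | skip (s : State) : Run .skip s 1 s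
  | instr (i : Instr) (s : State) : Run (.instr i) s 1 (i.exec s)
  | seq {p q : Prog} {s s' s'' : State} {t t' : ℕ} :
      Run p s t s' → Run q s' t' s'' → Run (.seq p q) s (t + t') s''
  | ite_true {b : Test} {p q : Prog} {s s' : State} {t : ℕ} :
      b.Holds s → Run p s t s' → Run (.ite b p q) s (t + 1) s'
  | ite_false {b : Test} {p q : Prog} {s s' : State} {t : ℕ} :
      ¬ b.Holds s → Run q s t s' → Run (.ite b p q) s (t + 1) s'
  | while_true {b : Test} {p : Prog} {s s' s'' : State} {t t' : ℕ} :
      b.Holds s → Run p s t s' → Run (.while b p) s' t' s'' → Run (.while b p) s (t + t' + 1) s''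
  | while_false {b : Test} {p : Prog} {s : State} :
      ¬ b.Holds s → Run (.while b p) s 1 s

/-- The initial state: the input, followed by zeros, is in array `0`; all else is zero. -/
def State.init (input : List ℕ) : State where
  reg := fun _ => 0
  arr := fun a => if a = 0 then fun i => input.getD i 0 else fun _ => 0

/-- The output `out` stands at the beginning of array `1` and is followed by a zero. -/
def State.Outputs (s : State) (out : List ℕ) : Prop :=
  ∀ i ≤ out.length, s.arr 1 i = out.getD i 0

end RAM

/-! ### Conjugacy search relative to a subgroup -/

/-- Words in the letters `x₀, …, x_{r-1}` and their inverses, not necessarily reduced; `(i, true)`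
is `x_i` and `(i, false)` is its inverse, as in `FreeGroup.mk`. -/
abbrev GroupWord (r : ℕ) : Type := List (Fin r × Bool)

namespace GroupWord

/-- Letters are coded by the numbers `2, …, 2 * r + 1`. -/
def code {r : ℕ} (w : GroupWord r) : List ℕ :=
  w.map fun x => 2 * (x.1 : ℕ) + x.2.toNat + 2

end GroupWord

/-- An input of the simultaneous conjugacy search problem relative to a subgroup, in the free group
of rank `r`: generators of the subgroup, and the pairs `(u, v)` of the equations `u ^ x = v`. -/
structure SCSPInput (r : ℕ) where
  gens : List (GroupWord r)
  eqns : List (GroupWord r × GroupWord r)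

namespace SCSPInput

variable {r : ℕ}

/-- The subgroup generated by the given words. -/
def subgroup (I : SCSPInput r) : Subgroup (FreeGroup (Fin r)) :=
  Subgroup.closure {g | ∃ a ∈ I.gens, g = FreeGroup.mk a}

/-- `x` lies in the subgroup and solves all equations `u ^ x = v`, where `u ^ x = x⁻¹ * u * x`. -/
def IsSolution (I : SCSPInput r) (x : FreeGroup (Fin r)) : Prop :=
  x ∈ I.subgroup ∧ ∀ e ∈ I.eqns, x⁻¹ * FreeGroup.mk e.1 * x = FreeGroup.mk e.2

/-- The input as a string: every word is followed by the symbol `1`, and both the list of the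
generators and the list of the equations are followed by the symbol `0`. -/
def encode (I : SCSPInput r) : List ℕ :=
  (I.gens.flatMap fun a => a.code ++ [1]) ++ [0] ++
    (I.eqns.flatMap fun e => e.1.code ++ [1] ++ e.2.code ++ [1]) ++ [0]

/-- The size of the input: the number of letters in all words, plus the number of words, plus 2. -/
def size (I : SCSPInput r) : ℕ := I.encode.length

end SCSPInput

/-! ### Programs on scalars and lists -/

namespace RAM

/-! Let `U₀` and `V₀` be the tuples of left and right sides of the equations. Conjugating by single
letters as long as the total length drops gives words `p`, `q` and tuples `U = U₀ ^ p`, `V = V₀ ^ q`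
that no letter shortens. The solutions are the elements `x = p * y * q⁻¹` of `A` with `U ^ y = V`,
so it remains to search for `y`.

Geometry of flat paths. Along a reduced word the total length of the conjugated tuple is convex
(`size_cjT_take_convex`), because two different letters cannot cancel at the same end of a word.
Between two local minima it is therefore constant (`LocalMin.flat`): `y` is a flat path. Three
different letters never all preserve the length of a nontrivial tuple
(`size_cjT_add_size_cjT_add_size_cjT`), so a flat path is determined by its first letter
(`Flat.unique`), and there are at most `2 * r` directions to explore. A flat path of more than `3 *
size U` letters runs for a long time along a periodic word. All entries of `U` have such a period,
hence commute with a common element, and the path comes back to `U` with the same next letter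
(`Flat.exists_return`). So each direction is described by a list of linear length, which either
stops or repeats forever (`Trace`).

Membership. A graph with a loop for every generator is extended at its base by tails reading `p` and
`q` and is then folded. The ends of the tails represent the cosets `A * p` and `A * q`, so for
reduced `y` the condition `p * y * q⁻¹ ∈ A` says that `y` labels a path between them
(`GraphInv.mem_iff_reads`). The program follows each flat path in this graph. On a periodic path, a
vertex that recurs at the same phase makes the motion repeat, so a hit occurs within (number of
edges + 1) periods, if at all (`exists_hit_lt`).

Time. Each of the linearly many descent steps, trace steps and folds costs linear time for fixed
`r`, and following a path takes quadratically many steps of bounded cost. The machine is handled by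
a timed Hoare calculus (`HT`) for programs on scalars and lists, in which every specification
carries an explicit step bound. -/

/-- A view of a machine state: the input, scalar variables and list variables. -/
structure Store where
  inp : List ℕ
  v : ℕ → ℕ
  l : ℕ → List ℕ

namespace Store

def set (σ : Store) (x n : ℕ) : Store := { σ with v := Function.update σ.v x n }

def setL (σ : Store) (a : ℕ) (L : List ℕ) : Store := { σ with l := Function.update σ.l a L }

@[simp] theorem set_inp (σ : Store) (x n : ℕ) : (σ.set x n).inp = σ.inp := rfl
@[simp] theorem set_l (σ : Store) (x n : ℕ) : (σ.set x n).l = σ.l := rfl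
@[simp] theorem set_v (σ : Store) (x n y : ℕ) :
    (σ.set x n).v y = if y = x then n else σ.v y := by
  simp [set, Function.update_apply]
@[simp] theorem setL_inp (σ : Store) (a : ℕ) (L : List ℕ) : (σ.setL a L).inp = σ.inp := rfl
@[simp] theorem setL_v (σ : Store) (a : ℕ) (L : List ℕ) : (σ.setL a L).v = σ.v := rfl
@[simp] theorem setL_l (σ : Store) (a : ℕ) (L : List ℕ) (b : ℕ) :
    (σ.setL a L).l b = if b = a then L else σ.l b := by
  simp [setL, Function.update_apply]

end Store

/-- Operands: scalars, lengths of lists, and the constants zero and one. -/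
inductive Opd where
  | var (x : ℕ)
  | len (a : ℕ)
  | zero
  | one

namespace Opd

/-- The register in which an operand is kept. -/
def reg : Opd → ℕ
  -- Lengths occupy the even registers, the constants the registers 1 and 3, and scalars the odd
  -- registers from 5 on, so different operands never share a register.
  | var x => 2 * x + 5
  | len a => 2 * a
  | zero => 1
  | one => 3

def val (σ : Store) : Opd → ℕ
  | var x => σ.v x
  | len a => (σ.l a).length
  | zero => 0
  | one => 1

@[simp] theorem val_var (σ : Store) (x : ℕ) : (var x).val σ = σ.v x := rfl
@[simp] theorem val_len (σ : Store) (a : ℕ) : (len a).val σ = (σ.l a).length := rfl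
@[simp] theorem val_zero (σ : Store) : zero.val σ = 0 := rfl
@[simp] theorem val_one (σ : Store) : one.val σ = 1 := rfl

theorem reg_eq_var {o : Opd} {x : ℕ} : o.reg = 2 * x + 5 ↔ o = var x := by
  cases o <;> simp only [reg, var.injEq, reduceCtorEq, iff_false] <;> omega

theorem reg_eq_len {o : Opd} {a : ℕ} : o.reg = 2 * a ↔ o = len a := by
  cases o <;> simp [reg] <;> omega

end Opd

/-- The state `s` represents the store `σ`; array `a + 1` holds the list variable `a`. -/
structure Rep (σ : Store) (s : State) : Prop where
  opd : ∀ o : Opd, s.reg o.reg = o.val σ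
  inp : ∀ i, s.arr 0 i = σ.inp.getD i 0
  -- Entries beyond the length are unconstrained, so `pop` and `clear` need only touch the length
  -- register.
  arr : ∀ a, ∀ i < (σ.l a).length, s.arr (a + 1) i = (σ.l a).getD i 0

/-- Elementary operations on stores. -/
inductive Op where
  | const (x c : ℕ)
  | mov (x : ℕ) (o : Opd)
  | inc (x : ℕ)
  | dec (x : ℕ)
  | push (a : ℕ) (o : Opd)
  | pop (a : ℕ)
  | clear (a : ℕ)
  | get (x a y : ℕ)
  | put (a x : ℕ) (o : Opd)
  | input (x y : ℕ)

namespace Op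

/-- Accesses to lists must be within their bounds. -/
@[simp] def Ok (σ : Store) : Op → Prop
  | get _ a y => σ.v y < (σ.l a).length
  | put a x _ => σ.v x < (σ.l a).length
  | _ => True

@[simp] def eff (σ : Store) : Op → Store
  | const x c => σ.set x c
  | mov x o => σ.set x (o.val σ)
  | inc x => σ.set x (σ.v x + 1)
  | dec x => σ.set x (σ.v x - 1)
  | push a o => σ.setL a (σ.l a ++ [o.val σ])
  | pop a => σ.setL a (σ.l a).dropLast
  | clear a => σ.setL a []
  | get x a y => σ.set x ((σ.l a).getD (σ.v y) 0)
  | put a x o => σ.setL a ((σ.l a).set (σ.v x) (o.val σ))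
  | input x y => σ.set x (σ.inp.getD (σ.v y) 0)

def prog : Op → Prog
  | const x c => .instr (.const (Opd.var x).reg c)
  | mov x o => .instr (.copy (Opd.var x).reg o.reg)
  | inc x => .instr (.inc (Opd.var x).reg)
  | dec x => .instr (.dec (Opd.var x).reg)
  | push a o => .seq (.instr (.store (a + 1) (Opd.len a).reg o.reg))
      (.instr (.inc (Opd.len a).reg))
  | pop a => .instr (.dec (Opd.len a).reg)
  | clear a => .instr (.const (Opd.len a).reg 0)
  | get x a y => .instr (.load (Opd.var x).reg (a + 1) (Opd.var y).reg)
  | put a x o => .instr (.store (a + 1) (Opd.var x).reg o.reg)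
  | input x y => .instr (.load (Opd.var x).reg 0 (Opd.var y).reg)

end Op

theorem Rep.update_var {σ : Store} {s : State} (h : Rep σ s) (x n : ℕ) :
    Rep (σ.set x n) { s with reg := Function.update s.reg (2 * x + 5) n } where
  opd o := by
    rcases o with y | a | _ | _
    · by_cases hy : y = x
      · simp [Function.update_apply, Opd.reg_eq_var, hy]
      · simpa [Function.update_apply, Opd.reg_eq_var, hy] using h.opd (.var y)
    · simpa [Function.update_apply, Opd.reg_eq_var] using h.opd (.len a)
    · simpa [Function.update_apply, Opd.reg_eq_var] using h.opd .zero
    · simpa [Function.update_apply, Opd.reg_eq_var] using h.opd .one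
  inp := h.inp
  arr := h.arr

/-- The common part of `push`, `pop`, `clear` and `put`, which change at most one array together
with its length register. -/
theorem Rep.update_len {σ : Store} {s : State} (h : Rep σ s) (a n : ℕ) (L : List ℕ)
    (f : ℕ → ℕ → ℕ) (hn : L.length = n) (h0 : f 0 = s.arr 0)
    (hf : ∀ b ≠ a, f (b + 1) = s.arr (b + 1)) (hL : ∀ i < L.length, f (a + 1) i = L.getD i 0) :
    Rep (σ.setL a L) { reg := Function.update s.reg (2 * a) n, arr := f } where
  opd o := by
    rcases o with y | b | _ | _
    · simpa [Function.update_apply, Opd.reg_eq_len] using h.opd (.var y)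
    · by_cases hb : b = a
      · simp [Function.update_apply, Opd.reg_eq_len, hb, hn]
      · simpa [Function.update_apply, Opd.reg_eq_len, hb] using h.opd (.len b)
    · simpa [Function.update_apply, Opd.reg_eq_len] using h.opd .zero
    · simpa [Function.update_apply, Opd.reg_eq_len] using h.opd .one
  inp i := by simpa [h0] using h.inp i
  arr b i hi := by
    by_cases hb : b = a
    · subst hb; simp at hi ⊢; simpa using hL i hi
    · simp [hb] at hi ⊢; rw [hf b hb]; simpa using h.arr b i hi

/-- The bound 2 is needed only for `push`, which stores an entry and then increments the length. -/
theorem Op.run {σ : Store} {s : State} (h : Rep σ s) (op : Op) (ok : op.Ok σ) :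
    ∃ t s', Run op.prog s t s' ∧ t ≤ 2 ∧ Rep (op.eff σ) s' := by
  have hvar : ∀ x, s.reg (2 * x + 5) = σ.v x := fun x => h.opd (.var x)
  have hlen : ∀ a, s.reg (2 * a) = (σ.l a).length := fun a => h.opd (.len a)
  cases op with
  | const x c => exact ⟨1, _, .instr _ _, by omega, h.update_var x c⟩
  | mov x o =>
    refine ⟨1, _, .instr _ _, by omega, ?_⟩
    simp only [eff, ← h.opd o]
    exact h.update_var x _
  | inc x =>
    refine ⟨1, _, .instr _ _, by omega, ?_⟩
    simp only [eff, ← hvar]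
    exact h.update_var x _
  | dec x =>
    refine ⟨1, _, .instr _ _, by omega, ?_⟩
    simp only [eff, ← hvar]
    exact h.update_var x _
  | push a o =>
    refine ⟨2, _, .seq (.instr _ _) (.instr _ _), by omega, ?_⟩
    simp only [eff, Instr.exec, Opd.reg, ← h.opd o]
    refine h.update_len a _ _ _ (by simp [hlen]) (by simp) (fun b hb => by simp [hb]) ?_
    intro i hi
    simp only [Function.update_self, hlen, Function.update_apply]
    simp at hi
    split_ifs with hia
    · subst hia; simp [List.getD_eq_getElem?_getD]
    · have : i < (σ.l a).length := by omega
      rw [h.arr a i this, List.getD_append _ _ _ _ this]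
  | pop a =>
    refine ⟨1, _, .instr _ _, by omega, ?_⟩
    simp only [eff, Instr.exec, Opd.reg]
    refine h.update_len a _ _ _ (by simp [hlen]) rfl (fun b hb => rfl) ?_
    intro i hi
    rw [List.length_dropLast] at hi
    rw [h.arr a i (by omega)]
    simp [List.getD_eq_getElem?_getD, hi, show i < (σ.l a).length by omega]
  | clear a =>
    refine ⟨1, _, .instr _ _, by omega, ?_⟩
    simp only [eff, Instr.exec, Opd.reg]
    exact h.update_len a _ _ _ (by simp) rfl (fun b hb => rfl) (by simp)
  | get x a y =>
    refine ⟨1, _, .instr _ _, by omega, ?_⟩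
    simp only [Ok] at ok
    have e := h.arr a _ ok
    rw [← hvar y] at e
    simp only [eff, ← hvar y, ← e]
    exact h.update_var x _
  | put a x o =>
    refine ⟨1, _, .instr _ _, by omega, ?_⟩
    simp only [Ok] at ok
    -- Overwriting an entry keeps the length, so the length register is formally updated with its
    -- own content.
    have := h.update_len a (s.reg (2 * a)) ((σ.l a).set (σ.v x) (o.val σ))
      (Function.update s.arr (a + 1)
        (Function.update (s.arr (a + 1)) (s.reg (2 * x + 5)) (s.reg o.reg)))
      (by simp [hlen]) (by simp) (fun b hb => by simp [hb]) ?_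
    · rw [Function.update_eq_self] at this
      exact this
    · intro i hi
      simp only [List.length_set] at hi
      simp only [Function.update_self, Function.update_apply, hvar, h.opd o]
      split_ifs with hix
      · subst hix; simp [List.getD_eq_getElem?_getD, hi]
      · rw [h.arr a i hi]
        simp [List.getD_eq_getElem?_getD, Ne.symm hix]
  | input x y =>
    refine ⟨1, _, .instr _ _, by omega, ?_⟩
    simp only [eff, ← h.inp, ← hvar y]
    exact h.update_var x _

/-- Comparisons of operands. -/
inductive Cond where
  | eq (o o' : Opd)
  | lt (o o' : Opd)

namespace Cond

@[simp] def Holds (σ : Store) : Cond → Prop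
  | eq o o' => o.val σ = o'.val σ
  | lt o o' => o.val σ < o'.val σ

def test : Cond → Test
  | eq o o' => .eq o.reg o'.reg
  | lt o o' => .lt o.reg o'.reg

theorem holds_test {σ : Store} {s : State} (h : Rep σ s) (b : Cond) :
    b.test.Holds s ↔ b.Holds σ := by
  cases b <;> simp [test, Test.Holds, h.opd]

end Cond

/-! ### Timed Hoare rules. -/

def blk : List Op → Prog
  | [] => .skip
  | op :: ops => .seq op.prog (blk ops)

def cond (b : Cond) (p q : Prog) : Prog := .ite b.test p q

def loop (b : Cond) (p : Prog) : Prog := .while b.test p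

/-- Iterate `p` while the scalar `x`, which is increased after every iteration, is below `o`. -/
def upto (x : ℕ) (o : Opd) (p : Prog) : Prog := loop (.lt (.var x) o) (.seq p (blk [.inc x]))

infixr:30 " ;; " => Prog.seq

/-- Started in the store `σ`, the program `p` halts within `n` steps in a store satisfying `Q`. -/
def HT (p : Prog) (σ : Store) (n : ℕ) (Q : Store → Prop) : Prop :=
  ∀ s, Rep σ s → ∃ t s' σ', Run p s t s' ∧ t ≤ n ∧ Rep σ' s' ∧ Q σ'

theorem HT.mono {p : Prog} {σ : Store} {m n : ℕ} {P Q : Store → Prop} (h : HT p σ m P)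
    (hmn : m ≤ n) (hPQ : ∀ τ, P τ → Q τ) : HT p σ n Q := fun s hs =>
  let ⟨t, s', σ', h1, h2, h3, h4⟩ := h s hs
  ⟨t, s', σ', h1, h2.trans hmn, h3, hPQ _ h4⟩

/-- The second program inherits what the first leaves of the budget `n`, so a chain of
specifications needs only one inequality per link. -/
theorem HT.seq {p q : Prog} {σ : Store} {m n : ℕ} {P Q : Store → Prop} (hp : HT p σ m P)
    (hmn : m ≤ n) (hq : ∀ τ, P τ → HT q τ (n - m) Q) : HT (p ;; q) σ n Q := fun s hs => by
  obtain ⟨t, s', σ', h1, h2, h3, h4⟩ := hp s hs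
  obtain ⟨t', s'', σ'', k1, k2, k3, k4⟩ := hq σ' h4 s' h3
  exact ⟨t + t', s'', σ'', .seq h1 k1, by omega, k3, k4⟩

@[simp] def okAll : List Op → Store → Prop
  | [], _ => True
  | op :: ops, σ => op.Ok σ ∧ okAll ops (op.eff σ)

@[simp] def effAll : List Op → Store → Store
  | [], σ => σ
  | op :: ops, σ => effAll ops (op.eff σ)

/-- Two steps pay for each operation and one for the final `skip`. -/
theorem HT.blk {ops : List Op} {σ : Store} {n : ℕ} {Q : Store → Prop}
    (hn : 2 * ops.length + 1 ≤ n) (ok : okAll ops σ) (hQ : Q (effAll ops σ)) :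
    HT (blk ops) σ n Q := by
  induction ops generalizing σ n with
  | nil => exact fun s hs => ⟨1, s, σ, .skip s, hn, hs, hQ⟩
  | cons op ops ih =>
    intro s hs
    obtain ⟨t, s', h1, h2, h3⟩ := op.run hs ok.1
    simp at hn
    obtain ⟨t', s'', σ'', k1, k2, k3, k4⟩ := ih (n := n - 2) (by omega) ok.2 hQ s' h3
    exact ⟨_, s'', σ'', .seq h1 k1, by omega, k3, k4⟩

/-- A block of operations followed by another program. -/
theorem HT.blk_seq {ops : List Op} {q : Prog} {σ : Store} {n : ℕ} {Q : Store → Prop}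
    (hn : 2 * ops.length + 1 ≤ n) (ok : okAll ops σ)
    (hq : HT q (effAll ops σ) (n - (2 * ops.length + 1)) Q) : HT (RAM.blk ops ;; q) σ n Q :=
  HT.seq (P := fun τ => τ = effAll ops σ) (HT.blk le_rfl ok rfl) hn (fun _ h => h ▸ hq)

theorem HT.cond {b : Cond} {p q : Prog} {σ : Store} {n : ℕ} {Q : Store → Prop} (hn : 1 ≤ n)
    (hp : b.Holds σ → HT p σ (n - 1) Q) (hq : ¬ b.Holds σ → HT q σ (n - 1) Q) :
    HT (cond b p q) σ n Q := by
  intro s hs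
  by_cases h : b.Holds σ
  · obtain ⟨t, s', σ', h1, h2, h3, h4⟩ := hp h s hs
    exact ⟨_, s', σ', .ite_true ((b.holds_test hs).2 h) h1, by omega, h3, h4⟩
  · obtain ⟨t, s', σ', h1, h2, h3, h4⟩ := hq h s hs
    exact ⟨_, s', σ', .ite_false (mt (b.holds_test hs).1 h) h1, by omega, h3, h4⟩

/-- The rule for loops: `I n τ` says that the invariant holds in `τ` and that `n` steps remain. -/
theorem HT.loop {b : Cond} {p : Prog} {σ : Store} {n : ℕ} {Q : Store → Prop}
    (I : ℕ → Store → Prop) (h0 : I n σ)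
    (hp : ∀ n τ, I n τ → b.Holds τ → ∃ m, HT p τ m (fun τ' => ∃ n', m + 1 + n' ≤ n ∧ I n' τ'))
    (hq : ∀ n τ, I n τ → ¬ b.Holds τ → 1 ≤ n ∧ Q τ) : HT (loop b p) σ n Q := by
  -- The remaining budget is also the termination measure, since each iteration pays at least for
  -- its test.
  induction n using Nat.strong_induction_on generalizing σ with
  | _ n ih =>
    intro s hs
    by_cases h : b.Holds σ
    · obtain ⟨m, hm⟩ := hp n σ h0 h
      obtain ⟨t, s', σ', h1, h2, h3, n', h4, h5⟩ := hm s hs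
      obtain ⟨t', s'', σ'', k1, k2, k3, k4⟩ := ih n' (by omega) h5 s' h3
      exact ⟨_, s'', σ'', .while_true ((b.holds_test hs).2 h) h1 k1, by omega, k3, k4⟩
    · obtain ⟨h1, h2⟩ := hq n σ h0 h
      exact ⟨1, s, σ, .while_false (mt (b.holds_test hs).1 h), h1, hs, h2⟩

/-- Besides the body an iteration costs 4: three steps for the block that increments `x` and one for
the test. The body must leave `x` unchanged, and the invariant is claimed for the store after the
increment. -/
theorem HT.upto {x : ℕ} {o : Opd} {p : Prog} {σ : Store} {k₀ m c n : ℕ} {Q : Store → Prop}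
    (J : ℕ → Store → Prop) (h0 : J k₀ σ) (hx : σ.v x = k₀) (hk : k₀ ≤ m)
    (ho : ∀ k τ, J k τ → o.val τ = m)
    (hp : ∀ k τ, k₀ ≤ k → k < m → J k τ → τ.v x = k →
      HT p τ c (fun τ' => τ'.v x = k ∧ J (k + 1) (τ'.set x (k + 1))))
    (hn : (m - k₀) * (c + 4) + 1 ≤ n) (hQ : ∀ τ, J m τ → τ.v x = m → Q τ) :
    HT (upto x o p) σ n Q := by
  refine HT.mono (m := (m - k₀) * (c + 4) + 1) ?_ hn (fun τ (h : J m τ ∧ τ.v x = m) => hQ τ h.1 h.2)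
  refine HT.loop (fun n τ => ∃ k, k₀ ≤ k ∧ k ≤ m ∧ J k τ ∧ τ.v x = k ∧ n = (m - k) * (c + 4) + 1)
    ⟨k₀, le_rfl, hk, h0, hx, rfl⟩ ?_ ?_
  · rintro n τ ⟨k, hk0, hkm, hJ, hv, rfl⟩ hb
    simp only [Cond.Holds, ho k τ hJ] at hb
    simp only [Opd.val, hv] at hb
    refine ⟨c + 3, HT.seq (hp k τ hk0 hb hJ hv) (by omega) fun τ' h => HT.blk (by simp) (by simp) ?_⟩
    refine ⟨(m - (k + 1)) * (c + 4) + 1, ?_, k + 1, by omega, hb, ?_, by simp [h.1], rfl⟩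
    · obtain ⟨d, rfl⟩ : ∃ d, m = k + 1 + d := ⟨m - (k + 1), by omega⟩
      have e1 : k + 1 + d - k = d + 1 := by omega
      have e2 : k + 1 + d - (k + 1) = d := by omega
      rw [e1, e2]; nlinarith
    · simpa [h.1] using h.2
  · rintro n τ ⟨k, hk0, hkm, hJ, hv, rfl⟩ hb
    simp only [Cond.Holds, ho k τ hJ] at hb
    simp only [Opd.val, hv] at hb
    obtain rfl : k = m := by omega
    exact ⟨by omega, hJ, hv⟩

/-- `τ` arises from `σ` by changes to lists and to scalars from `k` on. -/
structure Frame (k : ℕ) (σ τ : Store) : Prop where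
  inp : τ.inp = σ.inp
  v : ∀ x < k, τ.v x = σ.v x

theorem Frame.refl (k : ℕ) (σ : Store) : Frame k σ σ := ⟨rfl, fun _ _ => rfl⟩

theorem Frame.trans {j k : ℕ} {σ τ υ : Store} (h : Frame j σ τ) (h' : Frame k τ υ) (hjk : j ≤ k) :
    Frame j σ υ :=
  ⟨h'.inp.trans h.inp, fun x hx => (h'.v x (by omega)).trans (h.v x hx)⟩

@[simp] theorem Frame.set_iff {k x n : ℕ} {σ τ : Store} (hx : k ≤ x) :
    Frame k σ (τ.set x n) ↔ Frame k σ τ := by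
  constructor <;> rintro ⟨h1, h2⟩ <;> refine ⟨h1, fun y hy => ?_⟩ <;>
    simpa [show y ≠ x by omega] using h2 y hy

@[simp] theorem Frame.setL_iff {k a : ℕ} {L : List ℕ} {σ τ : Store} :
    Frame k σ (τ.setL a L) ↔ Frame k σ τ :=
  ⟨fun h => ⟨h.1, h.2⟩, fun h => ⟨h.1, h.2⟩⟩

end RAM

/-! ### List routines and conjugation of an encoded tuple by a letter. -/

namespace RAM

open Opd Op

/-- `τ` arises from `σ` by setting the list `a` to `L` and changing scalars from `k` on. -/
structure Upd (k : ℕ) (σ : Store) (a : ℕ) (L : List ℕ) (τ : Store) : Prop where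
  frame : Frame k σ τ
  l : ∀ b, τ.l b = if b = a then L else σ.l b

/-- Append a letter to the list `a`, or cancel it; list `1` contains the inverses of all letters. -/
def pushRedProg (a x : ℕ) : Prog :=
  blk [mov 40 (len a), dec 40, get 40 a 40, get 41 1 x] ;;
  cond (.eq (var 40) (var 41)) (blk [pop a]) (blk [push a (var x)])

/-- One step of free reduction on codes, `J` being the table of inverses. A separator `1` before the
current word stops cancellation at its beginning, since no entry of `J` is `1`. -/
def pushRed (J Y : List ℕ) (c : ℕ) : List ℕ :=
  if Y.getD (Y.length - 1) 0 = J.getD c 0 then Y.dropLast else Y ++ [c]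

theorem pushRedProg_spec {a x : ℕ} {σ : Store} (hx : x < 40) (h1 : σ.v x < (σ.l 1).length)
    (ha : σ.l a ≠ []) : HT (pushRedProg a x) σ 20
      (Upd 40 σ a (pushRed (σ.l 1) (σ.l a) (σ.v x))) := by
  have hx0 : x ≠ 40 := by omega
  have hx1 : x ≠ 41 := by omega
  have := List.length_pos_iff.2 ha
  refine HT.blk_seq (by simp) (by simp [hx0, h1, this]) ?_
  refine HT.cond (by simp) (fun h => HT.blk (by simp) (by simp) ?_)
    (fun h => HT.blk (by simp) (by simp) ?_)
  · simp [hx0] at h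
    exact ⟨by simp [Frame.refl], by simp [pushRed, h]⟩
  · simp [hx0] at h
    exact ⟨by simp [Frame.refl], by simp [pushRed, h, hx0, hx1]⟩

/-- The guard at the front is never cancelled, so the list stays nonempty, as `pushRedProg_spec`
requires. -/
theorem pushRed_cons {J Y : List ℕ} {c x : ℕ} (h : J.getD c 0 ≠ x) :
    ∃ Y', pushRed J (x :: Y) c = x :: Y' := by
  unfold pushRed
  split_ifs with h'
  · rcases Y with _ | ⟨y, Y⟩
    · simp at h h'; exact absurd h'.symm h
    · exact ⟨_, List.dropLast_cons_cons⟩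
  · exact ⟨_, List.cons_append⟩

/-- Copy the list `b` to the list `a`. -/
def copyProg (a b : ℕ) : Prog :=
  blk [clear a, const 32 0] ;; upto 32 (len b) (blk [get 33 b 32, push a (var 33)])

theorem copyProg_spec {a b : ℕ} (hab : b ≠ a) {σ : Store} {n : ℕ}
    (hn : (σ.l b).length * 9 + 6 ≤ n) :
    HT (copyProg a b) σ n (Upd 30 σ a (σ.l b)) := by
  refine HT.blk_seq (by simp; omega) (by simp) ?_
  refine HT.upto (k₀ := 0) (m := (σ.l b).length) (c := 5)
    (fun k τ => Upd 30 σ a ((σ.l b).take k) τ) ⟨by simp [Frame.refl], by simp⟩ (by simp) (by simp)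
    (fun k τ h => by simp [h.l, hab]) ?_ (by simp; omega) (fun τ h _ => by simpa using h)
  intro k τ _ hk h hv
  refine HT.blk (by simp) (by simp [h.l, hab, hv, hk]) ⟨by simp [hv], by simp [h.frame], ?_⟩
  intro c
  simp [h.l, hab, hv, hk]
  split_ifs <;> simp_all

/-- `τ` arises from `σ` by changing scalars from `k` on. -/
structure Same (k : ℕ) (σ τ : Store) : Prop where
  frame : Frame k σ τ
  l : ∀ b, τ.l b = σ.l b

/-- Compare the lists `a` and `b`, and set the scalar `35` to `1` if they are equal. -/
def eqProg (a b : ℕ) : Prog :=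
  blk [const 35 0] ;;
  cond (.eq (len a) (len b))
    (blk [const 35 1, const 32 0] ;;
      upto 32 (len a) (blk [get 33 a 32, get 34 b 32] ;;
        cond (.eq (var 33) (var 34)) (blk []) (blk [const 35 0])))
    (blk [])

theorem eqProg_spec {a b : ℕ} {σ : Store} {n : ℕ} (hn : (σ.l a).length * 20 + 20 ≤ n) :
    HT (eqProg a b) σ n (fun τ => Same 30 σ τ ∧ τ.v 35 = if σ.l a = σ.l b then 1 else 0) := by
  refine HT.blk_seq (by simp; omega) (by simp) ?_
  refine HT.cond (by simp; omega) (fun h => ?_) (fun h => HT.blk (by simp; omega) (by simp) ?_)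
  · simp at h
    refine HT.blk_seq (by simp; omega) (by simp) ?_
    refine HT.upto (k₀ := 0) (m := (σ.l a).length) (c := 12)
      (fun k τ => Same 30 σ τ ∧ τ.v 35 = if (σ.l a).take k = (σ.l b).take k then 1 else 0)
      ⟨⟨by simp [Frame.refl], by simp⟩, by simp⟩ (by simp) (by simp)
      (fun k τ h => by simp [h.1.l]) ?_ (by simp; omega)
      (fun τ h' _ => ⟨h'.1, by simp [h'.2]; rw [h]; simp⟩)
    rintro k τ _ hk ⟨hs, h35⟩ hv
    have hkb : k < (σ.l b).length := by omega
    refine HT.blk_seq (by simp) (by simp [hs.l, hv, hk, hkb]) ?_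
    refine HT.cond (by simp) (fun h' => HT.blk (by simp) (by simp) ?_)
      (fun h' => HT.blk (by simp) (by simp) ?_)
    all_goals
      simp only [effAll, eff, Cond.Holds, val_var, Store.set_v, Store.set_l, hv, hs.l,
        Nat.reduceEqDiff, if_true, if_false, List.getD_eq_getElem _ _ hk,
        List.getD_eq_getElem _ _ hkb] at h'
      refine ⟨by simp [hv], ⟨⟨by simp [hs.frame], by simp [hs.l]⟩, ?_⟩⟩
      -- Prefixes of equal length agree exactly if the shorter prefixes and the new entries do, so
      -- resetting the flag once at a mismatch is enough.
      have key : (σ.l a).take (k + 1) = (σ.l b).take (k + 1) ↔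
          (σ.l a).take k = (σ.l b).take k ∧ (σ.l a)[k] = (σ.l b)[k] := by
        rw [List.take_succ_eq_append_getElem hk, List.take_succ_eq_append_getElem hkb]
        exact ⟨fun e => by simpa using List.append_inj' e rfl, fun e => by rw [e.1, e.2]⟩
      simp only [key]
    · simp only [show (σ.l a)[k] = (σ.l b)[k] from h', and_true]
      simpa using h35
    · rw [if_neg (fun e => h' e.2)]
      simp
  · simp at h
    refine ⟨⟨by simp [Frame.refl], by simp⟩, ?_⟩
    rw [if_neg (fun h' => h (by rw [h']))]
    simp

/-- Add the operand `o` to the scalar `x`. -/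
def addProg (x : ℕ) (o : Opd) : Prog := blk [const 41 0] ;; upto 41 o (blk [inc x])

/-- Addition by repeated increments takes time linear in the summand. It is harmless because the
summands used later are letter codes, the end marker `0`, or the number `2 * r + 2`. -/
theorem addProg_spec {x y : ℕ} {σ : Store} {n : ℕ} (hx : x ≠ 41) (hy : y ≠ 41) (hxy : x ≠ y)
    (hn : σ.v y * 7 + 4 ≤ n) :
    HT (addProg x (var y)) σ n (fun τ => τ.inp = σ.inp ∧ (∀ b, τ.l b = σ.l b) ∧
      ∀ z ≠ 41, τ.v z = if z = x then σ.v x + σ.v y else σ.v z) := by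
  refine HT.blk_seq (by simp; omega) (by simp) ?_
  refine HT.upto (k₀ := 0) (m := σ.v y) (c := 3)
    (fun k τ => τ.inp = σ.inp ∧ (∀ b, τ.l b = σ.l b) ∧
      ∀ z ≠ 41, τ.v z = if z = x then σ.v x + k else σ.v z)
    ⟨by simp, by simp, by simp +contextual⟩ (by simp) (by simp)
    (fun k τ h => by simp [h.2.2 y hy, hxy.symm]) ?_ (by simp; omega)
    (fun τ h' _ => h')
  rintro k τ _ hk ⟨h1, h2, h3⟩ hv
  refine HT.blk (by simp) (by simp) ⟨by simp [hx.symm, hv], by simp [h1], by simp [h2], ?_⟩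
  intro z hz
  by_cases hzx : z = x
  · subst hzx; simp [hz, h3 z hz]; omega
  · simp [hz, hzx, h3 z hz]

/-- Replace the vertex `y` by the vertex `x`. -/
def relabel (x y z : ℕ) : ℕ := if z = y then x else z

/-- Apply `relabel` to the entries of the list `a`. -/
def relabelProg (a : ℕ) : Prog :=
  blk [const 33 0] ;; upto 33 (len a) (blk [get 34 a 33] ;;
    cond (.eq (var 34) (var 32)) (blk [put a 33 (var 31)]) (blk []))

theorem relabelProg_spec {a : ℕ} {σ : Store} {n : ℕ} (hn : (σ.l a).length * 20 + 20 ≤ n) :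
    HT (relabelProg a) σ n
      (Upd 33 σ a ((σ.l a).map (relabel (σ.v 31) (σ.v 32)))) := by
  set f := relabel (σ.v 31) (σ.v 32) with hf
  refine HT.blk_seq (by simp; omega) (by simp) ?_
  refine HT.upto (k₀ := 0) (m := (σ.l a).length) (c := 12)
    (fun k τ => Upd 33 σ a (((σ.l a).take k).map f ++ (σ.l a).drop k) τ)
    ⟨by simp [Frame.refl], by simp⟩ (by simp) (by simp)
    (fun k τ h => by simp [h.l]; omega) ?_ (by simp; omega)
    (fun τ h' _ => by simpa using h')
  rintro k τ _ hk h hv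
  have hlen : (τ.l a).length = (σ.l a).length := by simp [h.l]; omega
  have hget : (τ.l a).getD k 0 = (σ.l a)[k] := by
    rw [h.l, if_pos rfl, List.getD_append_right _ _ _ _ (by simp)]
    simp [hk.le, List.getD_eq_getElem?_getD, hk]
  have key : (τ.l a).set k (f (σ.l a)[k]) =
      ((σ.l a).take (k + 1)).map f ++ (σ.l a).drop (k + 1) := by
    simp only [h.l, if_true]
    rw [List.drop_eq_getElem_cons hk, List.set_append_right _ _ (by simp),
      List.take_succ_eq_append_getElem hk, List.map_append, List.append_assoc, List.length_map,
      List.length_take, min_eq_left hk.le, Nat.sub_self]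
    rfl
  refine HT.blk_seq (by simp) (by simp [hv, hlen, hk]) ?_
  have e1 := h.frame.v 31 (by simp)
  have e2 := h.frame.v 32 (by simp)
  refine HT.cond (by simp) (fun h' => HT.blk (by simp) (by simp [hv, hlen, hk]) ?_)
    (fun h' => HT.blk (by simp) (by simp) ?_)
  all_goals
    simp only [effAll, eff, Cond.Holds, val_var, Store.set_v, hv, hget, e2] at h'
    simp at h'
    refine ⟨by simp [hv], by simp [h.frame], fun b => ?_⟩
    by_cases hb : b = a
    · subst hb
      rw [← key]
      simp [hv, e1, hf, relabel, h']
      try rw [← hget]; simp [List.getD_eq_getElem?_getD, hlen, hk]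
    · simp [hb, h.l]

/-- Conjugate all words in the list `a` by the letter `30`; the result is the list `11`. -/
def conjProg (a : ℕ) : Prog :=
  blk [clear 11, push 11 one, get 31 1 30, push 11 (var 31), const 32 1] ;;
  upto 32 (len a) (blk [get 33 a 32] ;;
    cond (.eq (var 33) one)
      (pushRedProg 11 30 ;; blk [push 11 one, push 11 (var 31)])
      (pushRedProg 11 33)) ;;
  blk [pop 11]

/-- At a separator the current word is closed by the conjugating letter, and the next one is opened
with the inverse of that letter. The word opened after the last separator is spurious; the final
`pop` of `conjProg` removes its only letter. -/
def conjStep (J : List ℕ) (c : ℕ) (Y : List ℕ) (x : ℕ) : List ℕ :=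
  if x = 1 then pushRed J Y c ++ [1, J.getD c 0] else pushRed J Y x

theorem conjStep_cons {J Y : List ℕ} (hJ : ∀ c, J.getD c 0 ≠ 1) (c x : ℕ) :
    ∃ Y', conjStep J c (1 :: Y) x = 1 :: Y' := by
  unfold conjStep
  split_ifs
  · obtain ⟨Y', h⟩ := pushRed_cons (Y := Y) (hJ c)
    exact ⟨_, by rw [h]; rfl⟩
  · exact pushRed_cons (hJ x)

theorem foldl_conjStep_cons {J Y : List ℕ} (hJ : ∀ c, J.getD c 0 ≠ 1) (c : ℕ) (S : List ℕ) :
    ∃ Y', S.foldl (conjStep J c) (1 :: Y) = 1 :: Y' := by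
  induction S generalizing Y with
  | nil => exact ⟨Y, rfl⟩
  | cons x S ih =>
    obtain ⟨Y', h⟩ := conjStep_cons (Y := Y) hJ c x
    simpa [h] using ih

theorem conjProg_spec {a : ℕ} (ha : a ≠ 11) {σ : Store} {S : List ℕ} {n : ℕ}
    (hS : σ.l a = 1 :: S) (hJ : ∀ c, (σ.l 1).getD c 0 ≠ 1) (h30 : σ.v 30 < (σ.l 1).length)
    (hlt : ∀ x ∈ S, x < (σ.l 1).length) (hn : S.length * 40 + 20 ≤ n) :
    HT (conjProg a) σ n (Upd 31 σ 11
      (S.foldl (conjStep (σ.l 1) (σ.v 30)) [1, (σ.l 1).getD (σ.v 30) 0]).dropLast) := by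
  refine HT.blk_seq (by simp; omega) (by simp [h30]) ?_
  refine HT.seq (m := S.length * 40 + 1)
    (P := fun τ => Upd 31 σ 11
      (S.foldl (conjStep (σ.l 1) (σ.v 30)) [1, (σ.l 1).getD (σ.v 30) 0]) τ) ?_
    (by simp; omega) ?_
  swap
  · intro τ h
    refine HT.blk (by simp; omega) (by simp) ⟨by simp [h.frame], fun b => ?_⟩
    by_cases hb : b = 11 <;> simp [hb, h.l]
  -- Reading starts at position 1: the leading separator and the first inverse letter have been
  -- written in advance.
  refine HT.upto (k₀ := 1) (m := S.length + 1) (c := 36)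
    (fun k τ => Upd 31 σ 11 ((S.take (k - 1)).foldl (conjStep (σ.l 1) (σ.v 30))
      [1, (σ.l 1).getD (σ.v 30) 0]) τ ∧ τ.v 31 = (σ.l 1).getD (σ.v 30) 0)
    ⟨⟨by simp [Frame.refl], fun b => by by_cases hb : b = 11 <;> simp [hb]⟩, by simp⟩
    (by simp) (by omega)
    (fun k τ h => by simp [h.1.l, ha, hS]) ?_ (by simp)
    (fun τ h' _ => by simpa using h'.1)
  rintro k τ hk0 hk ⟨h, h31⟩ hv
  obtain ⟨k, rfl⟩ : ∃ j, k = j + 1 := ⟨k - 1, by omega⟩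
  simp only [Nat.add_sub_cancel, add_lt_add_iff_right] at h hk ⊢
  obtain ⟨Y', hY'⟩ := foldl_conjStep_cons (Y := [(σ.l 1).getD (σ.v 30) 0]) hJ (σ.v 30) (S.take k)
  rw [hY'] at h
  have hkey : (S.take (k + 1)).foldl (conjStep (σ.l 1) (σ.v 30)) [1, (σ.l 1).getD (σ.v 30) 0] =
      conjStep (σ.l 1) (σ.v 30) (1 :: Y') S[k] := by
    rw [List.take_succ_eq_append_getElem hk, List.foldl_append, hY']; rfl
  rw [hkey]
  have e30 := h.frame.v 30 (by simp)
  have hSk := hlt S[k] (by simp)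
  refine HT.blk_seq (by simp) (by simp [h.l, ha, hS, hv, hk]) ?_
  refine HT.cond (by simp) (fun h' => ?_) (fun h' => ?_)
  · simp [h.l, ha, hv, hS, hk] at h'
    refine HT.seq (pushRedProg_spec (by simp) (by simp [e30, h.l, h30]) (by simp [h.l])) (by simp) ?_
    intro υ hυ
    refine HT.blk (by simp) (by simp) ⟨by simp [hυ.frame.v, hv], ⟨?_, ?_⟩, ?_⟩
    · simp only [Frame.set_iff, Frame.setL_iff, effAll, eff, Nat.reduceLeDiff]
      exact Frame.trans (by simp [h.frame]) hυ.frame (by simp)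
    · intro b
      by_cases hb : b = 11
      · simp [hb, hυ.l, h.l, conjStep, h', hυ.frame.v, h31, e30]
      · simp [hb, hυ.l, h.l]
    · simp [hυ.frame.v, h31]
  · simp [h.l, ha, hv, hS, hk] at h'
    refine (pushRedProg_spec (by simp) (by simp [h.l, ha, hv, hS, hk, hSk]) (by simp [h.l])).mono
      (by simp) ?_
    intro υ hυ
    refine ⟨by simp [hυ.frame.v, hv], ⟨?_, ?_⟩, ?_⟩
    · simp only [Frame.set_iff, Nat.reduceLeDiff]
      exact Frame.trans (by simp [h.frame]) hυ.frame (by simp)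
    · intro b
      by_cases hb : b = 11
      · simp [hb, hυ.l, h.l, conjStep, h', ha, hS, hv, hk]
      · simp [hb, hυ.l, h.l]
    · simp [hυ.frame.v, h31]

end RAM

/-! ### Simultaneous conjugation of tuples in free groups -/

namespace FreeGroup

set_option linter.unusedSectionVars false

variable {α : Type*} [DecidableEq α]

/-- The inverse of a letter. -/
def linv (a : α × Bool) : α × Bool := (a.1, !a.2)

@[simp] theorem linv_linv (a : α × Bool) : linv (linv a) = a := by simp [linv]

theorem linv_ne (a : α × Bool) : linv a ≠ a := by
  intro h; have := congrArg Prod.snd h; simp [linv] at this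

theorem mk_linv (a : α × Bool) : mk [linv a] = (mk [a])⁻¹ := by simp [linv, inv_mk, invRev]

theorem toWord_mk_cons_mul (b : α × Bool) (h : FreeGroup α) :
    (mk [b] * h).toWord =
      if h.toWord.head? = some (linv b) then h.toWord.tail else b :: h.toWord := by
  have : mk [b] * h = mk (b :: h.toWord) := by
    conv_lhs => rw [← mk_toWord (x := h)]
    rw [mul_mk]; rfl
  rw [this, toWord_mk, reduce.cons, reduce_toWord]
  rcases h.toWord with _ | ⟨c, t⟩
  · simp
  · obtain ⟨b1, b2⟩ := b
    obtain ⟨c1, c2⟩ := c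
    simp only [linv, List.head?_cons, Option.some.injEq, Prod.mk.injEq, List.tail_cons]
    congr 1
    cases b2 <;> cases c2 <;> simp [eq_comm]

theorem toWord_mul_mk_singleton (h : FreeGroup α) (b : α × Bool) :
    (h * mk [b]).toWord =
      if h.toWord.getLast? = some (linv b) then h.toWord.dropLast else h.toWord ++ [b] := by
  have h1 : h * mk [b] = (mk [linv b] * h⁻¹)⁻¹ := by rw [mk_linv]; group
  have h2 : h.toWord = invRev (h⁻¹).toWord := by rw [toWord_inv, invRev_invRev]
  rw [h1, toWord_inv, toWord_mk_cons_mul, h2]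
  rcases (h⁻¹).toWord with _ | ⟨c, t⟩
  · simp [invRev, linv]
  · simp only [List.head?_cons, linv_linv, invRev, List.map_cons, List.reverse_cons,
      List.getLast?_append, List.getLast?_singleton, Option.some_or, Option.some.injEq,
      List.tail_cons, List.dropLast_concat]
    have : c = b ↔ ((c.1, !c.2) : α × Bool) = linv b := by
      rw [← Function.Involutive.injective (f := linv (α := α)) linv_linv |>.eq_iff]; rfl
    simp only [this]
    split_ifs
    · rfl
    · simp [linv]

/-- The conjugate `g ^ x = x⁻¹ * g * x`. -/
def cj (x g : FreeGroup α) : FreeGroup α := x⁻¹ * g * x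

@[simp] theorem cj_one_right (x : FreeGroup α) : cj x 1 = 1 := by simp [cj]
@[simp] theorem cj_one_left (g : FreeGroup α) : cj 1 g = g := by simp [cj]
theorem cj_cj (x y g : FreeGroup α) : cj y (cj x g) = cj (x * y) g := by simp [cj, mul_assoc]
theorem cj_inv_right (x g : FreeGroup α) : cj x g⁻¹ = (cj x g)⁻¹ := by simp [cj, mul_assoc]
theorem cj_ne_one {x g : FreeGroup α} (hg : g ≠ 1) : cj x g ≠ 1 := by
  intro h
  apply hg
  have : g = x * cj x g * x⁻¹ := by simp [cj, mul_assoc]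
  rw [this, h]; simp

theorem toWord_linv_mul (a : α × Bool) (h : FreeGroup α) :
    ((mk [a])⁻¹ * h).toWord =
      if h.toWord.head? = some a then h.toWord.tail else linv a :: h.toWord := by
  rw [← mk_linv, toWord_mk_cons_mul, linv_linv]

/-- Conjugation attaches one letter at each end, and each of them cancels exactly if the end of the
word matches it. The word must be nonempty, as otherwise the two new letters would cancel each
other. -/
theorem norm_cj {h : FreeGroup α} (hh : h ≠ 1) (a : α × Bool) :
    norm (cj (mk [a]) h) + (if h.toWord.head? = some a then 2 else 0) +
      (if h.toWord.getLast? = some (linv a) then 2 else 0) = norm h + 2 := by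
  have hw : h.toWord ≠ [] := by simpa [toWord_eq_nil_iff] using hh
  unfold cj norm
  rw [toWord_mul_mk_singleton, toWord_linv_mul]
  rcases hw' : h.toWord with _ | ⟨c, t⟩
  · exact absurd hw' hw
  · rcases List.eq_nil_or_concat t with rfl | ⟨s, d, rfl⟩
    · by_cases hc : c = a
      · subst hc; simp [(linv_ne c).symm]
      · by_cases hd : c = linv a <;> simp [hc, hd, linv_ne]
    · by_cases hc : c = a <;> by_cases hd : d = linv a <;>
        simp [hc, hd, List.getLast?_cons, List.getLast?_append]

theorem ite_some_eq_add_le {β : Type*} [DecidableEq β] (o : Option β) {a b : β} (hab : a ≠ b) :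
    (if o = some a then 2 else 0) + (if o = some b then 2 else 0) ≤ 2 := by
  split_ifs with h1 h2
  · exact absurd (Option.some.inj (h1.symm.trans h2)) hab
  all_goals simp

theorem ite_some_eq_add_add_le {β : Type*} [DecidableEq β] (o : Option β) {a b c : β}
    (hab : a ≠ b) (hac : a ≠ c) (hbc : b ≠ c) :
    (if o = some a then 2 else 0) + (if o = some b then 2 else 0) +
      (if o = some c then 2 else 0) ≤ 2 := by
  by_cases h1 : o = some a
  · simp [h1, hab, hac]
  · by_cases h2 : o = some b
    · simp [h2, hab.symm, hbc]
    · simp only [h1, h2, if_false]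
      split_ifs <;> simp

theorem linv_injective : Function.Injective (linv : α × Bool → α × Bool) :=
  Function.Involutive.injective linv_linv

/-- By `norm_cj` the two conjugations together attach four letters. At each end of the word only one
of the two letters can cancel, so they remove at most four. This is convexity of the displacement on
the Cayley tree. -/
theorem norm_cj_add_norm_cj (h : FreeGroup α) {b c : α × Bool} (hbc : b ≠ c) :
    2 * norm h ≤ norm (cj (mk [b]) h) + norm (cj (mk [c]) h) := by
  by_cases hh : h = 1
  · simp [hh]
  have h1 := norm_cj hh b
  have h2 := norm_cj hh c
  have e1 := ite_some_eq_add_le h.toWord.head? hbc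
  have e2 := ite_some_eq_add_le h.toWord.getLast? (linv_injective.ne hbc)
  linarith

/-- Three letters attach six letters in all, but still at most one cancellation per end occurs,
hence the strict inequality. -/
theorem norm_cj_add_norm_cj_add_norm_cj {h : FreeGroup α} (hh : h ≠ 1) {a b c : α × Bool}
    (hab : a ≠ b) (hac : a ≠ c) (hbc : b ≠ c) :
    3 * norm h < norm (cj (mk [a]) h) + norm (cj (mk [b]) h) + norm (cj (mk [c]) h) := by
  have h0 := norm_cj hh a
  have h1 := norm_cj hh b
  have h2 := norm_cj hh c
  have e1 := ite_some_eq_add_add_le h.toWord.head? hab hac hbc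
  have e2 := ite_some_eq_add_add_le h.toWord.getLast? (linv_injective.ne hab)
    (linv_injective.ne hac) (linv_injective.ne hbc)
  linarith

/-- Simultaneous conjugation. -/
def cjT (x : FreeGroup α) (U : List (FreeGroup α)) : List (FreeGroup α) := U.map (cj x)

/-- The total length of a tuple. -/
def size (U : List (FreeGroup α)) : ℕ := (U.map norm).sum

@[simp] theorem cjT_one (U : List (FreeGroup α)) : cjT 1 U = U := by
  simp [cjT, show cj (1 : FreeGroup α) = id from funext fun g => cj_one_left g]

theorem cjT_cjT (x y : FreeGroup α) (U : List (FreeGroup α)) :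
    cjT y (cjT x U) = cjT (x * y) U := by simp [cjT, cj_cj]

theorem cjT_inv_eq {x : FreeGroup α} {U V : List (FreeGroup α)} (h : cjT x U = V) :
    cjT x⁻¹ V = U := by rw [← h, cjT_cjT]; simp

theorem size_cjT_add_size_cjT (U : List (FreeGroup α)) {b c : α × Bool} (hbc : b ≠ c) :
    2 * size U ≤ size (cjT (mk [b]) U) + size (cjT (mk [c]) U) := by
  induction U with
  | nil => simp [size, cjT]
  | cons g U ih =>
    have := norm_cj_add_norm_cj g hbc
    simp only [size, cjT, List.map_cons, List.sum_cons] at ih ⊢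
    omega

/-- One nontrivial entry gives strictness, and the others contribute the weak inequality.
Consequently at most two letters can preserve the size at a point of a flat path; this makes flat
paths rigid. -/
theorem size_cjT_add_size_cjT_add_size_cjT {U : List (FreeGroup α)} (hU : ∃ g ∈ U, g ≠ 1)
    {a b c : α × Bool} (hab : a ≠ b) (hac : a ≠ c) (hbc : b ≠ c) :
    3 * size U < size (cjT (mk [a]) U) + size (cjT (mk [b]) U) + size (cjT (mk [c]) U) := by
  -- Half the sum of the three inequalities for pairs of letters.
  have weak : ∀ W : List (FreeGroup α), 3 * size W ≤
      size (cjT (mk [a]) W) + size (cjT (mk [b]) W) + size (cjT (mk [c]) W) := fun W => by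
    have := size_cjT_add_size_cjT W hab
    have := size_cjT_add_size_cjT W hac
    have := size_cjT_add_size_cjT W hbc
    omega
  obtain ⟨g, hg, hg1⟩ := hU
  obtain ⟨s, t, rfl⟩ := List.append_of_mem hg
  have h1 := weak s
  have h2 := weak t
  have h3 := norm_cj_add_norm_cj_add_norm_cj hg1 hab hac hbc
  simp only [size, cjT, List.map_append, List.map_cons, List.sum_append, List.sum_cons]
    at h1 h2 ⊢
  omega

theorem cjT_exists_ne_one {x : FreeGroup α} {U : List (FreeGroup α)} (hU : ∃ g ∈ U, g ≠ 1) :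
    ∃ g ∈ cjT x U, g ≠ 1 := by
  obtain ⟨g, hg, hg1⟩ := hU
  exact ⟨cj x g, List.mem_map_of_mem hg, cj_ne_one hg1⟩

theorem norm_le_size {g : FreeGroup α} {U : List (FreeGroup α)} (hg : g ∈ U) :
    norm g ≤ size U := by
  exact List.single_le_sum (by simp) _ (List.mem_map_of_mem hg)

/-! ### Convexity along reduced paths. -/

theorem isReduced_iff_linv {p : List (α × Bool)} :
    IsReduced p ↔ ∀ i (hi : i + 1 < p.length), p[i + 1] ≠ linv p[i] := by
  have : ∀ a b : α × Bool, (a.1 = b.1 → a.2 = b.2) ↔ b ≠ linv a := by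
    rintro ⟨a, x⟩ ⟨b, y⟩
    simp only [linv, ne_eq, Prod.mk.injEq, not_and]
    constructor
    · rintro h rfl; simp at h; simp [h]
    · rintro h rfl; simp at h; simp [h]
  simp only [IsReduced, List.isChain_iff_getElem, this]

theorem mk_take_succ {p : List (α × Bool)} {i : ℕ} (hi : i < p.length) :
    mk (p.take (i + 1)) = mk (p.take i) * mk [p[i]] := by
  rw [List.take_succ_eq_append_getElem hi, mul_mk]

/-- Seen from the middle point, its two neighbours are conjugates by the letters `linv p[i]` and
`p[i + 1]`, which differ because the path is reduced. -/
theorem size_cjT_take_convex (U : List (FreeGroup α)) {p : List (α × Bool)} (hp : IsReduced p)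
    {i : ℕ} (hi : i + 1 < p.length) :
    2 * size (cjT (mk (p.take (i + 1))) U) ≤
      size (cjT (mk (p.take i)) U) + size (cjT (mk (p.take (i + 2))) U) := by
  have h1 := size_cjT_add_size_cjT (cjT (mk (p.take (i + 1))) U)
    ((isReduced_iff_linv.1 hp i hi).symm)
  rw [cjT_cjT, cjT_cjT, mk_linv, ← mk_take_succ hi, mk_take_succ (by omega : i < p.length),
    mul_assoc, mul_inv_cancel, mul_one, ← mk_take_succ (by omega : i < p.length)] at h1
  exact h1

/-! ### Flat paths between local minima. -/

/-- Conjugation along the reduced path `p` does not change the total length of `U`. -/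
def Flat (U : List (FreeGroup α)) (p : List (α × Bool)) : Prop :=
  IsReduced p ∧ ∀ i ≤ p.length, size (cjT (mk (p.take i)) U) = size U

theorem Flat.take {U : List (FreeGroup α)} {p : List (α × Bool)} (h : Flat U p) (n : ℕ) :
    Flat U (p.take n) := by
  refine ⟨h.1.infix (List.take_prefix n p).isInfix, fun i hi => ?_⟩
  simp only [List.length_take, le_min_iff] at hi
  rw [List.take_take, min_eq_left hi.1]
  exact h.2 i hi.2

theorem Flat.drop {U : List (FreeGroup α)} {p : List (α × Bool)} (h : Flat U p) {n : ℕ}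
    (hn : n ≤ p.length) : Flat (cjT (mk (p.take n)) U) (p.drop n) := by
  refine ⟨h.1.infix (List.drop_suffix n p).isInfix, fun i hi => ?_⟩
  simp only [List.length_drop] at hi
  rw [cjT_cjT, mul_mk, ← List.take_add, h.2 _ (by omega), h.2 _ hn]

theorem flat_nil (U : List (FreeGroup α)) : Flat U [] := by
  refine ⟨by simp [IsReduced], fun i _ => ?_⟩
  simp [← one_eq_mk]

/-- The local criterion by which the machine prolongs a flat path: the next letter preserves the
size and does not backtrack. -/
theorem flat_concat {U : List (FreeGroup α)} {p : List (α × Bool)} {b : α × Bool} :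
    Flat U (p ++ [b]) ↔ Flat U p ∧ size (cjT (mk (p ++ [b])) U) = size U ∧
      ∀ a, p.getLast? = some a → b ≠ linv a := by
  constructor
  · intro h
    refine ⟨by simpa using h.take p.length, ?_, ?_⟩
    · have := h.2 (p ++ [b]).length le_rfl
      rwa [List.take_length] at this
    intro a ha
    obtain ⟨q, rfl⟩ := List.getLast?_eq_some_iff.1 ha
    simpa using isReduced_iff_linv.1 h.1 q.length (by simp)
  · rintro ⟨h1, h2, h3⟩
    refine ⟨isReduced_iff_linv.2 fun i hi => ?_, fun i hi => ?_⟩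
    · simp at hi
      rcases Nat.lt_or_ge (i + 1) p.length with h | h
      · simpa [List.getElem_append_left, h, hi] using isReduced_iff_linv.1 h1.1 i h
      · have hpi : p.length = i + 1 := by omega
        have := h3 p[i] (by rw [List.getLast?_eq_getElem?, hpi]; simp)
        simpa [List.getElem_append, hpi] using this
    · simp at hi
      rcases Nat.lt_or_ge p.length i with h | h
      · rw [List.take_of_length_le (by simp; omega)]; exact h2
      · rw [List.take_append_of_le_length h]; exact h1.2 i h

/-- No letter shortens the tuple. -/
def LocalMin (U : List (FreeGroup α)) : Prop := ∀ a, size U ≤ size (cjT (mk [a]) U)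

/-- A convex sequence that does not decrease in its first step and does not increase in its last
step is constant. -/
theorem LocalMin.flat {U V : List (FreeGroup α)} (hU : LocalMin U) (hV : LocalMin V)
    {p : List (α × Bool)} (hp : IsReduced p) (h : cjT (mk p) U = V) : Flat U p := by
  set f : ℕ → ℕ := fun i => size (cjT (mk (p.take i)) U) with hf
  have conv : ∀ i, i + 1 < p.length → 2 * f (i + 1) ≤ f i + f (i + 1 + 1) :=
    fun i hi => size_cjT_take_convex U hp hi
  have f0 : f 0 = size U := by simp [hf, ← one_eq_mk]
  -- Minimality of `U` starts the induction, and convexity carries it forward.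
  have up : ∀ i < p.length, f i ≤ f (i + 1) := by
    intro i hi
    induction i with
    | zero =>
      have := hU p[0]
      rw [f0]
      simpa [hf, mk_take_succ hi, ← one_eq_mk] using this
    | succ i ih =>
      have := conv i hi
      have := ih (by omega)
      omega
  have last : ∀ i, i + 1 = p.length → f (i + 1) ≤ f i := by
    intro i hi
    have e1 : cjT (mk (p.take (i + 1))) U = V := by rw [hi, List.take_length, h]
    have e2 : cjT (mk (p.take i)) U = cjT (mk [linv p[i]]) V := by
      rw [← e1, cjT_cjT, mk_take_succ (by omega), mk_linv, mul_assoc, mul_inv_cancel, mul_one]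
    simp only [hf, e1, e2]
    exact hV _
  -- The same from the other end, where minimality of `V` starts the induction; `j` counts the steps
  -- from the end.
  have down : ∀ j i, i + 1 + j = p.length → f (i + 1) ≤ f i := by
    intro j
    induction j with
    | zero => exact last
    | succ j ih =>
      intro i hi
      have := ih (i + 1) (by omega)
      have := conv i (by omega)
      omega
  refine ⟨hp, fun i hi => ?_⟩
  change f i = _
  induction i with
  | zero => exact f0
  | succ i ih =>
    rw [← ih (by omega)]
    exact le_antisymm (down (p.length - (i + 1)) i (by omega)) (up i hi)

/-- At a point where two flat paths part after a common nonempty prefix, three letters would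
preserve the size: the way back and the two continuations. For a nontrivial tuple this is
impossible. -/
theorem Flat.unique {U : List (FreeGroup α)} (hU : ∃ g ∈ U, g ≠ 1) {p q : List (α × Bool)}
    (hp : Flat U p) (hq : Flat U q) (h0 : p.head? = q.head?) :
    ∀ i, i ≤ p.length → i ≤ q.length → p.take i = q.take i := by
  intro i
  induction i with
  | zero => simp
  | succ i ih =>
    intro hip hiq
    have hi := ih (by omega) (by omega)
    rw [List.take_succ_eq_append_getElem hip, List.take_succ_eq_append_getElem hiq, hi]
    congr 2
    rcases i with _ | i
    · rw [List.head?_eq_getElem?, List.head?_eq_getElem?, List.getElem?_eq_getElem hip,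
        List.getElem?_eq_getElem hiq] at h0
      exact Option.some.inj h0
    have hpi : p[i] = q[i] := by
      have := congrArg (fun l => l[i]?) hi
      simpa [List.getElem?_take, show i < p.length by omega, show i < q.length by omega] using this
    by_contra hne
    have := size_cjT_add_size_cjT_add_size_cjT
      (cjT_exists_ne_one (x := mk (p.take (i + 1))) hU)
      (isReduced_iff_linv.1 hp.1 i hip).symm
      (by rw [hpi]; exact (isReduced_iff_linv.1 hq.1 i hiq).symm) hne
    rw [cjT_cjT, cjT_cjT, cjT_cjT, mk_linv, ← mk_take_succ hip, hi, ← mk_take_succ hiq,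
      hpi, mk_take_succ (p := q) (by omega : i < q.length), mul_assoc, mul_inv_cancel, mul_one,
      ← mk_take_succ (p := q) (by omega : i < q.length),
      hq.2 _ (by omega), hq.2 _ (by omega), hq.2 _ (by omega), hp.2 _ (by omega)] at this
    omega

/-- A flat path of a single element that starts with its first letter runs along its word. -/
theorem Flat.getElem?_eq_of_head? {g : FreeGroup α} (hg : g ≠ 1) {p : List (α × Bool)}
    (hp : Flat [g] p) (h0 : ∀ a, p.head? = some a → g.toWord.head? = some a) :
    ∀ i < p.length, p[i]? = g.toWord[i % g.toWord.length]? := by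
  induction p generalizing g with
  | nil => simp
  | cons a p ih =>
    obtain ⟨t, ht⟩ : ∃ t, g.toWord = a :: t := by
      have := h0 a rfl
      rcases hw : g.toWord with _ | ⟨b, t⟩
      · simp [hw] at this
      · rw [hw] at this; exact ⟨t, by simpa using this⟩
    have hn := norm_cj hg a
    have e1 : norm (cj (mk [a]) g) = norm g := by
      simpa [size, cjT] using hp.2 1 (by simp)
    rw [e1] at hn
    -- The length is preserved and the first letter cancels, so nothing cancels at the end: the
    -- conjugation rotates the word by one letter.
    have hl : t.getLast? ≠ some (linv a) := by
      intro h
      rw [ht] at hn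
      simp [List.getLast?_cons, h] at hn
    have hw : (cj (mk [a]) g).toWord = t ++ [a] := by
      rw [cj, toWord_mul_mk_singleton, toWord_linv_mul, ht]
      simp [hl]
    have hp' : Flat [cj (mk [a]) g] p := by simpa [cjT] using hp.drop (n := 1) (by simp)
    -- The rotated word ends with `a`. As the path does not backtrack, its next letter cannot cancel
    -- there, so the cancellation that keeps the length must occur at the front.
    have ih' := ih (cj_ne_one hg) hp' (fun b hb => by
      rcases p with _ | ⟨b', p⟩
      · simp at hb
      obtain rfl : b' = b := by simpa using hb
      have hn' := norm_cj (cj_ne_one (x := mk [a]) hg) b'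
      have e2 : norm (cj (mk [b']) (cj (mk [a]) g)) = norm (cj (mk [a]) g) := by
        simpa [size, cjT] using hp'.2 1 (by simp)
      have hb' : b' ≠ linv a := by simpa using isReduced_iff_linv.1 hp.1 0 (by simp)
      have : a ≠ linv b' := fun h => hb' (by rw [h, linv_linv])
      rw [e2, hw] at hn'
      by_contra hc
      rw [hw] at hc
      rw [if_neg hc] at hn'
      simp [this] at hn')
    intro i hi
    rcases i with _ | i
    · simp [ht]
    · have hi' : i < p.length := by simpa using hi
      rw [List.getElem?_cons_succ, ih' i hi', hw, ht]
      simp only [List.length_append, List.length_cons, List.length_nil]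
      have hr : t ++ [a] = (a :: t).rotate 1 := by simp
      have hpos : 0 < t.length + 1 := by omega
      rw [hr, List.getElem?_rotate (by simpa using Nat.mod_lt _ hpos)]
      simp

/-- A flat path of a single element runs along its word or along its inverse. -/
theorem Flat.exists_periodic {g : FreeGroup α} (hg : g ≠ 1) {p : List (α × Bool)}
    (hp : Flat [g] p) : ∃ w, (mk w = g ∨ mk w = g⁻¹) ∧ w.length = norm g ∧ w ≠ [] ∧
      ∀ i < p.length, p[i]? = w[i % w.length]? := by
  rcases p with _ | ⟨a, p⟩
  · exact ⟨g.toWord, .inl mk_toWord, rfl, by simpa [toWord_eq_nil_iff], by simp⟩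
  have e1 : norm (cj (mk [a]) g) = norm g := by
    simpa [size, cjT] using hp.2 1 (by simp)
  have hn := norm_cj hg a
  rw [e1] at hn
  by_cases h : g.toWord.head? = some a
  · exact ⟨g.toWord, .inl mk_toWord, rfl, by simpa [toWord_eq_nil_iff],
      hp.getElem?_eq_of_head? hg (by simpa using h)⟩
  -- If `a` does not cancel at the front, it cancels at the end, and then the word of the inverse
  -- element begins with `a`.
  · have hl : g.toWord.getLast? = some (linv a) := by
      by_contra hc
      simp [h, hc] at hn
    have hp' : Flat [g⁻¹] (a :: p) := by
      refine ⟨hp.1, fun i hi => ?_⟩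
      simpa [size, cjT, cj_inv_right] using hp.2 i hi
    refine ⟨g⁻¹.toWord, .inr mk_toWord, norm_inv_eq,
      fun h => hg (by simpa using toWord_eq_nil_iff.1 h),
      hp'.getElem?_eq_of_head? (by simpa) ?_⟩
    obtain ⟨t, ht⟩ := List.getLast?_eq_some_iff.1 hl
    rw [toWord_inv, ht]
    simp [invRev, linv]

theorem eq_of_sum_map_eq {β : Type*} {l : List β} {f g : β → ℕ} (h : ∀ x ∈ l, f x ≤ g x)
    (hs : (l.map f).sum = (l.map g).sum) : ∀ x ∈ l, f x = g x := by
  induction l with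
  | nil => simp
  | cons a l ih =>
    have h1 := h a (by simp)
    have h2 : (l.map f).sum ≤ (l.map g).sum :=
      List.sum_le_sum fun x hx => h x (by simp [hx])
    simp only [List.map_cons, List.sum_cons] at hs
    intro x hx
    rcases List.mem_cons.1 hx with rfl | hx
    · omega
    · exact ih (fun x hx => h x (by simp [hx])) (by omega) x hx

/-- Along a flat path, the single elements keep their lengths until near the end. -/
theorem Flat.single {U : List (FreeGroup α)} {p : List (α × Bool)} (hp : Flat U p)
    {u : FreeGroup α} (hu : u ∈ U) : Flat [u] (p.take (p.length - size U)) := by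
  have le : ∀ v ∈ U, ∀ i, i + size U < p.length →
      norm (cj (mk (p.take (i + 1))) v) ≤ norm (cj (mk (p.take i)) v) := by
    intro v hv i hi
    by_contra! hlt
    -- An entry that grows once grows at every later step by convexity, and after `size U` further
    -- steps it would be longer than the whole tuple.
    have grow : ∀ k, i + k + 1 ≤ p.length →
        norm (cj (mk (p.take (i + k))) v) < norm (cj (mk (p.take (i + k + 1))) v) ∧
        k + 1 ≤ norm (cj (mk (p.take (i + k + 1))) v) := by
      intro k
      induction k with
      | zero => intro _; exact ⟨hlt, by simpa using Nat.one_le_of_lt hlt⟩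
      | succ k ih =>
        intro hk
        have h1 := ih (by omega)
        have h2 := size_cjT_take_convex [v] hp.1 (i := i + k) (by omega)
        simp only [size, cjT, List.map_cons, List.map_nil, List.sum_cons, List.sum_nil] at h2
        have e : i + (k + 1) = i + k + 1 := by omega
        have e' : i + k + 1 + 1 = i + k + 2 := by omega
        rw [e, e']
        omega
    have h1 := (grow (size U) (by omega)).2
    have h2 := norm_le_size (List.mem_map_of_mem (f := cj (mk (p.take (i + size U + 1)))) hv)
    have h3 := hp.2 (i + size U + 1) (by omega)
    rw [cjT] at h3
    omega
  -- No entry grows and the sum is constant, so every entry keeps its length.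
  have eq : ∀ i, i + size U < p.length →
      norm (cj (mk (p.take (i + 1))) u) = norm (cj (mk (p.take i)) u) := by
    intro i hi
    refine eq_of_sum_map_eq (f := fun v => norm (cj (mk (p.take (i + 1))) v))
      (g := fun v => norm (cj (mk (p.take i)) v)) (fun v hv => le v hv i hi) ?_ u hu
    have h1 := hp.2 (i + 1) (by omega)
    have h2 := hp.2 i (by omega)
    rw [← h2] at h1
    simpa [size, cjT, Function.comp_def] using h1
  refine ⟨(hp.take _).1, fun i hi => ?_⟩
  simp only [List.length_take] at hi
  rw [List.take_take, min_eq_left (by omega)]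
  simp only [size, cjT, List.map_cons, List.map_nil, List.sum_cons, List.sum_nil, add_zero]
  induction i with
  | zero => simp [← one_eq_mk]
  | succ i ih => rw [eq i (by omega), ih (by omega)]

/-- A long flat path returns to its starting point, with the same next letter. -/
theorem Flat.exists_return {U : List (FreeGroup α)} (hU : ∃ g ∈ U, g ≠ 1) {p : List (α × Bool)}
    (hp : Flat U p) (hlen : 3 * size U < p.length) :
    ∃ n, 0 < n ∧ n ≤ size U ∧ p[n]? = p[0]? ∧ cjT (mk (p.take n)) U = U := by
  obtain ⟨g, hgU, hg⟩ := hU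
  -- Of the `3 * size U` letters, `Flat.single` gives up `size U`; the rest has room for two periods
  -- of length at most `size U` each.
  set q := p.take (p.length - size U) with hq
  have hql : 2 * size U < q.length := by simp [hq]; omega
  have hqp : ∀ i < q.length, q[i]? = p[i]? := by
    intro i hi
    rw [hq, List.getElem?_take_of_lt]
    simp [hq] at hi; omega
  obtain ⟨w, hw, hwl, hw0, hwq⟩ := (hp.single hgU).exists_periodic hg
  rw [← hq] at hwq
  have hwS : w.length ≤ size U := hwl ▸ norm_le_size hgU
  have hwpos := List.length_pos_iff.2 hw0
  -- For two periods `w'` and `w''` of `q`, the word `w' ++ w''` is a prefix of `q`. With the roles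
  -- exchanged, so is `w'' ++ w'`, and hence the periods commute.
  have pre : ∀ w' : List (α × Bool), w'.length ≤ size U → 0 < w'.length →
      (∀ i < q.length, q[i]? = w'[i % w'.length]?) → ∀ w'' : List (α × Bool),
      w''.length ≤ size U → 0 < w''.length →
      (∀ i < q.length, q[i]? = w''[i % w''.length]?) →
      w' ++ w'' = q.take (w'.length + w''.length) := by
    intro w' h1 h2 h3 w'' h4 h5 h6
    apply List.ext_getElem?
    intro i
    rcases Nat.lt_or_ge i (w'.length + w''.length) with hi | hi
    · rw [List.getElem?_take_of_lt hi]
      rcases Nat.lt_or_ge i w'.length with hi' | hi'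
      · rw [List.getElem?_append_left hi', h3 i (by omega), Nat.mod_eq_of_lt hi']
      · rw [List.getElem?_append_right hi', h3 i (by omega), Nat.mod_eq_sub_mod hi',
          ← h3 _ (by omega), h6 _ (by omega), Nat.mod_eq_of_lt (by omega)]
    · rw [List.getElem?_eq_none (by simpa using hi),
        List.getElem?_eq_none (by simp; omega)]
  -- Every nontrivial entry is, up to inversion, represented by a period of `q`. So the period `w`
  -- of one entry centralizes the tuple, and conjugation by it returns to `U`.
  have comm : ∀ u ∈ U, Commute (mk w) u := by
    intro u huU
    by_cases hu : u = 1
    · subst hu; exact Commute.one_right _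
    obtain ⟨w', hw', hwl', hw0', hwq'⟩ := (hp.single huU).exists_periodic hu
    have hwS' : w'.length ≤ size U := hwl' ▸ norm_le_size huU
    have hwpos' := List.length_pos_iff.2 hw0'
    have e1 := pre w hwS hwpos hwq w' hwS' hwpos' hwq'
    have e2 := pre w' hwS' hwpos' hwq' w hwS hwpos hwq
    have e3 : w ++ w' = w' ++ w := by rw [e1, e2, add_comm]
    have e4 : Commute (mk w) (mk w') := by
      change mk w * mk w' = mk w' * mk w
      rw [mul_mk, mul_mk, e3]
    rcases hw' with h | h
    · rwa [h] at e4
    · rw [h] at e4; simpa using e4.inv_right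
  have hpw : p.take w.length = w := by
    apply List.ext_getElem?
    intro i
    rcases Nat.lt_or_ge i w.length with hi | hi
    · rw [List.getElem?_take_of_lt hi, ← hqp i (by omega), hwq i (by omega), Nat.mod_eq_of_lt hi]
    · rw [List.getElem?_eq_none hi, List.getElem?_eq_none (by simp; omega)]
  refine ⟨w.length, hwpos, hwS, ?_, ?_⟩
  · rw [← hqp _ (by omega), ← hqp 0 (by omega), hwq _ (by omega), hwq 0 (by omega)]
    simp
  · rw [hpw, cjT]
    conv_rhs => rw [← List.map_id U]
    refine List.map_congr_left fun u hu => ?_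
    have := comm u hu
    simp only [cj, id]
    rw [mul_assoc, ← this.eq, inv_mul_cancel_left]

/-- A flat path that cannot be prolonged comprises all flat paths with the same first letter. -/
theorem Flat.eq_take_of_maximal {U : List (FreeGroup α)} (hU : ∃ g ∈ U, g ≠ 1)
    {p y : List (α × Bool)} (hp : Flat U p) (hmax : ∀ b, ¬ Flat U (p ++ [b])) (hy : Flat U y)
    (h0 : p.head? = y.head?) : y.length ≤ p.length ∧ y = p.take y.length := by
  have hle : y.length ≤ p.length := by
    by_contra! hlt
    have e := Flat.unique hU hp hy h0 p.length le_rfl hlt.le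
    apply hmax y[p.length]
    rw [List.take_length] at e
    nth_rw 1 [e]
    rw [← List.take_succ_eq_append_getElem hlt]
    exact hy.take _
  have e := Flat.unique hU hp hy h0 y.length hle le_rfl
  rw [List.take_length] at e
  exact ⟨hle, e.symm⟩

/-- A flat path that returns to its starting point is repeated by all flat paths with the same
first letter. -/
theorem Flat.eq_cycle {U : List (FreeGroup α)} (hU : ∃ g ∈ U, g ≠ 1) {p : List (α × Bool)}
    {a : α × Bool} (hp : Flat U (p ++ [a])) (h0 : p.head? = some a) (hpU : cjT (mk p) U = U) :
    ∀ n, ∀ y : List (α × Bool), y.length = n → Flat U y → (y = [] ∨ y.head? = some a) →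
      (∀ i < y.length, y[i]? = p[i % p.length]?) ∧
        cjT (mk y) U = cjT (mk (p.take (y.length % p.length))) U := by
  have hpos : 0 < p.length := by
    rcases p with _ | _ <;> simp at h0 ⊢
  intro n
  induction n using Nat.strong_induction_on with
  | _ n ih =>
    rintro y rfl hy hy0
    rcases hy0 with rfl | hy0
    · simp
    have huniq := Flat.unique hU hp hy (by rw [List.head?_append, h0, hy0]; rfl)
    rcases Nat.lt_or_ge y.length p.length with hlt | hge
    · have e := huniq y.length (by simp; omega) le_rfl
      rw [List.take_length, List.take_append_of_le_length hlt.le] at e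
      refine ⟨fun i hi => ?_, by rw [Nat.mod_eq_of_lt hlt, e]⟩
      rw [Nat.mod_eq_of_lt (by omega), ← e, List.getElem?_take_of_lt hi]
    · have e := huniq p.length (by simp) hge
      rw [List.take_append_of_le_length le_rfl, List.take_length] at e
      have hy' := hy.drop hge
      rw [← e, hpU] at hy'
      have hsplit : y = p ++ y.drop p.length := by
        conv_lhs => rw [← List.take_append_drop p.length y, ← e]
      -- After one period the remainder is again a flat path for `U`. Its first letter is `a`, by
      -- uniqueness applied to `p ++ [a]`.
      obtain ⟨k1, k2⟩ := ih (y.drop p.length).length (by simp; omega) _ rfl hy' (by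
        rcases Nat.lt_or_ge p.length y.length with h | h
        · right
          have e' := huniq (p.length + 1) (by simp) h
          rw [List.take_of_length_le (by simp), List.take_succ_eq_append_getElem h, ← e] at e'
          rw [List.head?_drop, List.getElem?_eq_getElem h]
          simpa using e'.symm
        · left; simp [h])
      have hm : (y.drop p.length).length % p.length = y.length % p.length := by
        rw [List.length_drop, ← Nat.mod_eq_sub_mod hge]
      refine ⟨fun i hi => ?_, ?_⟩
      · rcases Nat.lt_or_ge i p.length with h | h
        · rw [hsplit, List.getElem?_append_left h, Nat.mod_eq_of_lt h]
        · rw [hsplit, List.getElem?_append_right h, k1 _ (by simp; omega), ← Nat.mod_eq_sub_mod h]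
      · rw [hm] at k2
        rw [← k2]
        conv_lhs => rw [hsplit, ← mul_mk, ← cjT_cjT, hpU]

end FreeGroup

/-! ### Graphs labelled by letters -/

namespace FreeGroup

section Graph

variable {α : Type*} [DecidableEq α]

set_option linter.unusedSectionVars false

/-- The word `w` is the label of a path from `u` to `v`. -/
def Reads (G : List (ℕ × (α × Bool) × ℕ)) : List (α × Bool) → ℕ → ℕ → Prop
  | [], u, v => u = v
  | c :: w, u, v => ∃ t, (u, c, t) ∈ G ∧ Reads G w t v

theorem Reads.append {G : List (ℕ × (α × Bool) × ℕ)} {w w' : List (α × Bool)} {u v t : ℕ}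
    (h : Reads G w u v) (h' : Reads G w' v t) : Reads G (w ++ w') u t := by
  induction w generalizing u with
  | nil => simp only [Reads] at h; subst h; exact h'
  | cons c w ih => obtain ⟨s, h1, h2⟩ := h; exact ⟨s, h1, ih h2⟩

theorem reads_append {G : List (ℕ × (α × Bool) × ℕ)} {w w' : List (α × Bool)} {u t : ℕ} :
    Reads G (w ++ w') u t ↔ ∃ v, Reads G w u v ∧ Reads G w' v t := by
  constructor
  · intro h
    induction w generalizing u with
    | nil => exact ⟨u, rfl, h⟩
    | cons c w ih =>
      obtain ⟨s, h1, h2⟩ := h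
      obtain ⟨v, h3, h4⟩ := ih h2
      exact ⟨v, ⟨s, h1, h3⟩, h4⟩
  · rintro ⟨v, h1, h2⟩; exact h1.append h2

theorem Reads.mono {G G' : List (ℕ × (α × Bool) × ℕ)} (hG : ∀ e ∈ G, e ∈ G')
    {w : List (α × Bool)} {u v : ℕ} (h : Reads G w u v) : Reads G' w u v := by
  induction w generalizing u with
  | nil => exact h
  | cons c w ih => obtain ⟨s, h1, h2⟩ := h; exact ⟨s, hG _ h1, ih h2⟩

def mapVerts (ρ : ℕ → ℕ) (G : List (ℕ × (α × Bool) × ℕ)) : List (ℕ × (α × Bool) × ℕ) :=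
  G.map fun e => (ρ e.1, e.2.1, ρ e.2.2)

theorem mem_mapVerts {ρ : ℕ → ℕ} {G : List (ℕ × (α × Bool) × ℕ)} {s t : ℕ} {c : α × Bool} :
    (s, c, t) ∈ mapVerts ρ G ↔ ∃ s' t', (s', c, t') ∈ G ∧ ρ s' = s ∧ ρ t' = t := by
  simp only [mapVerts, List.mem_map, Prod.mk.injEq]
  constructor
  · rintro ⟨⟨s', c', t'⟩, h, h1, rfl, h2⟩; exact ⟨s', t', h, h1, h2⟩
  · rintro ⟨s', t', h, h1, h2⟩; exact ⟨(s', c, t'), h, h1, rfl, h2⟩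

theorem Reads.map (ρ : ℕ → ℕ) {G : List (ℕ × (α × Bool) × ℕ)}
    {w : List (α × Bool)} {u v : ℕ} (h : Reads G w u v) :
    Reads (mapVerts ρ G) w (ρ u) (ρ v) := by
  induction w generalizing u with
  | nil => exact congrArg ρ h
  | cons c w ih => obtain ⟨s, h1, h2⟩ := h; exact ⟨_, mem_mapVerts.2 ⟨_, _, h1, rfl, rfl⟩, ih h2⟩

/-- The vertices of `G` are mapped to cosets of `A` consistently with the edges, and every mark
`(w, v)` is a vertex `v` that is reached from the base `b` by reading `w`. -/
structure GraphInv (A : Subgroup (FreeGroup α)) (G : List (ℕ × (α × Bool) × ℕ)) (b : ℕ)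
    (M : List (List (α × Bool) × ℕ)) (φ : ℕ → FreeGroup α) : Prop where
  intro ::
  symm : ∀ s c t, (s, c, t) ∈ G → (t, linv c, s) ∈ G
  edge : ∀ s c t, (s, c, t) ∈ G → φ s * mk [c] * (φ t)⁻¹ ∈ A
  base : φ b ∈ A
  reads : ∀ w v, (w, v) ∈ M → Reads G w b v
  mark : ∀ w v, (w, v) ∈ M → mk w * (φ v)⁻¹ ∈ A

variable {A : Subgroup (FreeGroup α)} {G : List (ℕ × (α × Bool) × ℕ)} {b : ℕ}
  {M : List (List (α × Bool) × ℕ)} {φ : ℕ → FreeGroup α}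

theorem graphInv_nil (A : Subgroup (FreeGroup α)) : GraphInv A [] 0 [([], 0)] (fun _ => 1) where
  symm := by simp
  edge := by simp
  base := one_mem A
  reads := by simp [Reads]
  mark := by simp [← one_eq_mk, one_mem]

theorem GraphInv.mono (h : GraphInv A G b M φ) {M' : List (List (α × Bool) × ℕ)}
    (hM : ∀ m ∈ M', m ∈ M) : GraphInv A G b M' φ where
  symm := h.symm
  edge := h.edge
  base := h.base
  reads w v hm := h.reads w v (hM _ hm)
  mark w v hm := h.mark w v (hM _ hm)

theorem GraphInv.mark_base (h : GraphInv A G b M φ) : GraphInv A G b (([], b) :: M) φ where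
  symm := h.symm
  edge := h.edge
  base := h.base
  reads w v hm := by
    rcases List.mem_cons.1 hm with hm | hm
    · obtain ⟨rfl, rfl⟩ := Prod.mk.inj hm; rfl
    · exact h.reads w v hm
  mark w v hm := by
    rcases List.mem_cons.1 hm with hm | hm
    · obtain ⟨rfl, rfl⟩ := Prod.mk.inj hm
      simpa [← one_eq_mk] using h.base
    · exact h.mark w v hm

/-- Vertices may be identified if they represent the same coset of `A`. The representatives `φ` need
not change, because all conditions depend only on cosets. -/
theorem GraphInv.relabel (h : GraphInv A G b M φ) {x y : ℕ} (hxy : φ x * (φ y)⁻¹ ∈ A) :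
    GraphInv A (mapVerts (RAM.relabel x y) G) (RAM.relabel x y b)
      (M.map fun m => (m.1, RAM.relabel x y m.2)) φ := by
  have key : ∀ z, φ z * (φ (RAM.relabel x y z))⁻¹ ∈ A := by
    intro z
    unfold RAM.relabel
    split_ifs with hz
    · subst hz; simpa using inv_mem hxy
    · simp [one_mem]
  constructor
  · rintro s c t hm
    obtain ⟨s', t', h1, rfl, rfl⟩ := mem_mapVerts.1 hm
    exact mem_mapVerts.2 ⟨_, _, h.symm _ _ _ h1, rfl, rfl⟩
  · rintro s c t hm
    obtain ⟨s', t', h1, rfl, rfl⟩ := mem_mapVerts.1 hm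
    have := mul_mem (mul_mem (inv_mem (key s')) (h.edge _ _ _ h1)) (key t')
    simpa [mul_assoc] using this
  · have := mul_mem (inv_mem (key b)) h.base
    simpa [mul_assoc] using this
  · intro w v hm
    obtain ⟨⟨w', v'⟩, h1, h2⟩ := List.mem_map.1 hm
    obtain ⟨rfl, rfl⟩ := Prod.mk.inj h2
    exact (h.reads _ _ h1).map _
  · intro w v hm
    obtain ⟨⟨w', v'⟩, h1, h2⟩ := List.mem_map.1 hm
    obtain ⟨rfl, rfl⟩ := Prod.mk.inj h2
    have := mul_mem (h.mark _ _ h1) (key v')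
    simpa [mul_assoc] using this

/-- Both targets represent the coset of `φ s * mk [c]`; this justifies folding them together. -/
theorem GraphInv.conflict (h : GraphInv A G b M φ) {s x y : ℕ} {c : α × Bool}
    (hx : (s, c, x) ∈ G) (hy : (s, c, y) ∈ G) : φ x * (φ y)⁻¹ ∈ A := by
  have := mul_mem (inv_mem (h.edge _ _ _ hx)) (h.edge _ _ _ hy)
  simpa [mul_assoc, -mul_mk, -inv_mk] using this

/-- The vertex `v` is new, so its representative can be chosen to fit the edge. -/
theorem GraphInv.addEdge (h : GraphInv A G b M φ) {w : List (α × Bool)} {u v : ℕ}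
    (c : α × Bool) (hu : (w, u) ∈ M) (huv : u ≠ v) (hb : b ≠ v) (hG : ∀ e ∈ G, e.1 ≠ v ∧ e.2.2 ≠ v)
    (hM : ∀ m ∈ M, m.2 ≠ v) :
    GraphInv A (G ++ [(u, c, v), (v, linv c, u)]) b ((w ++ [c], v) :: M)
      (Function.update φ v (φ u * mk [c])) := by
  have mono : ∀ e ∈ G, e ∈ G ++ [(u, c, v), (v, linv c, u)] := by simp +contextual
  constructor
  · intro s d t hm
    simp only [List.mem_append, List.mem_cons, Prod.mk.injEq, List.not_mem_nil, or_false] at hm ⊢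
    rcases hm with hm | ⟨rfl, rfl, rfl⟩ | ⟨rfl, rfl, rfl⟩
    · exact .inl (h.symm _ _ _ hm)
    · simp
    · simp
  · intro s d t hm
    simp only [List.mem_append, List.mem_cons, Prod.mk.injEq, List.not_mem_nil, or_false] at hm
    rcases hm with hm | ⟨rfl, rfl, rfl⟩ | ⟨rfl, rfl, rfl⟩
    · have := hG _ hm
      rw [Function.update_of_ne this.1, Function.update_of_ne this.2]
      exact h.edge _ _ _ hm
    · rw [Function.update_of_ne huv, Function.update_self]
      simp only [mul_inv_cancel, one_mem]
    · rw [Function.update_of_ne huv, Function.update_self, mk_linv]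
      simp only [mul_inv_cancel_right, mul_inv_cancel, one_mem]
  · rw [Function.update_of_ne hb]; exact h.base
  · intro w' v' hm
    rcases List.mem_cons.1 hm with hm | hm
    · obtain ⟨rfl, rfl⟩ := Prod.mk.inj hm
      exact ((h.reads _ _ hu).mono mono).append ⟨v', by simp, rfl⟩
    · exact (h.reads _ _ hm).mono mono
  · intro w' v' hm
    rcases List.mem_cons.1 hm with hm | hm
    · obtain ⟨rfl, rfl⟩ := Prod.mk.inj hm
      have := h.mark _ _ hu
      rw [Function.update_self, ← mul_mk]
      simpa [mul_assoc, -mul_mk, -inv_mk] using this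
    · rw [Function.update_of_ne (hM _ hm)]; exact h.mark _ _ hm

/-! ### Folded graphs and membership in the subgroup. -/

/-- The label of a path determines its end. -/
def Folded (G : List (ℕ × (α × Bool) × ℕ)) : Prop :=
  ∀ s c t t', (s, c, t) ∈ G → (s, c, t') ∈ G → t = t'

/-- In a folded graph with inverse edges, a letter followed by its inverse leads back to the same
vertex, so a cancelling pair can be left out of a path. -/
theorem Reads.of_red (hG : Folded G) (hs : ∀ s c t, (s, c, t) ∈ G → (t, linv c, s) ∈ G)
    {w w' : List (α × Bool)} (h : Red w w') {u v : ℕ} (hw : Reads G w u v) : Reads G w' u v := by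
  induction h with
  | refl => exact hw
  | tail _ hstep ih =>
    obtain ⟨⟩ := hstep
    rename_i L1 L2 x y _
    obtain ⟨s, h1, s1, h2, s2, h3, h4⟩ := reads_append.1 ih
    have := hG _ _ _ _ (hs _ _ _ h2) h3
    exact reads_append.2 ⟨s, h1, this ▸ h4⟩

theorem Reads.invRev (hs : ∀ s c t, (s, c, t) ∈ G → (t, linv c, s) ∈ G)
    {w : List (α × Bool)} {u v : ℕ} (hw : Reads G w u v) : Reads G (invRev w) v u := by
  induction w generalizing u with
  | nil => exact hw.symm
  | cons c w ih =>
    obtain ⟨s, h1, h2⟩ := hw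
    have : FreeGroup.invRev (c :: w) = FreeGroup.invRev w ++ [linv c] := by
      simp [FreeGroup.invRev, linv]
    rw [this]
    exact (ih h2).append ⟨u, hs _ _ _ h1, rfl⟩

theorem GraphInv.mem_of_reads (h : GraphInv A G b M φ) {y : List (α × Bool)} {u v : ℕ}
    (hy : Reads G y u v) : φ u * mk y * (φ v)⁻¹ ∈ A := by
  induction y generalizing u with
  | nil => obtain rfl := hy; simp [← one_eq_mk, one_mem]
  | cons c y ih =>
    obtain ⟨s, h1, h2⟩ := hy
    have := mul_mem (h.edge _ _ _ h1) (ih h2)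
    have e : mk (c :: y) = mk [c] * mk y := by rw [mul_mk]; rfl
    rw [e]
    simpa [mul_assoc, -mul_mk] using this

/-- In a folded graph, membership in the subgroup is decided by reading reduced words. -/
theorem GraphInv.mem_iff_reads (h : GraphInv A G b M φ) (hG : Folded G)
    {gens : List (List (α × Bool))} (hA : A = Subgroup.closure {g | ∃ a ∈ gens, g = mk a})
    (hgens : ∀ a ∈ gens, (a, b) ∈ M) {p q y : List (α × Bool)} {u v : ℕ} (hp : (p, u) ∈ M)
    (hq : (q, v) ∈ M) (hy : IsReduced y) :
    mk p * mk y * (mk q)⁻¹ ∈ A ↔ Reads G y u v := by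
  constructor
  · intro hm
    -- Some word for each element of `A` labels a loop at the base. It need not be reduced; folding
    -- is used only later.
    have loops : ∀ x ∈ A, ∃ w, mk w = x ∧ Reads G w b b := by
      intro x hx
      rw [hA] at hx
      induction hx using Subgroup.closure_induction with
      | mem x hx => obtain ⟨a, ha, rfl⟩ := hx; exact ⟨a, rfl, h.reads _ _ (hgens a ha)⟩
      | one => exact ⟨[], one_eq_mk.symm, rfl⟩
      | mul x y _ _ hx hy =>
        obtain ⟨w, rfl, hw⟩ := hx
        obtain ⟨w', rfl, hw'⟩ := hy
        exact ⟨w ++ w', by rw [mul_mk], hw.append hw'⟩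
      | inv x _ hx =>
        obtain ⟨w, rfl, hw⟩ := hx
        exact ⟨FreeGroup.invRev w, by rw [inv_mk], hw.invRev h.symm⟩
    obtain ⟨w, hw, hr⟩ := loops _ hm
    -- Back along `p` to the base, around the loop, and out along `q`. The label represents the same
    -- element as the reduced word `y`, so reducing it gives a path for `y`.
    have hr' : Reads G (FreeGroup.invRev p ++ (w ++ q)) u v :=
      ((h.reads _ _ hp).invRev h.symm).append (hr.append (h.reads _ _ hq))
    have e : mk y = mk (FreeGroup.invRev p ++ (w ++ q)) := by
      rw [← mul_mk, ← mul_mk, ← inv_mk, hw]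
      simp [mul_assoc, -mul_mk, -inv_mk]
    rw [← hy.reduce_eq, reduce.sound e]
    exact hr'.of_red hG h.symm reduce.red
  · intro hr
    have := mul_mem (mul_mem (h.mark _ _ hp) (h.mem_of_reads hr)) (inv_mem (h.mark _ _ hq))
    simpa [mul_assoc, -mul_mk, -inv_mk] using this

/-- The number of sources of edges. -/
def numVerts (G : List (ℕ × (α × Bool) × ℕ)) : ℕ := (G.map (·.1)).toFinset.card

theorem numVerts_le (G : List (ℕ × (α × Bool) × ℕ)) : numVerts G ≤ G.length :=
  (List.toFinset_card_le _).trans (by simp)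

/-- By symmetry the inverse edges make `x` and `y` sources. Identifying them removes `y` and adds no
source, so the number of sources bounds the number of folds. -/
theorem numVerts_relabel_lt (hs : ∀ s c t, (s, c, t) ∈ G → (t, linv c, s) ∈ G) {s x y : ℕ}
    {c : α × Bool} (hxy : x ≠ y) (hx : (s, c, x) ∈ G) (hy : (s, c, y) ∈ G) :
    numVerts (mapVerts (RAM.relabel x y) G) < numVerts G := by
  apply Finset.card_lt_card
  rw [Finset.ssubset_iff_of_subset]
  · refine ⟨y, ?_, ?_⟩
    · exact List.mem_toFinset.2 (List.mem_map.2 ⟨_, hs _ _ _ hy, rfl⟩)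
    · simp only [mapVerts, RAM.relabel, List.map_map, List.mem_toFinset, List.mem_map,
        Function.comp_apply, not_exists, not_and]
      intro e _
      split_ifs with he
      · exact hxy
      · exact he
  · intro z hz
    simp only [mapVerts, RAM.relabel, List.map_map, List.mem_toFinset, List.mem_map,
        Function.comp_apply] at hz ⊢
    obtain ⟨e, he, rfl⟩ := hz
    split_ifs
    · exact ⟨_, hs _ _ _ hx, rfl⟩
    · exact ⟨e, he, rfl⟩

end Graph

end FreeGroup

/-! ### Encodings of words and tuples -/

namespace RAM

open FreeGroup Opd Op

variable {r : ℕ}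

/-- The code of a letter. -/
def cd (x : Fin r × Bool) : ℕ := 2 * (x.1 : ℕ) + x.2.toNat + 2

theorem code_eq (w : GroupWord r) : w.code = w.map cd := rfl

theorem cd_injective : Function.Injective (cd : Fin r × Bool → ℕ) := by
  rintro ⟨i, x⟩ ⟨j, y⟩ h
  simp only [cd] at h
  have : (i : ℕ) = j ∧ x = y := by
    cases x <;> cases y <;> simp at h ⊢ <;> omega
  simp [Fin.ext_iff, this]

theorem two_le_cd (x : Fin r × Bool) : 2 ≤ cd x := by simp [cd]

theorem cd_lt (x : Fin r × Bool) : cd x < 2 * r + 2 := by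
  obtain ⟨i, x⟩ := x
  have := i.2
  cases x <;> simp only [cd, Bool.toNat_true, Bool.toNat_false] <;> omega

theorem exists_cd {c : ℕ} (h2 : 2 ≤ c) (hc : c < 2 * r + 2) : ∃ x : Fin r × Bool, cd x = c := by
  refine ⟨(⟨(c - 2) / 2, by omega⟩, decide (c % 2 = 1)), ?_⟩
  by_cases h : c % 2 = 1 <;> simp [cd, h] <;> omega

/-- The list `J` contains the codes of the inverses of all letters. -/
structure IsInv (r : ℕ) (J : List ℕ) : Prop where
  length : J.length = 2 * r + 2
  get : ∀ x : Fin r × Bool, J.getD (cd x) 0 = cd (linv x)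
  ne : ∀ c, J.getD c 0 ≠ 1

/-- A tuple as a string. -/
def encT (U : List (FreeGroup (Fin r))) : List ℕ :=
  1 :: U.flatMap fun g => g.toWord.map cd ++ [1]

theorem length_encT (U : List (FreeGroup (Fin r))) :
    (encT U).length = size U + U.length + 1 := by
  induction U with
  | nil => simp [encT, size]
  | cons g U ih => simp [encT, size, FreeGroup.norm] at ih ⊢; omega

theorem map_cd_append_injective {w w' : List (Fin r × Bool)} {S S' : List ℕ}
    (h : w.map cd ++ 1 :: S = w'.map cd ++ 1 :: S') : w = w' ∧ S = S' := by
  induction w generalizing w' with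
  | nil =>
    rcases w' with _ | ⟨x, w'⟩
    · simpa using h
    · have := two_le_cd x; simp at h; omega
  | cons y w ih =>
    rcases w' with _ | ⟨x, w'⟩
    · have := two_le_cd y; simp at h; omega
    · simp only [List.map_cons, List.cons_append, List.cons.injEq] at h
      obtain ⟨h1, h2⟩ := ih h.2
      exact ⟨by rw [cd_injective h.1, h1], h2⟩

/-- The separator is not the code of a letter. Therefore the machine can test equality of tuples by
comparing strings. -/
theorem encT_injective : Function.Injective (encT : List (FreeGroup (Fin r)) → List ℕ) := by
  intro U V h
  simp only [encT, List.cons.injEq, true_and] at h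
  induction U generalizing V with
  | nil => rcases V with _ | _ <;> simp at h ⊢
  | cons g U ih =>
    rcases V with _ | ⟨k, V⟩
    · simp at h
    · simp only [List.flatMap_cons, List.append_assoc, List.singleton_append] at h
      obtain ⟨h1, h2⟩ := map_cd_append_injective h
      rw [toWord_injective h1, ih h2]

/-- The last entry is either the last letter of the word or, for the empty word, the guard `1`,
which is not the code of a letter. -/
theorem pushRed_toWord {J : List ℕ} (hJ : IsInv r J) (Y : List ℕ) (g : FreeGroup (Fin r))
    (x : Fin r × Bool) : pushRed J (Y ++ [1] ++ g.toWord.map cd) (cd x) =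
      Y ++ [1] ++ (g * mk [x]).toWord.map cd := by
  rw [toWord_mul_mk_singleton, pushRed, hJ.get]
  rcases List.eq_nil_or_concat g.toWord with h | ⟨s, b, h⟩
  · have := two_le_cd (linv x)
    rw [h]
    simp; omega
  · rw [h]
    have e : (Y ++ [1] ++ (s.concat b).map cd).getD
        ((Y ++ [1] ++ (s.concat b).map cd).length - 1) 0 = cd b := by
      simp [List.getD_eq_getElem?_getD]
    rw [e]
    simp only [cd_injective.eq_iff, List.concat_eq_append, List.getLast?_append,
      List.getLast?_singleton, Option.some_or, Option.some.injEq]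
    split_ifs
    · rw [List.map_append, ← List.append_assoc, List.map_singleton, List.dropLast_concat,
        List.dropLast_concat]
    · simp

theorem foldl_conjStep_map_cd {J : List ℕ} (hJ : IsInv r J) (c : ℕ) (Y : List ℕ)
    (g : FreeGroup (Fin r)) (w : List (Fin r × Bool)) :
    (w.map cd).foldl (conjStep J c) (Y ++ [1] ++ g.toWord.map cd) =
      Y ++ [1] ++ (g * mk w).toWord.map cd := by
  induction w generalizing g with
  | nil => simp [← one_eq_mk]
  | cons x w ih =>
    have hx : cd x ≠ 1 := by have := two_le_cd x; omega
    rw [List.map_cons, List.foldl_cons, conjStep, if_neg hx, pushRed_toWord hJ, ih, mul_assoc,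
      mul_mk]
    rfl

/-- Between words the accumulator always ends with a separator and the inverse letter. The statement
keeps this pending letter so that the induction goes through. -/
theorem foldl_conjStep_flatMap {J : List ℕ} (hJ : IsInv r J) (x : Fin r × Bool) (Y : List ℕ)
    (U : List (FreeGroup (Fin r))) :
    (U.flatMap fun g => g.toWord.map cd ++ [1]).foldl (conjStep J (cd x))
      (Y ++ [1] ++ [cd (linv x)]) =
      Y ++ [1] ++ ((cjT (mk [x]) U).flatMap fun g => g.toWord.map cd ++ [1]) ++
        [cd (linv x)] := by
  induction U generalizing Y with
  | nil => simp [cjT]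
  | cons g U ih =>
    have e : [cd (linv x)] = (mk [linv x]).toWord.map cd := by simp [toWord_mk]
    rw [List.flatMap_cons, List.foldl_append, List.foldl_append, e,
      foldl_conjStep_map_cd hJ, mk_toWord, ← e, List.foldl_cons, List.foldl_nil, conjStep,
      if_pos rfl, pushRed_toWord hJ, hJ.get, mk_linv]
    have e2 : Y ++ [1] ++ ((mk [x])⁻¹ * g * mk [x]).toWord.map cd ++ [1, cd (linv x)] =
        (Y ++ [1] ++ ((mk [x])⁻¹ * g * mk [x]).toWord.map cd) ++ [1] ++ [cd (linv x)] := by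
      simp
    rw [e2, ih]
    simp [cjT, cj]

theorem conjProg_encT {a : ℕ} (ha : a ≠ 11) {σ : Store} {U : List (FreeGroup (Fin r))}
    {x : Fin r × Bool} {n : ℕ} (hJ : IsInv r (σ.l 1)) (hU : σ.l a = encT U)
    (hx : σ.v 30 = cd x) (hn : (size U + U.length) * 40 + 20 ≤ n) :
    HT (conjProg a) σ n (Upd 31 σ 11 (encT (cjT (mk [x]) U))) := by
  have hlen := length_encT U
  refine (conjProg_spec ha (S := U.flatMap fun g => g.toWord.map cd ++ [1]) hU hJ.ne
    (by rw [hx, hJ.length]; exact cd_lt x) ?_ ?_).mono le_rfl ?_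
  · intro y hy
    rw [hJ.length]
    simp only [List.mem_flatMap, List.mem_append, List.mem_map, List.mem_singleton] at hy
    obtain ⟨g, _, ⟨z, _, rfl⟩ | rfl⟩ := hy
    · exact cd_lt z
    · omega
  · rw [encT, List.length_cons] at hlen
    have : (U.flatMap fun g => g.toWord.map cd ++ [1]).length = size U + U.length := by omega
    rw [this]; exact hn
  · intro τ h
    rw [hx, hJ.get] at h
    have e := foldl_conjStep_flatMap hJ x [] U
    rw [List.nil_append, List.singleton_append] at e
    rw [e, List.dropLast_concat] at h
    exact h

/-! ### Shortening a tuple by conjugation -/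

/-- Amortized accounting: when a potential drops from `a` to `x`, the difference pays for at least
one iteration of cost `C`. -/
theorem add_mul_le_mul {a x y C : ℕ} (h : a = x + y) (hy : 1 ≤ y) : C + x * C ≤ a * C := by
  subst h
  have := Nat.mul_le_mul_right C hy
  rw [Nat.add_mul]; omega

/-- Conjugate the tuple in the list `a` by letters as long as it becomes shorter; the letters are
collected in the list `b`. -/
def descendProg (a b : ℕ) : Prog :=
  blk [const 20 2, clear b] ;;
  loop (.lt (var 20) (var 0)) (blk [mov 30 (var 20)] ;; conjProg a ;;
    cond (.lt (len 11) (len a)) (copyProg a 11 ;; blk [push b (var 20), const 20 2])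
      (blk [inc 20]))

@[simp] theorem length_cjT {α : Type*} (x : FreeGroup α) (U : List (FreeGroup α)) :
    (cjT x U).length = U.length := by simp [cjT]

/-- Each collected letter shortens the tuple by at least one, so `p` is at most as long as the loss
of size. The search for letters restarts after each success, and thus the last full round shows
local minimality. -/
theorem descendProg_spec {a b : ℕ} (ha : a ≠ 1) (hb : b ≠ 1) (hab : a ≠ b) (ha' : a ≠ 11)
    (hb' : b ≠ 11) {σ : Store} {U : List (FreeGroup (Fin r))} {n : ℕ} (hJ : IsInv r (σ.l 1))
    (hK : σ.v 0 = 2 * r + 2) (hU : σ.l a = encT U)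
    (hn : ((size U + 1) * (2 * r + 2)) * ((size U + U.length) * 60 + 70) + 6 ≤ n) :
    HT (descendProg a b) σ n (fun τ => Frame 20 σ τ ∧
      (∀ c, c ≠ a → c ≠ b → c ≠ 11 → τ.l c = σ.l c) ∧
      ∃ p : List (Fin r × Bool), τ.l b = p.map cd ∧ τ.l a = encT (cjT (mk p) U) ∧
        p.length + size (cjT (mk p) U) ≤ size U ∧ LocalMin (cjT (mk p) U)) := by
  set C := (size U + U.length) * 60 + 70 with hC
  refine HT.blk_seq (by simp; omega) (by simp) ?_
  refine HT.mono (m := (size U * (2 * r + 2) + 2 * r) * C + 1) ?_ ?_ (fun τ h => h)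
  swap
  · have : ((size U + 1) * (2 * r + 2)) * C = (size U * (2 * r + 2) + 2 * r) * C + 2 * C := by ring
    simp; omega
  -- The potential counts `2 * r + 2` units per unit of size, plus the letters not yet tried. A
  -- failed trial uses up a letter; a successful one loses size, which pays for restarting the
  -- search.
  refine HT.loop (fun n τ => Frame 20 σ τ ∧ (∀ c, c ≠ a → c ≠ b → c ≠ 11 → τ.l c = σ.l c) ∧
    2 ≤ τ.v 20 ∧ τ.v 20 ≤ 2 * r + 2 ∧
      ∃ p : List (Fin r × Bool), τ.l b = p.map cd ∧ τ.l a = encT (cjT (mk p) U) ∧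
        p.length + size (cjT (mk p) U) ≤ size U ∧
        (∀ x, cd x < τ.v 20 → size (cjT (mk p) U) ≤ size (cjT (mk [x]) (cjT (mk p) U))) ∧
        n = (size (cjT (mk p) U) * (2 * r + 2) + (2 * r + 2 - τ.v 20)) * C + 1) ?_ ?_ ?_
  · refine ⟨by simp [Frame.refl], by simp +contextual, by simp, by simp, [], by simp,
      by simp [hab, hU, ← one_eq_mk], by simp [← one_eq_mk], ?_, by simp [← one_eq_mk]⟩
    intro x hx
    have := two_le_cd x
    simp at hx; omega
  · rintro n τ ⟨hF, hl, h2, h3, p, hb1, ha1, hp, hmin, rfl⟩ hlt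
    simp only [Cond.Holds, val_var, hF.v 0 (by simp), hK] at hlt
    obtain ⟨x, hx⟩ := exists_cd h2 hlt
    set W := cjT (mk p) U with hW
    have hWs : size W + W.length ≤ size U + U.length := by
      have : W.length = U.length := length_cjT _ _
      omega
    have hJ' : IsInv r (τ.l 1) := by rw [hl 1 ha.symm hb.symm (by simp)]; exact hJ
    refine ⟨C - 1, ?_⟩
    refine HT.blk_seq (by simp; omega) (by simp) ?_
    refine HT.seq (conjProg_encT (U := W) (x := x) ha' (by simpa using hJ') (by simpa using ha1)
      (by simp [hx]) le_rfl) (by simp; omega) ?_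
    intro υ hυ
    have e20 : υ.v 20 = cd x := by simp [hυ.frame.v, hx]
    have hF' : Frame 20 σ υ := (Frame.trans hF (by simp [Frame.refl]) le_rfl).trans hυ.frame (by simp)
    refine HT.cond (by simp; omega) (fun hc => ?_) (fun hc => ?_)
    · have hc' : size (cjT (mk [x]) W) < size W := by
        simp only [Cond.Holds, val_len, hυ.l, ha', if_true, if_false, effAll, eff, Store.set_l,
          ha1, length_encT, length_cjT] at hc
        omega
      refine HT.seq (copyProg_spec ha'.symm le_rfl) ?_ ?_
      · simp [hυ.l, length_encT]; omega
      intro ω hω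
      refine HT.blk ?_ (by simp) ?_
      · simp [hυ.l, length_encT]; omega
      refine ⟨(size (cjT (mk [x]) W) * (2 * r + 2) + 2 * r) * C + 1, ?_, ?_, ?_, ?_, ?_,
        p ++ [x], ?_, ?_, ?_, ?_, ?_⟩
      · have : (size W * (2 * r + 2) + (2 * r + 2 - τ.v 20)) =
            (size (cjT (mk [x]) W) * (2 * r + 2) + 2 * r) +
            (((size W - size (cjT (mk [x]) W) - 1) * (2 * r + 2)) + 1 +
              (2 * r + 2 - τ.v 20) + 1) := by
          obtain ⟨d, hd⟩ : ∃ d, size W = size (cjT (mk [x]) W) + 1 + d :=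
            ⟨size W - (size (cjT (mk [x]) W) + 1), by omega⟩
          rw [show size W - size (cjT (mk [x]) W) - 1 = d by omega, hd]
          ring
        have := add_mul_le_mul (C := C) this (by omega)
        omega
      · simp only [effAll, eff, Frame.setL_iff, le_refl, Frame.set_iff]
        exact hF'.trans hω.frame (by simp)
      · intro c h4 h5 h6
        simp [h4, h5, h6, hω.l, hυ.l, hl]
      · simp
      · simp
      · simp [hω.l, hab.symm, hυ.l, hb', hb1, hω.frame.v, e20]
      · simp [hω.l, hab, hυ.l, ← mul_mk, ← cjT_cjT, hW]
      · rw [← mul_mk, ← cjT_cjT, ← hW]; simp; omega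
      · intro y hy
        have := two_le_cd y
        simp at hy; omega
      · rw [← mul_mk, ← cjT_cjT, ← hW]; simp
    · have hc' : size W ≤ size (cjT (mk [x]) W) := by
        simp only [Cond.Holds, val_len, hυ.l, ha', if_true, if_false, effAll, eff, Store.set_l,
          ha1, length_encT, length_cjT] at hc
        omega
      refine HT.blk (by simp; omega) (by simp) ?_
      refine ⟨(size W * (2 * r + 2) + (2 * r + 2 - (cd x + 1))) * C + 1, ?_, ?_, ?_, ?_, ?_, p, ?_,
        ?_, hp, ?_, ?_⟩
      · have : size W * (2 * r + 2) + (2 * r + 2 - τ.v 20) =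
            size W * (2 * r + 2) + (2 * r + 2 - (cd x + 1)) + 1 := by omega
        have := add_mul_le_mul (C := C) this le_rfl
        omega
      · simpa using hF'
      · intro c h4 h5 h6
        simp [h6, hυ.l, hl, h4, h5]
      · simp [e20]; omega
      · simp [e20]; omega
      · simp [hυ.l, hb', hb1]
      · simp [hυ.l, ha', ha1, hW]
      · intro y hy
        simp [e20] at hy
        rcases Nat.lt_or_ge (cd y) (cd x) with h | h
        · exact hmin y (by omega)
        · rwa [cd_injective (by omega : cd y = cd x)]
      · simp [e20, hW]
  · rintro n τ ⟨hF, hl, h2, h3, p, hb1, ha1, hp, hmin, rfl⟩ hlt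
    simp only [Cond.Holds, val_var, hF.v 0 (by simp), hK] at hlt
    refine ⟨by omega, hF, hl, p, hb1, ha1, hp, fun x => hmin x ?_⟩
    have := cd_lt x
    omega

end RAM

/-! ### Bookkeeping of changed variables. -/

namespace RAM

open FreeGroup Opd Op

variable {r : ℕ}

/-- `τ` arises from `σ` by changes to the scalars in `xs` and from `k` on and to the lists in
`ls`. -/
structure Keep (k : ℕ) (xs ls : List ℕ) (σ τ : Store) : Prop where
  inp : τ.inp = σ.inp
  v : ∀ x < k, x ∉ xs → τ.v x = σ.v x
  l : ∀ b, b ∉ ls → τ.l b = σ.l b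

theorem Keep.refl (k : ℕ) (xs ls : List ℕ) (σ : Store) : Keep k xs ls σ σ :=
  ⟨rfl, fun _ _ _ => rfl, fun _ _ => rfl⟩

theorem Keep.trans {k j : ℕ} {xs ls xs' ls' : List ℕ} {σ τ υ : Store} (h : Keep k xs ls σ τ)
    (h' : Keep j xs' ls' τ υ) (hk : k ≤ j) (hxs : ∀ x ∈ xs', x ∈ xs ∨ k ≤ x)
    (hls : ∀ b ∈ ls', b ∈ ls) : Keep k xs ls σ υ where
  inp := h'.inp.trans h.inp
  v x hx hx' := (h'.v x (by omega) fun hm => (hxs x hm).elim hx' (by omega)).trans (h.v x hx hx')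
  l b hb := (h'.l b fun hm => hb (hls b hm)).trans (h.l b hb)

theorem Keep.set {k : ℕ} {xs ls : List ℕ} {σ τ : Store} (h : Keep k xs ls σ τ) {x n : ℕ}
    (hx : x ∈ xs ∨ k ≤ x) : Keep k xs ls σ (τ.set x n) where
  inp := h.inp
  v y hy hy' := by
    have : y ≠ x := by rintro rfl; exact hx.elim hy' (by omega)
    simpa [this] using h.v y hy hy'
  l := h.l

theorem Keep.setL {k : ℕ} {xs ls : List ℕ} {σ τ : Store} (h : Keep k xs ls σ τ) {a : ℕ}
    {L : List ℕ} (ha : a ∈ ls) : Keep k xs ls σ (τ.setL a L) where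
  inp := h.inp
  v := h.v
  l b hb := by
    have : b ≠ a := by rintro rfl; exact hb ha
    simpa [this] using h.l b hb

theorem Upd.keep {k a : ℕ} {L : List ℕ} {σ τ : Store} (h : Upd k σ a L τ) : Keep k [] [a] σ τ where
  inp := h.frame.inp
  v x hx _ := h.frame.v x hx
  l b hb := by
    have : b ≠ a := by simpa using hb
    simp [h.l, this]

/-! ### Reading the input -/

/-- The string `R` is what remains of the input, from the position `10` on; the scalar `11` is its
first symbol. -/
def At (σ : Store) (R : List ℕ) : Prop := σ.inp.drop (σ.v 10) = R ∧ σ.v 11 = R.headD 0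

def next : Prog := blk [inc 10, input 11 10]

theorem At.next {σ : Store} {c : ℕ} {R : List ℕ} (h : At σ (c :: R)) :
    At (effAll [inc 10, input 11 10] σ) R := by
  have h1 : σ.inp.drop (σ.v 10 + 1) = R := by
    rw [← List.drop_drop, h.1]; rfl
  refine ⟨by simpa using h1, ?_⟩
  rw [← h1]
  simp [List.headD_eq_head?_getD, List.head?_drop, List.getD_eq_getElem?_getD]

theorem At.congr {σ τ : Store} {R : List ℕ} (h : At σ R) (hi : τ.inp = σ.inp)
    (h10 : τ.v 10 = σ.v 10) (h11 : τ.v 11 = σ.v 11) : At τ R := by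
  rw [At, hi, h10, h11]; exact h

/-- Read a word and append its reduced form to the list `a`. -/
def readWord (a : ℕ) : Prog := loop (.lt one (var 11)) (pushRedProg a 11 ;; next)

theorem readWord_spec {a : ℕ} (ha1 : a ≠ 1) {σ : Store} {w : List (Fin r × Bool)} {R Y : List ℕ}
    {n : ℕ} (hJ : IsInv r (σ.l 1)) (hσ : At σ (w.map cd ++ 1 :: R)) (ha : σ.l a = Y ++ [1])
    (hn : w.length * 30 + 1 ≤ n) :
    HT (readWord a) σ n (fun τ => Keep 40 [10, 11] [a] σ τ ∧ At τ (1 :: R) ∧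
      τ.l a = Y ++ [1] ++ (mk w).toWord.map cd) := by
  refine HT.mono (m := w.length * 30 + 1) ?_ hn (fun τ h => h)
  refine HT.loop (fun n τ => Keep 40 [10, 11] [a] σ τ ∧ ∃ w₁ w₂, w = w₁ ++ w₂ ∧
    At τ (w₂.map cd ++ 1 :: R) ∧ τ.l a = Y ++ [1] ++ (mk w₁).toWord.map cd ∧
    n = w₂.length * 30 + 1) ⟨Keep.refl _ _ _ _, [], w, rfl, hσ, by simp [ha, ← one_eq_mk], rfl⟩ ?_ ?_
  · rintro n τ ⟨hk, w₁, w₂, rfl, hAt, hl, rfl⟩ hb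
    rcases w₂ with _ | ⟨x, w₂⟩
    · simp [hAt.2] at hb
    have e11 : τ.v 11 = cd x := by simpa using hAt.2
    have e1 : τ.l 1 = σ.l 1 := hk.l 1 (by simpa using ha1.symm)
    refine ⟨25, HT.seq (pushRedProg_spec (by simp) ?_ (by simp [hl])) (by simp) ?_⟩
    · rw [e1, e11, hJ.length]; exact cd_lt x
    intro υ hυ
    have hAt' : At υ (cd x :: (w₂.map cd ++ 1 :: R)) :=
      hAt.congr hυ.frame.inp (hυ.frame.v 10 (by simp)) (hυ.frame.v 11 (by simp))
    refine HT.blk (by simp) (by simp) ⟨w₂.length * 30 + 1, by simp; omega, ?_, w₁ ++ [x], w₂,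
      by simp, hAt'.next, ?_, rfl⟩
    · exact ((hk.trans hυ.keep le_rfl (by simp) (by simp)).set (by simp)).set (by simp)
    · simp only [effAll, eff, Store.set_l]
      rw [hυ.l, if_pos rfl, hl, e1, e11, pushRed_toWord hJ, mul_mk]
  · rintro n τ ⟨hk, w₁, w₂, rfl, hAt, hl, rfl⟩ hb
    rcases w₂ with _ | ⟨x, w₂⟩
    · exact ⟨by omega, hk, hAt, by simpa using hl⟩
    · have := two_le_cd x
      simp [hAt.2] at hb; omega

/-- Read the equations; the tuples of their sides become the lists `2` and `3`. -/
def readEqns : Prog :=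
  blk [clear 2, clear 3, push 2 one, push 3 one] ;;
  loop (.lt zero (var 11)) (readWord 2 ;; blk [push 2 one, inc 10, input 11 10] ;;
    readWord 3 ;; blk [push 3 one, inc 10, input 11 10])

theorem encT_append_singleton (U : List (FreeGroup (Fin r))) (g : FreeGroup (Fin r)) :
    encT (U ++ [g]) = encT U ++ g.toWord.map cd ++ [1] := by
  simp [encT]

theorem encT_eq_concat (U : List (FreeGroup (Fin r))) : ∃ Y, encT U = Y ++ [1] := by
  rcases List.eq_nil_or_concat U with rfl | ⟨V, g, rfl⟩
  · exact ⟨[], rfl⟩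
  · exact ⟨_, by rw [List.concat_eq_append, encT_append_singleton]⟩

/-- The equations as a string. -/
def encE (E : List (GroupWord r × GroupWord r)) : List ℕ :=
  E.flatMap fun e => e.1.code ++ [1] ++ e.2.code ++ [1]

theorem readEqns_spec {σ : Store} {E : List (GroupWord r × GroupWord r)} {R : List ℕ} {n : ℕ}
    (hJ : IsInv r (σ.l 1)) (hσ : At σ (encE E ++ 0 :: R)) (hn : (encE E).length * 40 + 10 ≤ n) :
    HT readEqns σ n (fun τ => Keep 40 [10, 11] [2, 3] σ τ ∧ At τ (0 :: R) ∧
      τ.l 2 = encT (E.map fun e => mk e.1) ∧ τ.l 3 = encT (E.map fun e => mk e.2)) := by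
  refine HT.blk_seq (by simp; omega) (by simp) ?_
  refine HT.mono (m := (encE E).length * 40 + 1) ?_ (by simp; omega) (fun τ h => h)
  refine HT.loop (fun n τ => Keep 40 [10, 11] [2, 3] σ τ ∧ ∃ E₁ E₂, E = E₁ ++ E₂ ∧
    At τ (encE E₂ ++ 0 :: R) ∧ τ.l 2 = encT (E₁.map fun e => mk e.1) ∧
    τ.l 3 = encT (E₁.map fun e => mk e.2) ∧ n = (encE E₂).length * 40 + 1) ?_ ?_ ?_
  · refine ⟨?_, [], E, rfl, hσ, by simp [encT], by simp [encT], rfl⟩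
    exact ((((Keep.refl _ _ _ _).setL (by simp)).setL (by simp)).setL (by simp)).setL (by simp)
  · rintro n τ ⟨hk, E₁, E₂, rfl, hAt, hl2, hl3, rfl⟩ hb
    rcases E₂ with _ | ⟨⟨u, v⟩, E₂⟩
    · simp [hAt.2, encE] at hb
    have e1 : τ.l 1 = σ.l 1 := hk.l 1 (by simp)
    obtain ⟨Y, hY⟩ := encT_eq_concat (E₁.map fun e => mk e.1)
    obtain ⟨Z, hZ⟩ := encT_eq_concat (E₁.map fun e => mk e.2)
    have hcode : encE ((u, v) :: E₂) ++ 0 :: R =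
        u.map cd ++ 1 :: (v.map cd ++ 1 :: (encE E₂ ++ 0 :: R)) := by
      simp [encE, code_eq]
    have hlen : (encE ((u, v) :: E₂)).length = u.length + v.length + 2 + (encE E₂).length := by
      simp [encE, code_eq]; omega
    rw [hcode] at hAt
    refine ⟨(u.length + v.length + 2) * 40 - 1, HT.seq (readWord_spec (a := 2) (by simp)
      (e1 ▸ hJ) hAt (hl2.trans hY) le_rfl) (by omega) ?_⟩
    rintro υ ⟨k1, k2, k3⟩
    refine HT.blk_seq (by simp; omega) (by simp) ?_
    refine HT.seq (readWord_spec (a := 3) (w := v) (Y := Z)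
      (R := encE E₂ ++ 0 :: R) (by simp) ?_ ?_ ?_ le_rfl)
      (by simp; omega) ?_
    · simpa [k1.l, e1] using hJ
    · exact (At.next (k2.congr (τ := υ.setL 2 (υ.l 2 ++ [1])) rfl rfl rfl) :)
    · simp [k1.l, hl3, hZ]
    rintro ω ⟨m1, m2, m3⟩
    refine HT.blk (by simp; omega) (by simp) ⟨(encE E₂).length * 40 + 1, by rw [hlen]; omega, ?_,
      E₁ ++ [(u, v)], E₂, by simp, ?_, ?_, ?_, rfl⟩
    · refine ((Keep.setL ?_ (by simp)).set (by simp)).set (by simp)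
      refine Keep.trans (((Keep.setL ?_ (by simp)).set (by simp)).set (by simp)) m1 le_rfl
        (by simp) (by simp)
      exact hk.trans k1 le_rfl (by simp) (by simp)
    · exact (At.next (m2.congr (τ := ω.setL 3 (ω.l 3 ++ [1])) rfl rfl rfl) :)
    · rw [List.map_append, List.map_singleton, encT_append_singleton, hY]
      simp [m1.l, k3]
    · rw [List.map_append, List.map_singleton, encT_append_singleton, hZ]
      simp [m3]
  · rintro n τ ⟨hk, E₁, E₂, rfl, hAt, hl2, hl3, rfl⟩ hb
    rcases E₂ with _ | ⟨⟨u, v⟩, E₂⟩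
    · exact ⟨by omega, hk, hAt, by simpa using hl2, by simpa using hl3⟩
    · exfalso
      apply hb
      -- Unread equations begin with a letter code or, for an empty word, with a separator, but
      -- never with the end symbol `0`.
      have : 0 < (u.map cd ++ [1]).headD 0 := by
        rcases u with _ | ⟨x, u⟩
        · simp
        · have := two_le_cd x; simp; omega
      simp only [Cond.Holds, val_zero, val_var, hAt.2]
      convert this using 1
      rcases u with _ | ⟨x, u⟩ <;> simp [encE, code_eq]

end RAM

/-! ### Building the graph of a subgroup -/

namespace RAM

open FreeGroup Opd Op

variable {r : ℕ}

/-- The graph `G` with base `1` is stored in the lists `6`, `7`, `8`; its vertices are multiples of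
`2 * r + 2` up to the scalar `4`. -/
structure GState (A : Subgroup (FreeGroup (Fin r))) (σ : Store)
    (G : List (ℕ × (Fin r × Bool) × ℕ)) (M : List (List (Fin r × Bool) × ℕ)) : Prop where
  src : σ.l 6 = G.map (·.1)
  lbl : σ.l 7 = G.map fun e => cd e.2.1
  tgt : σ.l 8 = G.map (·.2.2)
  inv : ∃ φ, GraphInv A G (σ.v 1) M φ
  -- Every new vertex raises the scalar by `2 * r + 2` and comes with two directed edges.
  -- Relabelling changes neither number, so the vertex numbers stay linear in the length of `G`.
  fresh : σ.v 4 = (r + 1) * G.length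
  fresh_dvd : 2 * r + 2 ∣ σ.v 4
  base : σ.v 1 ≤ σ.v 4 ∧ 2 * r + 2 ∣ σ.v 1
  vert : ∀ e ∈ G, (e.1 ≤ σ.v 4 ∧ 2 * r + 2 ∣ e.1) ∧ (e.2.2 ≤ σ.v 4 ∧ 2 * r + 2 ∣ e.2.2)
  mark : ∀ m ∈ M, m.2 ≤ σ.v 4 ∧ 2 * r + 2 ∣ m.2

variable {A : Subgroup (FreeGroup (Fin r))} {σ τ : Store}
  {G : List (ℕ × (Fin r × Bool) × ℕ)} {M : List (List (Fin r × Bool) × ℕ)}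

theorem GState.mono (h : GState A σ G M) {M' : List (List (Fin r × Bool) × ℕ)}
    (hM : ∀ m ∈ M', m ∈ M) : GState A σ G M' :=
  { h with
    inv := h.inv.imp fun _ h => h.mono hM
    mark := fun m hm => h.mark m (hM m hm) }

theorem GState.mark_base (h : GState A σ G M) : GState A σ G (([], σ.v 1) :: M) :=
  { h with
    inv := h.inv.imp fun _ h => h.mark_base
    mark := fun m hm => by
      rcases List.mem_cons.1 hm with rfl | hm
      · exact h.base
      · exact h.mark m hm }

theorem GState.congr (h : GState A σ G M) (h1 : τ.v 1 = σ.v 1) (h4 : τ.v 4 = σ.v 4)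
    (h6 : τ.l 6 = σ.l 6) (h7 : τ.l 7 = σ.l 7) (h8 : τ.l 8 = σ.l 8) : GState A τ G M := by
  constructor
  · rw [h6, h.src]
  · rw [h7, h.lbl]
  · rw [h8, h.tgt]
  · rw [h1]; exact h.inv
  · rw [h4, h.fresh]
  · rw [h4]; exact h.fresh_dvd
  · rw [h1, h4]; exact h.base
  · rw [h4]; exact h.vert
  · rw [h4]; exact h.mark

/-- Add an edge with label `30` from the vertex `5` to a new vertex, which becomes the scalar
`5`. -/
def addEdgeProg : Prog :=
  addProg 4 (var 0) ;;
  blk [push 6 (var 5), push 7 (var 30), push 8 (var 4), get 31 1 30, push 6 (var 4),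
    push 7 (var 31), push 8 (var 5), mov 5 (var 4)]

theorem addEdgeProg_spec {w : List (Fin r × Bool)} {c : Fin r × Bool} {n : ℕ}
    (h : GState A σ G M) (hw : (w, σ.v 5) ∈ M) (hc : σ.v 30 = cd c) (hJ : IsInv r (σ.l 1))
    (hK : σ.v 0 = 2 * r + 2) (hn : (2 * r + 2) * 7 + 30 ≤ n) :
    HT addEdgeProg σ n (fun τ => Keep 30 [4, 5] [6, 7, 8] σ τ ∧
      ∃ G', G'.length = G.length + 2 ∧ GState A τ G' ((w ++ [c], τ.v 5) :: M)) := by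
  refine HT.seq (addProg_spec (by simp) (by simp) (by simp) le_rfl) (by rw [hK]; omega) ?_
  rintro υ ⟨hi, hl, hv⟩
  have e4 := hv 4 (by simp)
  have e5 := hv 5 (by simp)
  have e1 := hv 1 (by simp)
  have e30 := hv 30 (by simp)
  simp [hK] at e4 e5 e1 e30
  have hcl := cd_lt c
  refine HT.blk (by simp; omega) (by simp [hl, e30, hc, hJ.length]; exact hcl) ?_
  obtain ⟨φ, hφ⟩ := h.inv
  refine ⟨⟨by simp [hi], ?_, ?_⟩,
    G ++ [(σ.v 5, c, σ.v 4 + (2 * r + 2)), (σ.v 4 + (2 * r + 2), linv c, σ.v 5)], by simp, ?_⟩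
  · intro x hx hx'
    simp at hx'
    have := hv x (by omega)
    simp [hx', show x ≠ 31 by omega, this]
  · intro b hb
    simp at hb
    simp [hb, hl]
  have h5 := h.mark _ hw
  simp only at h5
  have hd : 2 * r + 2 ∣ σ.v 4 + (2 * r + 2) := (Nat.dvd_add_self_right).2 h.fresh_dvd
  refine ⟨by simp [hl, h.src, e4, e5], ?_, by simp [hl, h.tgt, e4, e5],
    ⟨Function.update φ (σ.v 4 + (2 * r + 2)) (φ (σ.v 5) * mk [c]), ?_⟩, ?_,
    by simpa [e4] using hd, ?_, ?_, ?_⟩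
  · simp [hl, h.lbl, e30, hc]
    simpa [List.getD_eq_getElem?_getD] using hJ.get c
  · simp only [effAll, eff, Store.set_v, Store.setL_v, Opd.val_var, e1, e4, Nat.reduceEqDiff,
      if_true, if_false, OfNat.one_ne_ofNat]
    refine hφ.addEdge c hw (by omega) (by have := h.base.1; omega) ?_ ?_
    · intro e he
      have := h.vert e he
      omega
    · intro m hm
      have := h.mark m hm
      omega
  · simp [e4, h.fresh]; ring
  · simp [e1, e4]; exact ⟨by have := h.base.1; omega, h.base.2⟩
  · intro e he
    simp only [effAll, eff, Store.set_v, Store.setL_v, Opd.val_var, e4, Nat.reduceEqDiff,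
      if_false]
    simp only [List.mem_append, List.mem_cons, List.not_mem_nil, or_false] at he
    rcases he with he | rfl | rfl
    · have := h.vert e he
      exact ⟨⟨by omega, this.1.2⟩, by omega, this.2.2⟩
    · exact ⟨⟨by omega, h5.2⟩, le_rfl, hd⟩
    · exact ⟨⟨le_rfl, hd⟩, by simp only; omega, h5.2⟩
  · intro m hm
    simp only [effAll, eff, Store.set_v, Store.setL_v, Opd.val_var, e4, Nat.reduceEqDiff,
      if_true, if_false] at hm ⊢
    rcases List.mem_cons.1 hm with rfl | hm
    · exact ⟨le_rfl, hd⟩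
    · have := h.mark m hm
      exact ⟨by omega, this.2⟩

/-- Replace the scalar `x` by `31` if it equals `32`. -/
def relabelVar (x : ℕ) : Prog := cond (.eq (var x) (var 32)) (blk [mov x (var 31)]) (blk [])

theorem relabelVar_spec {x : ℕ} {n : ℕ} (hn : 4 ≤ n) :
    HT (relabelVar x) σ n (fun τ => τ = σ.set x (relabel (σ.v 31) (σ.v 32) (σ.v x))) := by
  refine HT.cond (by omega) (fun h => HT.blk (by simp; omega) (by simp) ?_)
    (fun h => HT.blk (by simp; omega) (by simp) ?_)
  · simp at h; simp [relabel, h]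
  · simp at h; simp [relabel, h, Store.set]

/-- Replace the vertex `32` by the vertex `31`. -/
def relabelAll : Prog :=
  relabelProg 6 ;; relabelProg 8 ;; relabelVar 1 ;; relabelVar 2 ;; relabelVar 3

theorem relabelAll_spec {n : ℕ} (h : GState A σ G M)
    -- Required for every `φ`, because `GState` only asserts that some `φ` exists.
    (hxy : ∀ φ, GraphInv A G (σ.v 1) M φ → φ (σ.v 31) * (φ (σ.v 32))⁻¹ ∈ A)
    (hx : σ.v 31 ≤ σ.v 4 ∧ 2 * r + 2 ∣ σ.v 31) (hn : G.length * 40 + 60 ≤ n) :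
    HT relabelAll σ n (fun τ => Keep 30 [1, 2, 3] [6, 8] σ τ ∧
      GState A τ (mapVerts (relabel (σ.v 31) (σ.v 32)) G)
        (M.map fun m => (m.1, relabel (σ.v 31) (σ.v 32) m.2)) ∧
      (∀ x, 1 ≤ x → x ≤ 3 → τ.v x = relabel (σ.v 31) (σ.v 32) (σ.v x))) := by
  have l6 : (σ.l 6).length = G.length := by simp [h.src]
  have l8 : (σ.l 8).length = G.length := by simp [h.tgt]
  refine HT.seq (relabelProg_spec le_rfl) (by omega) fun σ₁ h1 => ?_
  have l8' : (σ₁.l 8).length = G.length := by simp [h1.l, h.tgt]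
  refine HT.seq (relabelProg_spec le_rfl) (by omega) fun σ₂ h2 => ?_
  refine HT.seq (relabelVar_spec le_rfl) (by omega) fun σ₃ h3 => ?_
  refine HT.seq (relabelVar_spec le_rfl) (by omega) fun σ₄ h4 => ?_
  refine (relabelVar_spec le_rfl).mono (by omega) fun σ₅ h5 => ?_
  have hF := h1.frame.trans h2.frame le_rfl
  subst h3
  subst h4
  subst h5
  have e31 := hF.v 31 (by simp)
  have e32 := hF.v 32 (by simp)
  have key : ∀ v, v ≤ σ.v 4 ∧ 2 * r + 2 ∣ v → relabel (σ.v 31) (σ.v 32) v ≤ σ.v 4 ∧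
      2 * r + 2 ∣ relabel (σ.v 31) (σ.v 32) v := by
    intro v hv
    unfold relabel
    split_ifs
    · exact hx
    · exact hv
  have e4 := hF.v 4 (by simp)
  have e1 := hF.v 1 (by simp)
  have e2 := hF.v 2 (by simp)
  have e3 := hF.v 3 (by simp)
  refine ⟨⟨hF.inp, ?_, ?_⟩, ?_, ?_⟩
  · intro x hx hx'
    simp at hx'
    simp [hx', hF.v x (by omega)]
  · intro b hb
    simp at hb
    simp [hb, h1.l, h2.l]
  · constructor
    · simp [h1.l, h2.l, h.src, mapVerts]
    · simp [h1.l, h2.l, h.lbl, mapVerts]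
    · simp [h1.l, h2.l, h.tgt, mapVerts, h1.frame.v]
    · obtain ⟨φ, hφ⟩ := h.inv
      refine ⟨φ, ?_⟩
      simpa [e1, e31, e32] using hφ.relabel (hxy φ hφ)
    · simp [e4, h.fresh, mapVerts]
    · simpa [e4] using h.fresh_dvd
    · simpa [e1, e4, e31, e32] using key _ h.base
    · intro e he
      obtain ⟨e', he', rfl⟩ := List.mem_map.1 he
      simpa [e4] using ⟨key _ (h.vert e' he').1, key _ (h.vert e' he').2⟩
    · intro m hm
      obtain ⟨m', hm', rfl⟩ := List.mem_map.1 hm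
      simpa [e4] using key _ (h.mark m' hm')
  · intro x hx1 hx3
    obtain rfl | rfl | rfl : x = 1 ∨ x = 2 ∨ x = 3 := by omega
    all_goals simp [e1, e2, e3, e31, e32]

/-- Read a word and add the path that it labels to the graph. -/
def readPath : Prog :=
  loop (.lt one (var 11)) (blk [mov 30 (var 11)] ;; addEdgeProg ;; next)

theorem readPath_spec {w : List (Fin r × Bool)} {R : List ℕ} {n : ℕ}
    (h : GState A σ G (([], σ.v 5) :: M)) (hσ : At σ (w.map cd ++ 1 :: R))
    (hJ : IsInv r (σ.l 1)) (hK : σ.v 0 = 2 * r + 2)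
    (hn : w.length * ((2 * r + 2) * 7 + 40) + 1 ≤ n) :
    HT readPath σ n (fun τ => Keep 30 [4, 5, 10, 11] [6, 7, 8] σ τ ∧ At τ (1 :: R) ∧
      ∃ G', G'.length = G.length + 2 * w.length ∧ GState A τ G' ((w, τ.v 5) :: M)) := by
  refine HT.mono (m := w.length * ((2 * r + 2) * 7 + 40) + 1) ?_ hn (fun τ h => h)
  refine HT.loop (fun n τ => Keep 30 [4, 5, 10, 11] [6, 7, 8] σ τ ∧ ∃ w₁ w₂, w = w₁ ++ w₂ ∧
    At τ (w₂.map cd ++ 1 :: R) ∧ (∃ G', G'.length = G.length + 2 * w₁.length ∧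
      GState A τ G' ((w₁, τ.v 5) :: M)) ∧
    n = w₂.length * ((2 * r + 2) * 7 + 40) + 1)
    ⟨Keep.refl _ _ _ _, [], w, rfl, hσ, ⟨G, by simp, h⟩, rfl⟩ ?_ ?_
  · rintro n τ ⟨hk, w₁, w₂, rfl, hAt, ⟨G', hG', hs⟩, rfl⟩ hb
    rcases w₂ with _ | ⟨x, w₂⟩
    · simp [hAt.2] at hb
    have e11 : τ.v 11 = cd x := by simpa using hAt.2
    refine ⟨(2 * r + 2) * 7 + 39, HT.blk_seq (by simp) (by simp) ?_⟩
    have hs' : GState A (τ.set 30 (cd x)) G' ((w₁, (τ.set 30 (cd x)).v 5) :: M) :=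
      hs.congr rfl rfl rfl rfl rfl
    refine HT.seq (addEdgeProg_spec (w := w₁) (c := x) (σ := effAll [mov 30 (var 11)] τ)
      (by simpa [e11] using hs') (by simp) (by simp [e11])
      (by simpa [hk.l] using hJ) (by simp [hk.v, hK]) le_rfl) (by simp) ?_
    rintro υ ⟨k1, G'', hG'', hs''⟩
    have hAt' : At υ (cd x :: (w₂.map cd ++ 1 :: R)) :=
      hAt.congr (k1.inp.trans rfl) (k1.v 10 (by simp) (by simp)) (k1.v 11 (by simp) (by simp))
    refine HT.blk (by simp) (by simp) ⟨w₂.length * ((2 * r + 2) * 7 + 40) + 1, ?_, ?_,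
      w₁ ++ [x], w₂, by simp, hAt'.next, ⟨G'', ?_, ?_⟩, rfl⟩
    · simp only [List.length_cons, Nat.add_mul]; omega
    · refine Keep.set (Keep.set ?_ (by simp)) (by simp)
      refine Keep.trans (Keep.set hk (x := 30) (n := τ.v 11) (by simp)) k1 le_rfl (by simp) (by simp)
    · simp [hG'', hG']; ring
    · exact (hs''.mono (by simp; tauto)).congr rfl rfl rfl rfl rfl
  · rintro n τ ⟨hk, w₁, w₂, rfl, hAt, ⟨G', hG', hs⟩, rfl⟩ hb
    rcases w₂ with _ | ⟨x, w₂⟩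
    · exact ⟨by omega, hk, hAt, G', by simpa using hG', by simpa using hs⟩
    · have := two_le_cd x
      simp [hAt.2] at hb; omega

/-- Read the generators and add a loop at the base for each of them. -/
def readGens : Prog :=
  loop (.lt zero (var 11)) (readPath ;; blk [mov 31 (var 1), mov 32 (var 5)] ;; relabelAll ;;
    blk [mov 5 (var 1), inc 10, input 11 10])

/-- The generators as a string. -/
def encG (gens : List (GroupWord r)) : List ℕ := gens.flatMap fun a => a.code ++ [1]

/-- A path is drawn for each generator, and its end is then merged with the base. Merging scans the
whole graph, whose length is linear in the input; over all generators this is quadratic. -/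
theorem readGens_spec {gens : List (GroupWord r)} {R : List ℕ} {n : ℕ}
    (hA : ∀ a ∈ gens, mk a ∈ A)
    (h : GState A σ [] [([], σ.v 5)]) (hσ : At σ (encG gens ++ 0 :: R))
    (h5 : σ.v 5 = σ.v 1) (hJ : IsInv r (σ.l 1)) (hK : σ.v 0 = 2 * r + 2)
    (hn : (encG gens).length * ((2 * r + 2) * 7 + 80 * (encG gens).length + 100) + 1 ≤ n) :
    HT readGens σ n (fun τ => Keep 30 [1, 2, 3, 4, 5, 10, 11] [6, 7, 8] σ τ ∧ At τ (0 :: R) ∧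
      ∃ G, G.length ≤ 2 * (encG gens).length ∧ GState A τ G (gens.map fun a => (a, τ.v 1))) := by
  set N := (encG gens).length with hN
  set C := (2 * r + 2) * 7 + 80 * N + 100 with hC
  refine HT.mono (m := N * C + 1) ?_ hn (fun τ h => h)
  refine HT.loop (fun n τ => Keep 30 [1, 2, 3, 4, 5, 10, 11] [6, 7, 8] σ τ ∧ ∃ g₁ g₂,
    gens = g₁ ++ g₂ ∧ At τ (encG g₂ ++ 0 :: R) ∧
    (∃ G, G.length + 2 * (encG g₂).length ≤ 2 * N ∧
      GState A τ G (([], τ.v 5) :: g₁.map fun a => (a, τ.v 1))) ∧ τ.v 5 = τ.v 1 ∧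
    n = (encG g₂).length * C + 1)
    ⟨Keep.refl _ _ _ _, [], gens, rfl, hσ, ⟨[], by simp [hN], h⟩, h5, rfl⟩ ?_ ?_
  · rintro n τ ⟨hk, g₁, g₂, hg, hAt, ⟨G, hG, hs⟩, h51, rfl⟩ hb
    rcases g₂ with _ | ⟨a, g₂⟩
    · simp [hAt.2, encG] at hb
    have hcode : encG (a :: g₂) ++ 0 :: R = a.map cd ++ 1 :: (encG g₂ ++ 0 :: R) := by
      simp [encG, code_eq]
    have hlen : (encG (a :: g₂)).length = a.length + 1 + (encG g₂).length := by
      simp [encG, code_eq]; omega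
    rw [hcode] at hAt
    refine ⟨a.length * ((2 * r + 2) * 7 + 40) + 1 + (80 * N + 80), ?_⟩
    refine HT.seq (readPath_spec hs hAt (by simpa [hk.l] using hJ) (by simp [hk.v, hK]) le_rfl)
      (by omega) ?_
    rintro υ ⟨k1, k2, G', hG', hs'⟩
    have e1 : υ.v 1 = τ.v 1 := k1.v 1 (by simp) (by simp)
    refine HT.blk_seq (by simp) (by simp) ?_
    refine HT.seq (relabelAll_spec (σ := effAll [mov 31 (var 1), mov 32 (var 5)] υ)
      (hs'.congr rfl rfl rfl rfl rfl) ?_ ?_ le_rfl) ?_ ?_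
    -- The end of the path for `a` represents the coset of `mk a`, which is `A` itself, like the
    -- coset of the base.
    · intro φ hφ
      have h1 := hφ.mark a (υ.v 5) (by simp)
      have h2 := mul_mem (inv_mem (hA a (by simp [hg]))) h1
      simpa using mul_mem hφ.base (by simpa [-inv_mk] using h2)
    · simpa using hs'.base
    · simp; omega
    rintro ω ⟨m1, m2, m3⟩
    have hr : relabel (υ.v 1) (υ.v 5) (υ.v 5) = υ.v 1 := by simp [relabel]
    have hr' : relabel (υ.v 1) (υ.v 5) (υ.v 1) = υ.v 1 := by simp [relabel]
    have f1 : ω.v 1 = υ.v 1 := by simpa [hr'] using m3 1 (by simp) (by simp)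
    have hAt' : At ω (1 :: (encG g₂ ++ 0 :: R)) :=
      k2.congr (m1.inp.trans rfl) (m1.v 10 (by simp) (by simp)) (m1.v 11 (by simp) (by simp))
    refine HT.blk (by simp; omega) (by simp) ⟨(encG g₂).length * C + 1, ?_, ?_, g₁ ++ [a], g₂,
      by simp [hg], ?_, ⟨mapVerts (relabel (υ.v 1) (υ.v 5)) G', ?_, ?_⟩, by simp, rfl⟩
    · have e2 : a.length * ((2 * r + 2) * 7 + 40) ≤ a.length * C :=
        Nat.mul_le_mul_left _ (by omega)
      have e3 : (a.length + 1 + (encG g₂).length) * C =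
        a.length * C + C + (encG g₂).length * C := by ring
      rw [hlen, e3]
      omega
    · refine Keep.set (Keep.set (Keep.set ?_ (by simp)) (by simp)) (by simp)
      refine Keep.trans (Keep.set (Keep.set (hk.trans k1 le_rfl (by simp) (by simp))
        (x := 31) (n := υ.v 1) (by simp)) (x := 32) (n := υ.v 5) (by simp)) m1 le_rfl
        (by simp) (by simp)
    · exact (At.next (hAt'.congr (τ := ω.set 5 (ω.v 1)) rfl rfl rfl) :)
    · simp [mapVerts, hG']; omega
    · have m2' := m2.mark_base
      refine GState.congr (σ := ω) (m2'.mono ?_) rfl rfl rfl rfl rfl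
      intro m hm
      obtain ⟨b, hb, rfl⟩ | rfl | rfl : (∃ b ∈ g₁, (b, ω.v 1) = m) ∨ m = (a, ω.v 1) ∨ m = ([], ω.v 1) := by
        simpa [or_assoc, or_comm, or_left_comm] using hm
      · refine List.mem_cons_of_mem _ (List.mem_cons_of_mem _ ?_)
        rw [List.map_map]
        refine List.mem_map.2 ⟨b, hb, ?_⟩
        simp [f1, ← e1, hr']
      · refine List.mem_cons_of_mem _ ?_
        rw [List.map_cons]
        simp [f1, hr]
      · simp
  · rintro n τ ⟨hk, g₁, g₂, hg, hAt, ⟨G, hG, hs⟩, h51, rfl⟩ hb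
    rcases g₂ with _ | ⟨a, g₂⟩
    · refine ⟨by omega, hk, hAt, G, by omega, ?_⟩
      rw [hg]
      exact hs.mono (by simp +contextual)
    · exfalso
      apply hb
      simp only [Cond.Holds, val_zero, val_var, hAt.2]
      rcases a with _ | ⟨x, u⟩
      · simp [encG, code_eq]
      · have := two_le_cd x; simp [encG, code_eq]; omega

/-- Add the path at the base that is labelled by the list `a`; its end becomes the scalar `y`. -/
def addTail (a y : ℕ) : Prog :=
  blk [mov 5 (var 1), const 20 0] ;;
  upto 20 (len a) (blk [get 30 a 20] ;; addEdgeProg) ;; blk [mov y (var 5)]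

/-- Unlike a generator, a tail is not closed up: its end is meant to represent the coset of `A` that
contains `mk p`. -/
theorem addTail_spec {a y : ℕ} (ha : a ∉ [6, 7, 8]) (hy : y = 2 ∨ y = 3)
    {p : List (Fin r × Bool)} {n : ℕ} (h : GState A σ G M) (hp : σ.l a = p.map cd)
    (hJ : IsInv r (σ.l 1)) (hK : σ.v 0 = 2 * r + 2)
    (hn : p.length * ((2 * r + 2) * 7 + 40) + 20 ≤ n) :
    HT (addTail a y) σ n (fun τ => Keep 20 [4, 5, y] [6, 7, 8] σ τ ∧
      ∃ G', G'.length = G.length + 2 * p.length ∧ GState A τ G' ((p, τ.v y) :: M)) := by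
  refine HT.blk_seq (by simp; omega) (by simp) ?_
  refine HT.seq (m := p.length * ((2 * r + 2) * 7 + 40) + 1)
    (P := fun τ => Keep 20 [4, 5] [6, 7, 8] σ τ ∧
      ∃ G', G'.length = G.length + 2 * p.length ∧ GState A τ G' ((p, τ.v 5) :: M)) ?_
    (by simp; omega) ?_
  · refine HT.upto (k₀ := 0) (m := p.length) (c := (2 * r + 2) * 7 + 36)
      (fun k τ => Keep 20 [4, 5] [6, 7, 8] σ τ ∧
      ∃ G', G'.length = G.length + 2 * k ∧ GState A τ G' ((p.take k, τ.v 5) :: M)) ?_ (by simp)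
      (by simp) (fun k τ hk => by rw [val_len, hk.1.l a ha, hp]; simp) ?_ (by simp) ?_
    · refine ⟨Keep.set (Keep.set (Keep.refl _ _ _ _) (by simp)) (by simp), G, by simp, ?_⟩
      exact h.mark_base.congr rfl rfl rfl rfl rfl
    · rintro k τ - hk ⟨k1, G', hG', hs⟩ hv
      have hla : τ.l a = p.map cd := by rw [k1.l a ha, hp]
      refine HT.blk_seq (by simp) (by simp [hla, hv, hk]) ?_
      refine HT.mono (addEdgeProg_spec (w := p.take k) (c := p[k]) (n := (2 * r + 2) * 7 + 30)
        (σ := effAll [get 30 a 20] τ)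
        (hs.congr rfl rfl rfl rfl rfl) (by simp) (by simp [hla, hv, hk])
        (by simpa [k1.l] using hJ) (by simp [k1.v, hK]) le_rfl) (by simp) ?_
      rintro υ ⟨m1, G'', hG'', hs''⟩
      refine ⟨by simp [m1.v, hv], ?_, G'', by omega, ?_⟩
      · refine Keep.set ?_ (by simp)
        exact Keep.trans (Keep.set k1 (x := 30) (n := _) (by simp)) m1 (by simp) (by simp) (by simp)
      · rw [List.take_succ_eq_append_getElem hk]
        exact (hs''.mono (by simp; tauto)).congr rfl rfl rfl rfl rfl
    · rintro τ ⟨k1, G', hG', hs⟩ -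
      rw [List.take_length] at hs
      exact ⟨k1, G', hG', hs⟩
  · rintro τ ⟨k1, G', hG', hs⟩
    refine HT.blk (by simp; omega) (by simp) ⟨?_, G', hG', ?_⟩
    · refine Keep.set ?_ (by simp)
      exact Keep.trans (Keep.refl _ _ _ _) k1 le_rfl (by simp) (by simp)
    · simp
      exact hs.congr (by rcases hy with rfl | rfl <;> simp) (by rcases hy with rfl | rfl <;> simp)
        rfl rfl rfl

end RAM

/-! ### Folding -/

namespace RAM

open FreeGroup Opd Op

variable {r : ℕ}

/-- The list `T` tabulates the transition function of the graph `G`. -/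
structure Table (T : List ℕ) (G : List (ℕ × (Fin r × Bool) × ℕ)) : Prop where
  mem : ∀ e ∈ G, T.getD (e.1 + cd e.2.1) 0 = e.2.2 + 1
  of_ne : ∀ x, T.getD x 0 ≠ 0 → ∃ e ∈ G, x = e.1 + cd e.2.1 ∧ T.getD x 0 = e.2.2 + 1

theorem Table.folded {T : List ℕ} {G : List (ℕ × (Fin r × Bool) × ℕ)} (h : Table T G) :
    Folded G := by
  intro s c t t' h1 h2
  have e1 := h.mem _ h1
  have e2 := h.mem _ h2
  simp only at e1 e2
  omega

/-- Codes are smaller than `2 * r + 2` and vertices are multiples of it, so vertex and letter can be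
recovered from their sum. Hence one table can be addressed without multiplication. -/
theorem slot_injective {s s' : ℕ} {c c' : Fin r × Bool} (hs : 2 * r + 2 ∣ s)
    (hs' : 2 * r + 2 ∣ s') (h : s + cd c = s' + cd c') : s = s' ∧ c = c' := by
  obtain ⟨a, rfl⟩ := hs
  obtain ⟨b, rfl⟩ := hs'
  have h1 := congrArg (· % (2 * r + 2)) h
  simp only [Nat.mul_add_mod, Nat.mod_eq_of_lt (cd_lt c), Nat.mod_eq_of_lt (cd_lt c')] at h1
  exact ⟨by omega, cd_injective h1⟩

def fillProg : Prog :=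
  blk [clear 9, mov 21 (var 4)] ;; addProg 21 (var 0) ;; blk [const 22 0] ;;
  upto 22 (var 21) (blk [push 9 zero])

/-- The table extends beyond the largest vertex number by `2 * r + 2`, which makes room for its
letters. -/
theorem fillProg_spec {σ : Store} {n : ℕ} (hn : (σ.v 4 + σ.v 0) * 7 + σ.v 0 * 7 + 20 ≤ n) :
    HT fillProg σ n (fun τ => Keep 21 [] [9] σ τ ∧
      τ.l 9 = List.replicate (σ.v 4 + σ.v 0) 0) := by
  refine HT.blk_seq (by simp; omega) (by simp) ?_
  refine HT.seq (addProg_spec (by simp) (by simp) (by simp) le_rfl) (by simp; omega) ?_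
  rintro υ ⟨hi, hl, hv⟩
  have e21 := hv 21 (by simp)
  simp at e21
  refine HT.blk_seq (by simp; omega) (by simp) ?_
  refine HT.upto (k₀ := 0) (m := σ.v 4 + σ.v 0) (c := 3)
    (fun k τ => Keep 21 [] [9] σ τ ∧ τ.v 21 = σ.v 4 + σ.v 0 ∧ τ.l 9 = List.replicate k 0)
    ⟨⟨by simp [hi], ?_, ?_⟩, by simp [e21], by simp [hl]⟩ (by simp) (by simp)
    (fun k τ hk => by simp [hk.2.1]) ?_ (by simp; omega) (fun τ h _ => ⟨h.1, h.2.2⟩)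
  · intro x hx _
    have := hv x (by omega)
    simpa [show x ≠ 22 by omega, show x ≠ 21 by omega] using this
  · intro b hb
    simp at hb
    simp [hl, hb]
  · rintro k τ - hk ⟨h1, h2, h3⟩ hv
    refine HT.blk (by simp) (by simp) ⟨by simp [hv], ?_, by simp [h2], by simp [h3, List.replicate_succ']⟩
    exact Keep.set (Keep.setL h1 (by simp)) (by simp)

/-- Tabulate all edges; the scalar `20` is set to `1` if two edges with the same source and label
have the different targets `31` and `32`. -/
def scanProg : Prog :=
  blk [const 22 0] ;; upto 22 (len 6)
    (blk [get 30 6 22, get 33 7 22, get 34 8 22, inc 34] ;; addProg 30 (var 33) ;;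
      blk [get 35 9 30] ;;
      cond (.eq (var 35) zero) (blk [put 9 30 (var 34)])
        (cond (.eq (var 35) (var 34)) (blk [])
          (blk [const 20 1, mov 31 (var 35), dec 31, mov 32 (var 34), dec 32])))

theorem scanProg_spec {A : Subgroup (FreeGroup (Fin r))} {σ : Store}
    {G : List (ℕ × (Fin r × Bool) × ℕ)} {M : List (List (Fin r × Bool) × ℕ)} {n : ℕ}
    (h : GState A σ G M) (h20 : σ.v 20 = 0)
    (h9 : σ.l 9 = List.replicate (σ.v 4 + (2 * r + 2)) 0)
    (hn : G.length * ((2 * r + 2) * 7 + 50) + 10 ≤ n) :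
    HT scanProg σ n (fun τ => Keep 20 [] [9] σ τ ∧ (τ.l 9).length = σ.v 4 + (2 * r + 2) ∧
      ((τ.v 20 = 0 ∧ Table (τ.l 9) G) ∨ (τ.v 20 = 1 ∧ τ.v 31 ≠ τ.v 32 ∧
        ∃ s c, (s, c, τ.v 31) ∈ G ∧ (s, c, τ.v 32) ∈ G))) := by
  refine HT.blk_seq (by simp; omega) (by simp) ?_
  have l6 : (σ.l 6).length = G.length := by simp [h.src]
  -- Every filled slot comes from an edge in any case, but completeness of the table is claimed only
  -- as long as no conflict has been found. Entries are targets plus one, so `0` marks an empty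
  -- slot.
  refine HT.upto (k₀ := 0) (m := G.length) (c := (2 * r + 2) * 7 + 46)
    (fun k τ => Keep 20 [] [9] σ τ ∧ (τ.l 9).length = σ.v 4 + (2 * r + 2) ∧
      (∀ x, (τ.l 9).getD x 0 ≠ 0 → ∃ e ∈ G.take k, x = e.1 + cd e.2.1 ∧
        (τ.l 9).getD x 0 = e.2.2 + 1) ∧
      ((τ.v 20 = 0 ∧ ∀ e ∈ G.take k, (τ.l 9).getD (e.1 + cd e.2.1) 0 = e.2.2 + 1) ∨
        (τ.v 20 = 1 ∧ τ.v 31 ≠ τ.v 32 ∧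
        ∃ s c, (s, c, τ.v 31) ∈ G ∧ (s, c, τ.v 32) ∈ G)))
    ⟨Keep.set (Keep.refl _ _ _ _) (by simp), by simp [h9], ?_, by simp [h20]⟩ (by simp) (by simp)
    (fun k τ hk => by simp [hk.1.l, l6]) ?_ ?_ ?_
  · intro x hx
    exfalso
    apply hx
    simp only [effAll, eff, Store.set_l, h9, List.getD_eq_getElem?_getD, List.getElem?_replicate]
    split_ifs <;> rfl
  · rintro k τ - hk ⟨h1, h2, h3, h4⟩ hv
    rcases he : G[k] with ⟨s, c, t⟩
    have hmem : (s, c, t) ∈ G := he ▸ List.getElem_mem hk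
    have hv1 := (h.vert _ hmem).1
    simp only at hv1
    have hcl := cd_lt c
    have hc2 := two_le_cd c
    have e6 : τ.l 6 = G.map (·.1) := by rw [h1.l 6 (by simp), h.src]
    have e7 : τ.l 7 = G.map fun e => cd e.2.1 := by rw [h1.l 7 (by simp), h.lbl]
    have e8 : τ.l 8 = G.map (·.2.2) := by rw [h1.l 8 (by simp), h.tgt]
    have g6 : (τ.l 6).getD k 0 = s := by simp [e6, hk, he]
    have g7 : (τ.l 7).getD k 0 = cd c := by simp [e7, hk, he]
    have g8 : (τ.l 8).getD k 0 = t := by simp [e8, hk, he]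
    refine HT.blk_seq (by simp) (by simp [e6, e7, e8, hv, hk]) ?_
    refine HT.seq (addProg_spec (by simp) (by simp) (by simp) le_rfl) ?_ ?_
    · simp [hv] at *; simp [e7, hk, he]; omega
    have e33 : (effAll [get 30 6 22, get 33 7 22, get 34 8 22, inc 34] τ).v 33 = cd c := by
      simp only [effAll, eff, Store.set_v, Store.set_l, hv, g7, Nat.reduceEqDiff, if_true, if_false]
    rw [e33]
    rintro υ ⟨hi, hl, hv'⟩
    have f30 : υ.v 30 = s + cd c := by
      rw [hv' 30 (by simp), if_pos rfl]
      simp only [effAll, eff, Store.set_v, Store.set_l, hv, g6, g7, Nat.reduceEqDiff, if_true, if_false]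
    have f34 : υ.v 34 = t + 1 := by
      rw [hv' 34 (by simp), if_neg (by simp)]
      simp only [effAll, eff, Store.set_v, Store.set_l, hv, g8, Nat.reduceEqDiff, if_true, if_false]
    have fl : ∀ b, υ.l b = τ.l b := hl
    have k1 : Keep 20 [] [9] σ υ := by
      refine ⟨hi.trans h1.inp, fun x hx _ => ?_, fun b hb => by rw [fl, h1.l b hb]⟩
      rw [hv' x (by omega), if_neg (by omega), ← h1.v x hx (by simp)]
      simp [show x ≠ 30 by omega, show x ≠ 33 by omega, show x ≠ 34 by omega]
    have f22 : υ.v 22 = k := by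
      rw [hv' 22 (by simp), if_neg (by simp)]; simp [hv]
    have f20 : υ.v 20 = τ.v 20 := by
      rw [hv' 20 (by simp), if_neg (by simp)]; simp
    have f31 : υ.v 31 = τ.v 31 := by
      rw [hv' 31 (by simp), if_neg (by simp)]; simp
    have f32 : υ.v 32 = τ.v 32 := by
      rw [hv' 32 (by simp), if_neg (by simp)]; simp
    have hslot : s + cd c < (τ.l 9).length := by omega
    refine HT.blk_seq (by simp; omega) (by simp [f30, fl, hslot]) ?_
    have htake : G.take (k + 1) = G.take k ++ [(s, c, t)] := by
      rw [List.take_succ_eq_append_getElem hk, he]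
    refine HT.cond (by simp; omega) (fun h5 => ?_) (fun h5 => ?_)
    · simp only [effAll, eff, Cond.Holds, val_var, val_zero, Store.set_v, if_true, fl, f30] at h5
      refine HT.blk (by simp; omega) (by simp [f30, fl, hslot]) ?_
      have hget : ∀ x, ((τ.l 9).set (s + cd c) (t + 1)).getD x 0 =
          if x = s + cd c then t + 1 else (τ.l 9).getD x 0 := by
        intro x
        split_ifs with hx
        · subst hx; simp [List.getD_eq_getElem?_getD, hslot]
        · simp [List.getD_eq_getElem?_getD, Ne.symm hx]
      have hl9 : ((effAll [put 9 30 (var 34)] (effAll [get 35 9 30] υ)).set 22 (k + 1)).l 9 =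
          (τ.l 9).set (s + cd c) (t + 1) := by
        simp [fl, f30, f34]
      refine ⟨by simp [f22], ?_, ?_, ?_, ?_⟩
      · exact Keep.set (Keep.setL (Keep.set k1 (by simp)) (by simp)) (by simp)
      · rw [hl9]; simpa using h2
      · rw [hl9, htake]
        intro x hx
        rw [hget] at hx ⊢
        split_ifs at hx ⊢ with hx'
        · exact ⟨(s, c, t), by simp, hx', rfl⟩
        · obtain ⟨e, he1, he2⟩ := h3 x hx
          exact ⟨e, by simp [he1], he2⟩
      · rw [hl9, htake]
        rcases h4 with ⟨h6, h7⟩ | ⟨h6, h7⟩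
        · left
          refine ⟨by simp [f20, h6], fun e he1 => ?_⟩
          rw [hget]
          rcases List.mem_append.1 he1 with he1 | he1
          · have h8 := h7 e he1
            have : e.1 + cd e.2.1 ≠ s + cd c := fun e' => by rw [e', h5] at h8; omega
            rw [if_neg this, h8]
          · rw [List.mem_singleton.1 he1, if_pos rfl]
        · right
          simpa [f20, f31, f32, h6] using h7
    · simp only [effAll, eff, Cond.Holds, val_var, val_zero, Store.set_v, if_true, fl, f30] at h5
      -- A filled slot belongs to an earlier edge with the same source and label. Either the edge is
      -- repeated or the two targets must be identified.
      obtain ⟨⟨s', c', t'⟩, he1, he2, he3⟩ := h3 _ h5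
      have hmem' := List.mem_of_mem_take he1
      obtain ⟨rfl, rfl⟩ := slot_injective hv1.2 (h.vert _ hmem').1.2 he2
      simp only at he3
      refine HT.cond (by simp; omega) (fun h6 => ?_) (fun h6 => ?_)
      · simp only [effAll, eff, Cond.Holds, val_var, Store.set_v, if_true, fl, f30, he3, f34,
          Nat.reduceEqDiff, if_false] at h6
        obtain rfl : t' = t := by omega
        refine HT.blk (by simp; omega) (by simp) ⟨by simp [f22], ?_, ?_, ?_, ?_⟩
        · exact Keep.set (Keep.set k1 (by simp)) (by simp)
        · simpa [fl] using h2
        · simp only [effAll, eff, Store.set_l, fl, htake]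
          intro x hx
          obtain ⟨e, he4, he5⟩ := h3 x hx
          exact ⟨e, by simp [he4], he5⟩
        · simp only [effAll, eff, Store.set_l, Store.set_v, fl, f20, f31, f32, htake, Nat.reduceEqDiff,
            if_false]
          rcases h4 with ⟨h7, h8⟩ | h7
          · left
            refine ⟨h7, fun e he4 => ?_⟩
            rcases List.mem_append.1 he4 with he4 | he4
            · exact h8 e he4
            · rw [List.mem_singleton.1 he4, he3]
          · exact .inr h7
      · simp only [effAll, eff, Cond.Holds, val_var, Store.set_v, if_true, fl, f30, he3, f34,
          Nat.reduceEqDiff, if_false] at h6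
        refine HT.blk (by simp; omega) (by simp) ⟨by simp [f22], ?_, ?_, ?_, ?_⟩
        · exact Keep.set (Keep.set (Keep.set (Keep.set (Keep.set (Keep.set (Keep.set k1 (by simp))
            (by simp)) (by simp)) (by simp)) (by simp)) (by simp)) (by simp)
        · simpa [fl] using h2
        · simp only [effAll, eff, Store.set_l, fl, htake]
          intro x hx
          obtain ⟨e, he4, he5⟩ := h3 x hx
          exact ⟨e, by simp [he4], he5⟩
        · right
          simp only [effAll, eff, Store.set_v, val_var, fl, f30, he3, f34,
            Nat.reduceEqDiff, if_true, if_false, Nat.add_sub_cancel]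
          exact ⟨trivial, by omega, s, c, hmem', hmem⟩
  · have : (2 * r + 2) * 7 + 46 + 4 = (2 * r + 2) * 7 + 50 := by omega
    rw [this, Nat.sub_zero]
    simp
    omega
  · rintro τ ⟨h1, h2, h3, h4⟩ -
    rw [List.take_length] at h3 h4
    exact ⟨h1, h2, h4.imp (fun h5 => ⟨h5.1, h5.2, h3⟩) id⟩

/-- Fold the graph. -/
def foldProg : Prog :=
  blk [const 20 1] ;;
  loop (.eq (var 20) one) (blk [const 20 0] ;; fillProg ;; scanProg ;;
    cond (.eq (var 20) one) relabelAll (blk []))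

/-- Each round tabulates the edges in linear time and identifies two vertices if there is a
conflict, after which the graph has fewer sources. Edges are never deleted, so the cost per round
stays the same. -/
theorem foldProg_spec {A : Subgroup (FreeGroup (Fin r))} {σ : Store}
    {G : List (ℕ × (Fin r × Bool) × ℕ)} {gens : List (List (Fin r × Bool))}
    {p q : List (Fin r × Bool)} {n : ℕ} (hK : σ.v 0 = 2 * r + 2)
    (h : GState A σ G ((p, σ.v 2) :: (q, σ.v 3) :: gens.map fun a => (a, σ.v 1)))
    (hn : (G.length + 1) * (G.length * (21 * r + 120) + (2 * r + 2) * 21 + 150) + 10 ≤ n) :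
    HT foldProg σ n (fun τ => Keep 20 [1, 2, 3] [6, 8, 9] σ τ ∧
      ∃ G', G'.length = G.length ∧
        GState A τ G' ((p, τ.v 2) :: (q, τ.v 3) :: gens.map fun a => (a, τ.v 1)) ∧
        Table (τ.l 9) G' ∧ (τ.l 9).length = τ.v 4 + (2 * r + 2)) := by
  obtain ⟨C, hC⟩ : ∃ C, C = G.length * (21 * r + 120) + (2 * r + 2) * 21 + 150 := ⟨_, rfl⟩
  rw [← hC] at hn
  refine HT.blk_seq (by simp; omega) (by simp) ?_
  refine HT.mono (m := (G.length + 1) * C + 1) ?_ (by simp; omega) (fun τ h => h)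
  -- The potential is the number of sources, plus one for the final round that finds no conflict.
  refine HT.loop (fun n τ => Keep 20 [1, 2, 3] [6, 8, 9] σ τ ∧ ∃ G', G'.length = G.length ∧
    GState A τ G' ((p, τ.v 2) :: (q, τ.v 3) :: gens.map fun a => (a, τ.v 1)) ∧
    ((τ.v 20 = 0 ∧ 1 ≤ n ∧ Table (τ.l 9) G' ∧ (τ.l 9).length = τ.v 4 + (2 * r + 2)) ∨
      (τ.v 20 = 1 ∧ (numVerts G' + 1) * C + 1 ≤ n))) ?_ ?_ ?_
  · refine ⟨Keep.set (Keep.refl _ _ _ _) (by simp), G, rfl,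
      h.congr rfl rfl rfl rfl rfl, .inr ⟨by simp, ?_⟩⟩
    have := Nat.mul_le_mul_right C (Nat.add_le_add_right (numVerts_le G) 1)
    omega
  · rintro n τ ⟨k1, G', hG', hs, h1⟩ hb
    simp only [Cond.Holds, val_var, val_one] at hb
    obtain ⟨-, hb'⟩ := h1.resolve_left (by omega)
    refine ⟨C - 1, HT.blk_seq (by simp; omega) (by simp) ?_⟩
    have hfr := hs.fresh
    rw [hG'] at hfr
    have hring : C = ((r + 1) * G.length + (2 * r + 2)) * 7 + (2 * r + 2) * 7 +
        G.length * ((2 * r + 2) * 7 + 50) + G.length * 40 + 150 + G.length * 9 +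
        (2 * r + 2) * 7 := by
      rw [hC]; ring
    refine HT.seq (fillProg_spec le_rfl) ?_ ?_
    · have := k1.v 4 (by simp) (by simp)
      simp [k1.v, hK]; omega
    rintro υ ⟨m1, m2⟩
    have hυ4 : υ.v 4 = τ.v 4 := m1.v 4 (by simp) (by simp)
    have hτ0 : τ.v 0 = 2 * r + 2 := by simp [k1.v, hK]
    have hs1 : GState A υ G' ((p, τ.v 2) :: (q, τ.v 3) :: gens.map fun a => (a, τ.v 1)) :=
      hs.congr (m1.v 1 (by simp) (by simp)) (m1.v 4 (by simp) (by simp)) (m1.l 6 (by simp))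
        (m1.l 7 (by simp)) (m1.l 8 (by simp))
    refine HT.seq (scanProg_spec hs1 (by simp [m1.v]) (by simp [m2, hυ4, hτ0]) le_rfl) ?_ ?_
    · simp [hτ0, hG', hfr]; omega
    rintro ω ⟨o1, o2, o3⟩
    have hs2 : GState A ω G' ((p, τ.v 2) :: (q, τ.v 3) :: gens.map fun a => (a, τ.v 1)) :=
      hs1.congr (o1.v 1 (by simp) (by simp)) (o1.v 4 (by simp) (by simp)) (o1.l 6 (by simp))
        (o1.l 7 (by simp)) (o1.l 8 (by simp))
    have k2 : Keep 20 [1, 2, 3] [6, 8, 9] σ ω :=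
      Keep.trans (Keep.trans (Keep.set k1 (x := 20) (n := 0) (by simp)) m1 (by simp) (by simp)
        (by simp)) o1 le_rfl (by simp) (by simp)
    have e123 : ∀ x, 1 ≤ x → x ≤ 3 → ω.v x = τ.v x := by
      intro x hx1 hx3
      rw [o1.v x (by omega) (by simp), m1.v x (by omega) (by simp)]
      simp [show x ≠ 20 by omega]
    refine HT.cond ?_ (fun h5 => ?_) (fun h5 => ?_)
    · simp [hτ0, hG', hfr]; omega
    · simp only [Cond.Holds, val_var, val_one] at h5
      obtain ⟨-, hne, s, c, hc1, hc2⟩ := o3.resolve_left (by omega)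
      refine HT.mono (relabelAll_spec hs2 (fun φ hφ => hφ.conflict hc1 hc2)
        (hs2.vert _ hc1).2 le_rfl) ?_ ?_
      · simp [hτ0, hG', hfr]; omega
      rintro ψ ⟨q1, q2, q3⟩
      obtain ⟨φ, hφ⟩ := hs2.inv
      have hlt := numVerts_relabel_lt hφ.symm hne hc1 hc2
      have hle := Nat.mul_le_mul_right C (Nat.succ_le_iff.2 hlt)
      refine ⟨(numVerts (mapVerts (relabel (ω.v 31) (ω.v 32)) G') + 1) * C + 1, ?_, ?_,
        mapVerts (relabel (ω.v 31) (ω.v 32)) G', by simp [mapVerts, hG'], ?_, .inr ⟨?_, le_rfl⟩⟩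
      · have : (numVerts G' + 1) * C = numVerts G' * C + C := by ring
        have : 1 ≤ C := by omega
        simp only [Nat.succ_eq_add_one] at hle
        omega
      · exact Keep.trans k2 q1 (by simp) (by simp) (by simp)
      · simpa [q3, e123, Function.comp_def] using q2
      · rw [q1.v 20 (by simp) (by simp), h5]
    · simp only [Cond.Holds, val_var, val_one] at h5
      obtain ⟨h20, hT⟩ := o3.resolve_right (fun h6 => h5 h6.1)
      refine HT.blk ?_ (by simp) ?_
      · simp [hτ0, hG', hfr]; omega
      refine ⟨1, ?_, k2, G', hG', ?_, .inl ⟨h20, le_rfl, hT, ?_⟩⟩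
      · have : (numVerts G' + 1) * C = numVerts G' * C + C := by ring
        omega
      · simpa [e123] using hs2
      · simp only [effAll]
        rw [o2, o1.v 4 (by simp) (by simp)]
  · rintro n τ ⟨k1, G', hG', hs, h1⟩ hb
    simp only [Cond.Holds, val_var, val_one] at hb
    obtain ⟨-, h2, h3, h4⟩ := h1.resolve_right (fun h => hb h.1)
    exact ⟨h2, k1, G', hG', hs, h3, h4⟩

end RAM

/-! ### The flat path with a given first letter -/

namespace RAM

open FreeGroup Opd Op

variable {r : ℕ}

/-- Search a letter, different from the inverse of the letter `21`, by which conjugation of the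
tuple in the list `10` does not change its length; it becomes the scalar `25`. -/
def flatLetter : Prog :=
  blk [get 26 1 21, const 24 2, const 25 0] ;;
  upto 24 (var 0) (blk [mov 30 (var 24)] ;; conjProg 10 ;;
    cond (.eq (len 11) (len 10)) (cond (.eq (var 24) (var 26)) (blk []) (blk [mov 25 (var 24)]))
      (blk []))

/-- All letters are tried by conjugating the tuple with each. The result `0`, which is no letter
code, means that the flat path ends here. -/
theorem flatLetter_spec {σ : Store} {W : List (FreeGroup (Fin r))} {a : Fin r × Bool} {n : ℕ}
    (hJ : IsInv r (σ.l 1)) (hK : σ.v 0 = 2 * r + 2) (hW : σ.l 10 = encT W) (ha : σ.v 21 = cd a)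
    (hn : 2 * r * ((size W + W.length) * 40 + 40) + 20 ≤ n) :
    HT flatLetter σ n (fun τ => Keep 24 [] [11] σ τ ∧
      ((τ.v 25 = 0 ∧ ∀ b, b ≠ linv a → size (cjT (mk [b]) W) ≠ size W) ∨
        ∃ b, τ.v 25 = cd b ∧ b ≠ linv a ∧ size (cjT (mk [b]) W) = size W)) := by
  have hlt := cd_lt a
  refine HT.blk_seq (by simp; omega) (by simp [ha, hJ.length, hlt]) ?_
  refine HT.upto (k₀ := 2) (m := 2 * r + 2) (c := (size W + W.length) * 40 + 36)
    (fun k τ => Keep 24 [] [11] σ τ ∧ τ.v 26 = cd (linv a) ∧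
      ((τ.v 25 = 0 ∧ ∀ b, cd b < k → b ≠ linv a → size (cjT (mk [b]) W) ≠ size W) ∨
        ∃ b, τ.v 25 = cd b ∧ b ≠ linv a ∧ size (cjT (mk [b]) W) = size W))
    ⟨?_, ?_, .inl ⟨by simp, fun b hb => ?_⟩⟩ (by simp) (by omega)
    (fun k τ h => by simp [h.1.v, hK]) ?_ ?_ ?_
  · exact Keep.set (Keep.set (Keep.set (Keep.refl _ _ _ _) (by simp)) (by simp)) (by simp)
  · simpa [ha] using hJ.get a
  · have := two_le_cd b; omega
  · rintro k τ hk2 hk ⟨h1, h2, h3⟩ hv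
    obtain ⟨x, hx⟩ := exists_cd hk2 hk
    refine HT.blk_seq (by simp) (by simp) ?_
    refine HT.seq (conjProg_encT (U := W) (x := x) (by simp) (by simpa [h1.l] using hJ)
      (by simp [h1.l, hW]) (by simp [hv, hx]) le_rfl) (by simp) fun υ hυ => ?_
    have e24 : υ.v 24 = k := by simp [hυ.frame.v, hv]
    have e25 : υ.v 25 = τ.v 25 := by simp [hυ.frame.v]
    have e26 : υ.v 26 = cd (linv a) := by simp [hυ.frame.v, h2]
    have k1 : Keep 24 [] [11] σ υ := (Keep.set h1 (by simp)).trans hυ.keep (by simp) (by simp) (by simp)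
    have hc : (υ.l 11).length = (υ.l 10).length ↔ size (cjT (mk [x]) W) = size W := by
      simp [hυ.l, length_encT, h1.l, hW]
    refine HT.cond (by simp) (fun h4 => ?_) (fun h4 => ?_)
    · replace h4 := hc.1 h4
      refine HT.cond (by simp) (fun h5 => ?_) (fun h5 => ?_)
      · simp only [Cond.Holds, val_var, e24, e26, ← hx] at h5
        refine HT.blk (by simp) (by simp) ⟨by simpa using e24, Keep.set k1 (by simp),
          by simpa using e26, ?_⟩
        rcases h3 with ⟨h6, h7⟩ | h6
        · refine .inl ⟨by simpa [e25] using h6, fun b hb hb' => ?_⟩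
          refine h7 b (lt_of_le_of_ne (by omega) fun e => hb' ?_) hb'
          exact cd_injective (by omega)
        · exact .inr (by simpa [e25] using h6)
      · simp only [Cond.Holds, val_var, e24, e26, ← hx] at h5
        refine HT.blk (by simp) (by simp) ⟨by simpa using e24,
          Keep.set (Keep.set k1 (by simp)) (by simp), by simpa using e26, .inr ⟨x, ?_, ?_, h4⟩⟩
        · simp [e24, hx]
        · rintro rfl; exact h5 rfl
    · replace h4 := mt hc.2 h4
      refine HT.blk (by simp) (by simp) ⟨by simpa using e24, Keep.set k1 (by simp),
          by simpa using e26, ?_⟩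
      rcases h3 with ⟨h6, h7⟩ | h6
      · refine .inl ⟨by simpa [e25] using h6, fun b hb hb' => ?_⟩
        rcases Nat.lt_or_ge (cd b) k with h | h
        · exact h7 b h hb'
        · rwa [cd_injective (by omega : cd b = cd x)]
      · exact .inr (by simpa [e25] using h6)
  · have : (size W + W.length) * 40 + 36 + 4 = (size W + W.length) * 40 + 40 := by omega
    rw [this, Nat.add_sub_cancel]
    simp; omega
  · rintro τ ⟨h1, h2, h3⟩ -
    refine ⟨h1, h3.imp_left fun h4 => ⟨h4.1, fun b => h4.2 b (cd_lt b)⟩⟩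

/-- Whether conjugation by `p` takes `U` to `V`. -/
def flag (U V : List (FreeGroup (Fin r))) (p : List (Fin r × Bool)) : ℕ :=
  if cjT (mk p) U = V then 1 else 0

/-- The flags of the first `n` prefixes of `p`. -/
def flags (U V : List (FreeGroup (Fin r))) (p : List (Fin r × Bool)) (n : ℕ) : List ℕ :=
  (List.range n).map fun j => flag U V (p.take j)

theorem flags_succ (U V : List (FreeGroup (Fin r))) (p : List (Fin r × Bool)) :
    flags U V p (p.length + 1) = flags U V p p.length ++ [flag U V p] := by
  simp [flags, List.range_succ]

theorem flags_concat (U V : List (FreeGroup (Fin r))) (p : List (Fin r × Bool))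
    (b : Fin r × Bool) :
    flags U V (p ++ [b]) (p ++ [b]).length = flags U V p p.length ++ [flag U V p] := by
  rw [← flags_succ, List.length_append]
  refine List.map_congr_left fun j hj => ?_
  rw [List.take_append_of_le_length (Nat.lt_succ_iff.1 (List.mem_range.1 hj))]

/-- The list `D` describes all flat paths for `U` with the first letter `a`, and `FL` tells which of
their prefixes conjugate `U` to `V`. Either there is a longest path, and `D` ends with `0`, or the
path is periodic. -/
def Trace (U V : List (FreeGroup (Fin r))) (a : Fin r × Bool) (D FL : List ℕ) : Prop :=
  ∃ p, p.head? = some a ∧ Flat U p ∧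
    ((D = p.map cd ++ [0] ∧ FL = flags U V p (p.length + 1) ∧ ∀ b, ¬ Flat U (p ++ [b])) ∨
      (D = p.map cd ∧ FL = flags U V p p.length ∧ cjT (mk p) U = U ∧ Flat U (p ++ [a])))

def traceStep : Prog :=
  eqProg 10 3 ;; blk [push 13 (var 35), push 12 (var 21), mov 30 (var 21)] ;; conjProg 10 ;;
  copyProg 10 11 ;; flatLetter

/-- Compute the flat path for the tuple in the list `2` with the first letter in the scalar `7`. -/
def traceProg : Prog :=
  blk [clear 12, clear 13, mov 21 (var 7), const 22 1] ;; copyProg 10 2 ;;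
  loop (.eq (var 22) one) (traceStep ;;
    cond (.eq (var 25) zero) (eqProg 10 3 ;; blk [push 13 (var 35), push 12 zero, const 22 0])
      (blk [mov 21 (var 25)] ;; eqProg 10 2 ;;
        cond (.eq (var 35) one) (cond (.eq (var 21) (var 7)) (blk [const 22 0]) (blk []))
          (blk [])))

theorem traceStep_spec {σ : Store} {U V : List (FreeGroup (Fin r))} {p : List (Fin r × Bool)}
    {b : Fin r × Bool} {n : ℕ} (hJ : IsInv r (σ.l 1)) (hK : σ.v 0 = 2 * r + 2)
    (hp : Flat U (p ++ [b])) (h3 : σ.l 3 = encT V) (h12 : σ.l 12 = p.map cd)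
    (h13 : σ.l 13 = flags U V p p.length) (h21 : σ.v 21 = cd b)
    (h10 : σ.l 10 = encT (cjT (mk p) U))
    (hn : 2 * r * ((size U + U.length) * 40 + 40) + (size U + U.length) * 69 + 130 ≤ n) :
    HT traceStep σ n (fun τ => Keep 24 [] [10, 11, 12, 13] σ τ ∧ τ.l 12 = (p ++ [b]).map cd ∧
      τ.l 13 = flags U V (p ++ [b]) (p ++ [b]).length ∧
      τ.l 10 = encT (cjT (mk (p ++ [b])) U) ∧
      ((τ.v 25 = 0 ∧ ∀ c, ¬ Flat U (p ++ [b] ++ [c])) ∨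
        ∃ c, τ.v 25 = cd c ∧ Flat U (p ++ [b] ++ [c]))) := by
  have hpb : cjT (mk (p ++ [b])) U = cjT (mk [b]) (cjT (mk p) U) := by rw [cjT_cjT, mul_mk]
  have hs : size (cjT (mk p) U) = size U := by
    simpa using (flat_concat.1 hp).1.2 p.length le_rfl
  have hs' : size (cjT (mk (p ++ [b])) U) = size U := (flat_concat.1 hp).2.1
  have l10 : (σ.l 10).length = size U + U.length + 1 := by simp [h10, length_encT, hs]
  refine HT.seq (eqProg_spec le_rfl) (by omega) ?_
  rintro υ ⟨hυ, h35⟩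
  rw [h10, h3] at h35
  simp only [encT_injective.eq_iff] at h35
  refine HT.blk_seq (by simp; omega) (by simp) ?_
  refine HT.seq (conjProg_encT (U := cjT (mk p) U) (x := b) (by simp) (by simpa [hυ.l] using hJ)
    (by simp [hυ.l, h10]) (by simp [hυ.frame.v, h21]) le_rfl) ?_ fun ω hω => ?_
  · simp [hs]; omega
  have l11 : (ω.l 11).length = size U + U.length + 1 := by
    simp [hω.l, length_encT, ← hpb, hs']
  refine HT.seq (copyProg_spec (by simp) le_rfl) ?_ fun ψ hψ => ?_
  · simp [hs]; omega
  have f13 : ψ.l 13 = flags U V (p ++ [b]) (p ++ [b]).length := by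
    rw [flags_concat]
    simp [hψ.l, hω.l, hυ.l, h13, h35, flag]
  have f10 : ψ.l 10 = encT (cjT (mk (p ++ [b])) U) := by
    simp [hψ.l, hω.l, hpb]
  have f12 : ψ.l 12 = (p ++ [b]).map cd := by
    simp [hψ.l, hω.l, hυ.l, h12, hυ.frame.v, h21]
  have f1 : ψ.l 1 = σ.l 1 := by simp [hψ.l, hω.l, hυ.l]
  have k1 : Keep 24 [] [10, 11, 12, 13] σ ψ := by
    refine ⟨?_, fun x hx _ => ?_, fun c hc => ?_⟩
    · rw [hψ.frame.inp, hω.frame.inp]; exact hυ.frame.inp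
    · rw [hψ.frame.v x (by omega), hω.frame.v x (by omega)]
      simp [show x ≠ 30 by omega, hυ.frame.v x (by omega)]
    · simp at hc
      simp [hψ.l, hω.l, hυ.l, hc]
  refine HT.mono (flatLetter_spec (W := cjT (mk (p ++ [b])) U) (a := b) (by rw [f1]; exact hJ)
    (by rw [k1.v 0 (by simp) (by simp), hK]) f10
    (by rw [k1.v 21 (by simp) (by simp), h21]) le_rfl) ?_ ?_
  · simp only [hs, hs', length_cjT, l10, l11, List.length_cons, List.length_nil]
    omega
  rintro φ ⟨m1, m2⟩
  have hflat : ∀ c, Flat U (p ++ [b] ++ [c]) ↔ c ≠ linv b ∧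
      size (cjT (mk [c]) (cjT (mk (p ++ [b])) U)) = size (cjT (mk (p ++ [b])) U) := by
    intro c
    rw [flat_concat, cjT_cjT, mul_mk, hs']
    simp [hp, and_comm]
  refine ⟨k1.trans m1 le_rfl (by simp) (by simp), by rw [m1.l 12 (by simp), f12],
    by rw [m1.l 13 (by simp), f13], by rw [m1.l 10 (by simp), f10], ?_⟩
  simp only [hflat]
  rcases m2 with ⟨h4, h5⟩ | ⟨c, h4, h5, h6⟩
  · exact .inl ⟨h4, fun c hc => h5 c hc.1 hc.2⟩
  · exact .inr ⟨c, h4, h5, h6⟩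

/-- The loop stops when no flat letter exists or when the path is back at `U` and about to repeat
its first letter. By `Flat.exists_return` one of these happens within `3 * size U` steps. -/
theorem traceProg_spec {σ : Store} {U V : List (FreeGroup (Fin r))} {a : Fin r × Bool} {n : ℕ}
    (hJ : IsInv r (σ.l 1)) (hK : σ.v 0 = 2 * r + 2) (hU1 : ∃ g ∈ U, g ≠ 1)
    (h2 : σ.l 2 = encT U) (h3 : σ.l 3 = encT V) (h7 : σ.v 7 = cd a)
    (ha : size (cjT (mk [a]) U) = size U)
    (hn : (3 * size U + 1) * ((2 * r + 2) * ((size U + U.length) * 60 + 150)) ≤ n) :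
    HT traceProg σ n (fun τ => Keep 20 [] [10, 11, 12, 13] σ τ ∧
      Trace U V a (τ.l 12) (τ.l 13) ∧ (τ.l 12).length ≤ 3 * size U + 1) := by
  obtain ⟨S, hS⟩ : ∃ S, S = size U + U.length := ⟨_, rfl⟩
  obtain ⟨C, hC⟩ : ∃ C, C = (2 * r + 2) * (S * 60 + 150) := ⟨_, rfl⟩
  rw [← hS, ← hC] at hn
  have hC' : 2 * r * (S * 40 + 40) + S * 109 + 230 ≤ C := by
    have e : C = 2 * r * (S * 40 + 40) + 2 * r * (S * 20 + 110) + S * 120 + 300 := by rw [hC]; ring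
    omega
  have l2 : (σ.l 2).length = S + 1 := by rw [h2, length_encT, hS]
  have hn' : 3 * size U * C + C ≤ n := by
    rwa [Nat.add_mul, Nat.one_mul] at hn
  refine HT.blk_seq (by simp; omega) (by simp) ?_
  refine HT.seq (copyProg_spec (by simp) le_rfl) (by simp [l2]; omega) fun υ hυ => ?_
  refine HT.mono (m := 3 * size U * C + 1) ?_ (by simp [l2]; omega) (fun τ h => h)
  -- The letter `b` in scalar 21 has been chosen but not yet recorded. The condition on `k` says
  -- that no earlier return to `U` was followed by the letter `a`.
  refine HT.loop (fun n τ => Keep 20 [] [10, 11, 12, 13] σ τ ∧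
    ((τ.v 22 = 1 ∧ ∃ p b, Flat U (p ++ [b]) ∧ (p ++ [b]).head? = some a ∧ τ.l 12 = p.map cd ∧
        τ.l 13 = flags U V p p.length ∧ τ.v 21 = cd b ∧ τ.l 10 = encT (cjT (mk p) U) ∧
        (∀ k, 0 < k → k ≤ p.length → (p ++ [b])[k]? = some a → cjT (mk (p.take k)) U ≠ U) ∧
        n = (3 * size U - p.length) * C + 1) ∨
      (τ.v 22 = 0 ∧ 1 ≤ n ∧ Trace U V a (τ.l 12) (τ.l 13) ∧ (τ.l 12).length ≤ 3 * size U + 1)))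
    ?_ ?_ ?_
  · refine ⟨?_, .inl ⟨by simp [hυ.frame.v], [], a, flat_concat.2 ⟨flat_nil _, ha, by simp⟩, by simp,
      by simp [hυ.l], by simp [hυ.l, flags], by simp [hυ.frame.v, h7],
      by simp [hυ.l, h2, ← one_eq_mk], fun k hk hk' => absurd hk' (by simpa using hk.ne'), by simp⟩⟩
    refine Keep.trans (Keep.set (Keep.set (Keep.setL (Keep.setL (Keep.refl _ _ _ _) ?_) ?_) ?_) ?_)
      hυ.keep ?_ ?_ ?_ <;> simp
  · rintro n τ ⟨k1, h4⟩ hb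
    simp only [Cond.Holds, val_var, val_one] at hb
    obtain ⟨-, p, b, hp, hpa, h12, h13, h21, h10, hret, rfl⟩ := h4.resolve_right (by omega)
    -- A longer path would have returned among its first `size U` letters, and the loop would have
    -- stopped then.
    have hlen : p.length + 1 ≤ 3 * size U := by
      by_contra! hlt
      obtain ⟨k, hk0, hk1, hk2, hk3⟩ := Flat.exists_return hU1 hp (by simpa using hlt)
      have hkp : k ≤ p.length := by omega
      refine hret k hk0 hkp ?_ (by rwa [List.take_append_of_le_length hkp] at hk3)
      rw [hk2, ← List.head?_eq_getElem?, hpa]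
    have hcredit : C - 1 + 1 + ((3 * size U - (p.length + 1)) * C + 1) ≤
        (3 * size U - p.length) * C + 1 := by
      have := add_mul_le_mul (C := C)
        (show 3 * size U - p.length = 3 * size U - (p.length + 1) + 1 by omega) le_rfl
      omega
    refine ⟨C - 1, HT.seq (traceStep_spec (by rw [k1.l 1 (by simp)]; exact hJ)
      (by rw [k1.v 0 (by simp) (by simp), hK]) hp (by rw [k1.l 3 (by simp), h3]) h12 h13 h21 h10
      (by rw [← hS])) (by omega) ?_⟩
    rintro ω ⟨m1, m12, m13, m10, m25⟩
    have k2 : Keep 20 [] [10, 11, 12, 13] σ ω := k1.trans m1 (by simp) (by simp) (by simp)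
    have hs' : size (cjT (mk (p ++ [b])) U) = size U := (flat_concat.1 hp).2.1
    have l10 : (ω.l 10).length = S + 1 := by rw [m10, length_encT, hs', length_cjT, hS]
    have w22 : ω.v 22 = 1 := by rw [m1.v 22 (by simp) (by simp), hb]
    refine HT.cond (by omega) (fun h5 => ?_) (fun h5 => ?_)
    · simp only [Cond.Holds, val_var, val_zero] at h5
      obtain ⟨-, h6⟩ := m25.resolve_right (by
        rintro ⟨c, hc, -⟩; have := two_le_cd c; omega)
      refine HT.seq (eqProg_spec le_rfl) (by omega) ?_
      rintro ψ ⟨hψ, h35⟩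
      rw [m10, m1.l 3 (by simp), k1.l 3 (by simp), h3] at h35
      simp only [encT_injective.eq_iff] at h35
      refine HT.blk (by simp; omega) (by simp) ⟨_, hcredit, ?_, .inr ⟨by simp, by omega, ?_, ?_⟩⟩
      · refine Keep.set (Keep.setL (Keep.setL ?_ (by simp)) (by simp)) (by simp)
        exact k2.trans (j := 30) (xs' := []) (ls' := []) ⟨hψ.frame.inp, fun x hx _ => hψ.frame.v x hx,
          fun c _ => hψ.l c⟩ (by simp) (by simp) (by simp)
      · refine ⟨p ++ [b], hpa, hp, .inl ⟨by simp [hψ.l, m12], ?_, h6⟩⟩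
        rw [flags_succ]
        simp [hψ.l, m13, h35, flag]
      · simp [hψ.l, m12]; omega
    · simp only [Cond.Holds, val_var, val_zero] at h5
      obtain ⟨c, hc, h6⟩ := m25.resolve_left (fun h => h5 h.1)
      refine HT.blk_seq (by simp; omega) (by simp) ?_
      refine HT.seq (eqProg_spec le_rfl) (by simp; omega) ?_
      rintro ψ ⟨hψ, h35⟩
      have e10 : (effAll [mov 21 (var 25)] ω).l 10 = encT (cjT (mk (p ++ [b])) U) := by simp [m10]
      have e2 : (effAll [mov 21 (var 25)] ω).l 2 = encT U := by
        simp [m1.l 2, k1.l 2, h2]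
      rw [e10, e2] at h35
      simp only [encT_injective.eq_iff] at h35
      have p21 : ψ.v 21 = cd c := by simp [hψ.frame.v, hc]
      have p7 : ψ.v 7 = cd a := by simp [hψ.frame.v, m1.v, k1.v, h7]
      have p22 : ψ.v 22 = 1 := by simp [hψ.frame.v, w22]
      have k3 : Keep 20 [] [10, 11, 12, 13] σ ψ :=
        (Keep.set k2 (x := 21) (n := ω.v 25) (by simp)).trans (j := 30) (xs' := []) (ls' := [])
          ⟨hψ.frame.inp, fun x hx _ => hψ.frame.v x hx, fun c _ => hψ.l c⟩ (by simp) (by simp)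
          (by simp)
      have p12 : ψ.l 12 = (p ++ [b]).map cd := by simp [hψ.l, m12]
      have p13 : ψ.l 13 = flags U V (p ++ [b]) (p ++ [b]).length := by simp [hψ.l, m13]
      have p10 : ψ.l 10 = encT (cjT (mk (p ++ [b])) U) := by simp [hψ.l, m10]
      have hpa' : (p ++ [b] ++ [c]).head? = some a := by simp [List.head?_append, ← hpa]
      -- Coming back to `U` is not enough: with a different next letter the path goes on in a new
      -- direction.
      have cont : ¬ (cjT (mk (p ++ [b])) U = U ∧ c = a) →
          ∃ p' b', Flat U (p' ++ [b']) ∧ (p' ++ [b']).head? = some a ∧ ψ.l 12 = p'.map cd ∧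
          ψ.l 13 = flags U V p' p'.length ∧ ψ.v 21 = cd b' ∧ ψ.l 10 = encT (cjT (mk p') U) ∧
          (∀ k, 0 < k → k ≤ p'.length → (p' ++ [b'])[k]? = some a →
            cjT (mk (p'.take k)) U ≠ U) ∧
          (3 * size U - (p.length + 1)) * C + 1 = (3 * size U - p'.length) * C + 1 := by
        intro h7
        refine ⟨p ++ [b], c, h6, hpa', p12, p13, p21, p10, fun k hk0 hk1 hk2 hk3 => ?_, by simp⟩
        rw [List.length_append, List.length_singleton] at hk1
        rcases Nat.lt_or_ge p.length k with h | h
        · obtain rfl : k = p.length + 1 := by omega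
          rw [List.take_of_length_le (by simp)] at hk3
          rw [List.getElem?_append_right (by simp)] at hk2
          exact h7 ⟨hk3, by simpa using hk2⟩
        · rw [List.take_append_of_le_length h] at hk3
          rw [List.getElem?_append_left (by simp; omega)] at hk2
          exact hret k hk0 h hk2 hk3
      refine HT.cond (by simp; omega) (fun h7 => ?_) (fun h7 => ?_)
      · have h8 : cjT (mk (p ++ [b])) U = U := by
          by_contra h; simp [h35, h] at h7
        refine HT.cond (by simp; omega) (fun h9 => ?_) (fun h9 => ?_)
        · simp only [Cond.Holds, val_var, p21, p7, cd_injective.eq_iff] at h9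
          subst h9
          refine HT.blk (by simp; omega) (by simp) ⟨_, hcredit, Keep.set k3 (by simp),
            .inr ⟨by simp, by omega, ⟨p ++ [b], hpa, hp, .inr ⟨p12, p13, h8, h6⟩⟩, ?_⟩⟩
          simp [p12]; omega
        · simp only [Cond.Holds, val_var, p21, p7, cd_injective.eq_iff] at h9
          exact HT.blk (by simp; omega) (by simp) ⟨_, hcredit, k3, .inl ⟨p22, cont fun h => h9 h.2⟩⟩
      · refine HT.blk (by simp; omega) (by simp) ⟨_, hcredit, k3, .inl ⟨p22, cont fun h => h7 ?_⟩⟩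
        simp [h35, h.1]
  · rintro n τ ⟨k1, h4⟩ hb
    simp only [Cond.Holds, val_var, val_one] at hb
    obtain ⟨-, h5, h6, h7⟩ := h4.resolve_left (fun h => hb h.1)
    exact ⟨h5, k1, h6, h7⟩

end RAM

/-! ### Following a flat path in the graph -/

namespace RAM

open FreeGroup Opd Op

variable {r : ℕ}

/-- The first `t` entries of the sequence that repeats the list `D`. -/
def cycle (D : List ℕ) (t : ℕ) : List ℕ := (List.range t).map fun j => D.getD (j % D.length) 0

/-- A step in the table `T`; the vertex `v` is represented by `v + 1`, and `0` means that there is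
no edge. -/
def step (T : List ℕ) (x d : ℕ) : ℕ := if x = 0 then 0 else T.getD (x - 1 + d) 0

/-- The vertex that is reached from `u` after `t` steps. -/
def walk (T D : List ℕ) (u t : ℕ) : ℕ := (cycle D t).foldl (step T) (u + 1)

/-- After `t` steps the vertex `v` is reached, and there is a flag at this time. -/
def Hit (T D FL : List ℕ) (u v t : ℕ) : Prop :=
  FL.getD (t % D.length) 0 = 1 ∧ walk T D u t = v + 1

theorem cycle_succ (D : List ℕ) (t : ℕ) :
    cycle D (t + 1) = cycle D t ++ [D.getD (t % D.length) 0] := by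
  simp [cycle, List.range_succ]

theorem cycle_add (D : List ℕ) (s t : ℕ) : ∃ L, cycle D (s + t) = cycle D s ++ L := by
  simp only [cycle, List.range_add, List.map_append]
  exact ⟨_, rfl⟩

theorem cycle_eq_take {D : List ℕ} {t : ℕ} (ht : t ≤ D.length) : cycle D t = D.take t := by
  refine List.ext_getElem (by simp [cycle, ht]) fun i h1 h2 => ?_
  have : i < D.length := by simp at h2; omega
  simp [cycle, Nat.mod_eq_of_lt this, this]

theorem walk_succ (T D : List ℕ) (u t : ℕ) :
    walk T D u (t + 1) = step T (walk T D u t) (D.getD (t % D.length) 0) := by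
  simp [walk, cycle_succ]

theorem foldl_step_zero (T L : List ℕ) : L.foldl (step T) 0 = 0 := by
  induction L with
  | nil => rfl
  | cons d L ih => simpa [step] using ih

theorem walk_ne_zero {T D : List ℕ} {u s t : ℕ} (hst : s ≤ t) (h : walk T D u t ≠ 0) :
    walk T D u s ≠ 0 := by
  obtain ⟨d, rfl⟩ := Nat.exists_eq_add_of_le hst
  obtain ⟨L, hL⟩ := cycle_add D s d
  intro h0
  rw [walk, hL, List.foldl_append] at h
  rw [walk] at h0
  rw [h0, foldl_step_zero] at h
  exact h rfl

theorem foldl_step_iff_reads {T : List ℕ} {G : List (ℕ × (Fin r × Bool) × ℕ)} (hT : Table T G)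
    (hG : ∀ e ∈ G, 2 * r + 2 ∣ e.1 ∧ 2 * r + 2 ∣ e.2.2) {u v : ℕ} (hu : 2 * r + 2 ∣ u)
    {y : List (Fin r × Bool)} : (y.map cd).foldl (step T) (u + 1) = v + 1 ↔ Reads G y u v := by
  induction y generalizing u with
  | nil => simp [Reads]
  | cons c y ih =>
    have e : step T (u + 1) (cd c) = T.getD (u + cd c) 0 := by simp [step]
    simp only [List.map_cons, List.foldl_cons, Reads, e]
    constructor
    · intro h
      by_cases h0 : T.getD (u + cd c) 0 = 0
      · rw [h0, foldl_step_zero] at h; omega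
      · obtain ⟨⟨s, c', t⟩, h1, h2, h3⟩ := hT.of_ne _ h0
        obtain ⟨rfl, rfl⟩ := slot_injective hu (hG _ h1).1 h2
        rw [h3] at h
        exact ⟨t, h1, (ih (hG _ h1).2).1 h⟩
    · rintro ⟨t, h1, h2⟩
      rw [hT.mem _ h1]
      exact (ih (hG _ h1).2).2 h2

theorem _root_.FreeGroup.Reads.dvd {G : List (ℕ × (Fin r × Bool) × ℕ)} {K u v : ℕ}
    (hG : ∀ e ∈ G, K ∣ e.1 ∧ K ∣ e.2.2) {y : List (Fin r × Bool)} (h : Reads G y u v)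
    (hu : K ∣ u) : K ∣ v := by
  induction y generalizing u with
  | nil => obtain rfl := h; exact hu
  | cons c y ih => obtain ⟨t, h1, h2⟩ := h; exact ih h2 (hG _ h1).2

theorem getD_flags {U V : List (FreeGroup (Fin r))} {p : List (Fin r × Bool)} {n j : ℕ}
    (hj : j < n) : (flags U V p n).getD j 0 = 1 ↔ cjT (mk (p.take j)) U = V := by
  simp only [flags, List.getD_eq_getElem?_getD, List.getElem?_map, List.getElem?_range hj,
    Option.map_some, Option.getD_some, flag]
  split_ifs with h <;> simp [h]

/-- Since `p` fixes `U`, the conjugate reached depends only on the phase modulo the period; thus the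
flags of one period serve for all times. -/
theorem exists_cycle_eq {U : List (FreeGroup (Fin r))} {p : List (Fin r × Bool)} (hp : p ≠ [])
    (hU : cjT (mk p) U = U) (t : ℕ) : ∃ y, cycle (p.map cd) t = y.map cd ∧
      cjT (mk y) U = cjT (mk (p.take (t % p.length))) U := by
  have hpos := List.length_pos_iff.2 hp
  induction t with
  | zero => exact ⟨[], by simp [cycle], by simp⟩
  | succ t ih =>
    obtain ⟨y, h1, h2⟩ := ih
    have hlt := Nat.mod_lt t hpos
    refine ⟨y ++ [p[t % p.length]], ?_, ?_⟩
    · rw [cycle_succ, h1, List.length_map, List.map_append]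
      simp [List.getD_eq_getElem?_getD, hlt]
    · rw [← mul_mk, ← cjT_cjT, h2, cjT_cjT, mul_mk, ← List.take_succ_eq_append_getElem hlt]
      rcases Nat.lt_or_ge (t % p.length + 1) p.length with h | h
      · rw [Nat.add_mod_eq_add_mod_right _ (Nat.mod_mod t p.length).symm |>.trans
          (Nat.mod_eq_of_lt h)]
      · have e : t % p.length + 1 = p.length := by omega
        rw [Nat.add_mod_eq_add_mod_right _ (Nat.mod_mod t p.length).symm, e, Nat.mod_self,
          List.take_length, hU]
        simp [← one_eq_mk]

variable {U V : List (FreeGroup (Fin r))} {a : Fin r × Bool} {D FL T : List ℕ}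
  {G : List (ℕ × (Fin r × Bool) × ℕ)} {u v : ℕ}

theorem Trace.ne_nil (h : Trace U V a D FL) : D ≠ [] ∧ FL.length = D.length ∧
    ∀ d ∈ D, d < 2 * r + 2 := by
  obtain ⟨p, h0, -, ⟨rfl, rfl, -⟩ | ⟨rfl, rfl, -⟩⟩ := h
  · refine ⟨by simp, by simp [flags], fun d hd => ?_⟩
    simp only [List.mem_append, List.mem_map, List.mem_singleton] at hd
    obtain ⟨x, -, rfl⟩ | rfl := hd
    · exact cd_lt x
    · omega
  · refine ⟨by rintro h; simp_all, by simp [flags], fun d hd => ?_⟩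
    obtain ⟨x, -, rfl⟩ := List.mem_map.1 hd
    exact cd_lt x

/-- Soundness of the search: a hit yields a path in the graph whose label conjugates `U` to `V`.
Flatness of the label plays no role in this direction. -/
theorem Trace.reads_of_hit (h : Trace U V a D FL) (hT : Table T G)
    (hG : ∀ e ∈ G, 2 * r + 2 ∣ e.1 ∧ 2 * r + 2 ∣ e.2.2) (hu : 2 * r + 2 ∣ u) {t : ℕ}
    (ht : Hit T D FL u v t) :
    ∃ y : List (Fin r × Bool), cycle D t = y.map cd ∧ Reads G y u v ∧ cjT (mk y) U = V := by
  obtain ⟨p, h0, hp, ⟨rfl, rfl, hmax⟩ | ⟨rfl, rfl, hpU, -⟩⟩ := h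
  · obtain ⟨h1, h2⟩ := ht
    -- The end marker `0` leads to a slot that is a multiple of `2 * r + 2`. Such slots are empty,
    -- since letter codes lie strictly between `0` and `2 * r + 2`, so no walk gets beyond a maximal
    -- path.
    have htp : t ≤ p.length := by
      by_contra! hlt
      have h3 : walk T (p.map cd ++ [0]) u (p.length + 1) ≠ 0 := walk_ne_zero hlt (by omega)
      have h4 : walk T (p.map cd ++ [0]) u p.length ≠ 0 := walk_ne_zero hlt.le (by omega)
      obtain ⟨w, hw⟩ := Nat.exists_eq_succ_of_ne_zero h4
      have hw' := hw
      rw [walk, cycle_eq_take (by simp), List.take_append_of_le_length (by simp),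
        List.take_of_length_le (by simp)] at hw'
      have hdvd := ((foldl_step_iff_reads hT hG hu).1 hw').dvd hG hu
      rw [walk_succ, hw, Nat.mod_eq_of_lt (by simp), step, if_neg (by simp)] at h3
      have e : (p.map cd ++ [0]).getD p.length 0 = 0 := by simp [List.getD_eq_getElem?_getD]
      rw [e] at h3
      obtain ⟨e, he, h5, -⟩ := hT.of_ne _ h3
      have h5' : w = e.1 + cd e.2.1 := by simpa using h5
      have h6 := (Nat.dvd_add_right (hG e he).1).1 (h5' ▸ hdvd)
      have h7 := cd_lt e.2.1
      have h8 := two_le_cd e.2.1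
      exact absurd (Nat.le_of_dvd (by omega) h6) (by omega)
    have e : cycle (p.map cd ++ [0]) t = (p.take t).map cd := by
      rw [cycle_eq_take (by simp; omega), List.take_append_of_le_length (by simpa using htp),
        List.map_take]
    refine ⟨p.take t, e, (foldl_step_iff_reads hT hG hu).1 (by rw [← e]; exact h2), ?_⟩
    rw [List.length_append, List.length_map, List.length_singleton,
      Nat.mod_eq_of_lt (by omega)] at h1
    exact (getD_flags (by omega)).1 h1
  · obtain ⟨h1, h2⟩ := ht
    have hne : p ≠ [] := by rintro rfl; simp at h0
    obtain ⟨y, h3, h4⟩ := exists_cycle_eq hne hpU t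
    refine ⟨y, h3, (foldl_step_iff_reads hT hG hu).1 (by rw [← h3]; exact h2), ?_⟩
    rw [List.length_map] at h1
    rw [h4, (getD_flags (Nat.mod_lt _ (List.length_pos_iff.2 hne))).1 h1]

/-- Completeness of the search: by rigidity, every flat path with first letter `a` is an initial
piece of the recorded one or of its periodic continuation. -/
theorem Trace.exists_hit (h : Trace U V a D FL) (hU : ∃ g ∈ U, g ≠ 1) (hT : Table T G)
    (hG : ∀ e ∈ G, 2 * r + 2 ∣ e.1 ∧ 2 * r + 2 ∣ e.2.2) (hu : 2 * r + 2 ∣ u)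
    {y : List (Fin r × Bool)} (hy : Flat U y) (hya : y.head? = some a) (hyU : cjT (mk y) U = V)
    (hyr : Reads G y u v) : Hit T D FL u v y.length := by
  have hyr' := (foldl_step_iff_reads hT hG hu).2 hyr
  obtain ⟨p, h0, hp, ⟨rfl, rfl, hmax⟩ | ⟨rfl, rfl, hpU, hpa⟩⟩ := h
  · obtain ⟨h1, h2⟩ := Flat.eq_take_of_maximal hU hp hmax hy (h0.trans hya.symm)
    refine ⟨?_, ?_⟩
    · rw [List.length_append, List.length_map, List.length_singleton,
        Nat.mod_eq_of_lt (by omega), getD_flags (by omega), ← h2, hyU]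
    · rwa [walk, cycle_eq_take (by simp; omega), List.take_append_of_le_length (by simpa using h1),
        ← List.map_take, ← h2]
  · obtain ⟨h1, h2⟩ := Flat.eq_cycle hU hpa h0 hpU _ y rfl hy (.inr hya)
    have hpos : 0 < p.length := by rcases p with _ | _ <;> simp at h0 ⊢
    refine ⟨?_, ?_⟩
    · rw [List.length_map, getD_flags (Nat.mod_lt _ hpos), ← h2, hyU]
    · have e : cycle (p.map cd) y.length = y.map cd := by
        refine List.ext_getElem? fun i => ?_
        rcases Nat.lt_or_ge i y.length with hi | hi
        · have h3 := Nat.mod_lt i hpos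
          have h4 := h1 i hi
          rw [List.getElem?_eq_getElem hi, List.getElem?_eq_getElem h3] at h4
          simp [cycle, hi, List.getD_eq_getElem?_getD, h3, Option.some.inj h4]
        · simp [cycle, hi]
      rw [walk, e, hyr']

/-- If a vertex is ever hit, then it is hit early. -/
theorem exists_hit_lt {E : List ℕ} (hE : ∀ x, T.getD x 0 ≠ 0 → T.getD x 0 - 1 ∈ E)
    (hD : D ≠ []) (h : ∃ t, Hit T D FL u v t) :
    ∃ t < (E.length + 1) * D.length, Hit T D FL u v t := by
  obtain ⟨t, ht⟩ := h
  have hpos := List.length_pos_iff.2 hD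
  induction t using Nat.strong_induction_on with
  | _ t ih =>
    by_cases hlt : t < (E.length + 1) * D.length
    · exact ⟨t, hlt, ht⟩
    push Not at hlt
    -- Pigeonhole over the ends of periods. Time zero is left out because the starting vertex need
    -- not be the target of an edge.
    have hmem : ∀ j ∈ Finset.range (E.length + 1),
        walk T D u ((j + 1) * D.length) - 1 ∈ E.toFinset := by
      intro j hj
      rw [Finset.mem_range] at hj
      have h1 : (j + 1) * D.length ≤ t := (Nat.mul_le_mul_right _ hj).trans hlt
      obtain ⟨s, hs⟩ : ∃ s, (j + 1) * D.length = s + 1 :=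
        ⟨(j + 1) * D.length - 1, (Nat.succ_pred_eq_of_pos (Nat.mul_pos (by omega) hpos)).symm⟩
      have h2 := walk_ne_zero h1 (by rw [ht.2]; simp)
      rw [hs, walk_succ, step] at h2 ⊢
      split_ifs at h2 ⊢ with h3
      · exact absurd rfl h2
      · exact List.mem_toFinset.2 (hE _ h2)
    obtain ⟨i, hi, j, hj, hij, heq⟩ := Finset.exists_ne_map_eq_of_card_lt_of_maps_to
      (by rw [Finset.card_range]; exact Nat.lt_succ_of_le E.toFinset_card_le) hmem
    rw [Finset.mem_range] at hi hj
    wlog hlt' : i < j generalizing i j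
    · exact this j hj i hi hij.symm heq.symm (by omega)
    have hjt : (j + 1) * D.length ≤ t := (Nat.mul_le_mul_right _ hj).trans hlt
    have hle : (i + 1) * D.length ≤ (j + 1) * D.length := Nat.mul_le_mul_right _ (by omega)
    have h1 := walk_ne_zero hjt (by rw [ht.2]; simp)
    have h2 := walk_ne_zero (hle.trans hjt) (by rw [ht.2]; simp)
    replace heq : walk T D u ((i + 1) * D.length) = walk T D u ((j + 1) * D.length) := by omega
    -- Equal vertices at equal phases have the same future, so the part between them can be cut out,
    -- which gives an earlier hit.
    have key : ∀ d, walk T D u ((i + 1) * D.length + d) = walk T D u ((j + 1) * D.length + d) := by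
      intro d
      induction d with
      | zero => exact heq
      | succ d ihd =>
        rw [← Nat.add_assoc, ← Nat.add_assoc, walk_succ, walk_succ, ihd, Nat.mul_add_mod_self_right,
          Nat.mul_add_mod_self_right]
    obtain ⟨d, rfl⟩ := Nat.exists_eq_add_of_le hjt
    refine ih ((i + 1) * D.length + d) ?_ ⟨?_, ?_⟩
    · have := Nat.mul_lt_mul_of_pos_right (Nat.succ_lt_succ hlt') hpos
      simp only [Nat.succ_eq_add_one] at this
      omega
    · rw [Nat.mul_add_mod_self_right, ← ht.1, Nat.mul_add_mod_self_right]
    · rw [key, ht.2]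

/-- Follow the flat path in the lists `12` and `13` through the graph. -/
def followCheck : Prog :=
  blk [get 25 13 22] ;;
  cond (.eq (var 25) one) (cond (.eq (var 21) (var 3)) (blk [const 6 1, const 24 0]) (blk []))
    (blk [])

def followStep : Prog :=
  blk [get 25 12 22, mov 26 (var 21)] ;; addProg 26 (var 25) ;; blk [get 27 9 26] ;;
  cond (.eq (var 27) zero) (blk [const 24 0])
    (blk [push 14 (var 25), mov 21 (var 27), dec 21, inc 22] ;;
      cond (.eq (var 22) (len 12)) (blk [const 22 0, inc 23] ;;
        cond (.lt (len 6) (var 23)) (blk [const 24 0]) (blk [])) (blk []))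

/-- Search a flag on the flat path in the lists `12` and `13` at which the vertex `3` is reached
from the vertex `2`; if there is one, then the scalar `6` becomes `1`, and the path is collected in
the list `14`. -/
def followProg : Prog :=
  blk [mov 21 (var 2), const 22 0, const 23 0, const 24 1, clear 14] ;;
  loop (.eq (var 24) one) (followCheck ;; cond (.eq (var 24) one) followStep (blk []))

theorem followCheck_spec {σ : Store} {n : ℕ} (h : σ.v 22 < (σ.l 13).length)
    (h24 : σ.v 24 = 1) (h6 : σ.v 6 = 0) (hn : 12 ≤ n) :
    HT followCheck σ n (fun τ => Keep 24 [6] [] σ τ ∧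
      if (σ.l 13).getD (σ.v 22) 0 = 1 ∧ σ.v 21 = σ.v 3 then τ.v 6 = 1 ∧ τ.v 24 = 0
      else τ.v 6 = 0 ∧ τ.v 24 = 1) := by
  refine HT.blk_seq (by simp; omega) (by simpa using h) ?_
  refine HT.cond (by simp; omega) (fun h1 => ?_) (fun h1 => ?_)
  · simp only [Cond.Holds, effAll, eff, val_var, val_one, Store.set_v, if_true] at h1
    refine HT.cond (by simp; omega) (fun h2 => ?_) (fun h2 => ?_)
    · simp at h2
      refine HT.blk (by simp; omega) (by simp) ⟨?_, by rw [if_pos ⟨h1, h2⟩]; simp⟩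
      exact Keep.set (Keep.set (Keep.set (Keep.refl _ _ _ _) (by simp)) (by simp)) (by simp)
    · simp at h2
      refine HT.blk (by simp; omega) (by simp) ⟨Keep.set (Keep.refl _ _ _ _) (by simp), ?_⟩
      rw [if_neg (fun h => h2 h.2)]
      simp [h24, h6]
  · simp only [Cond.Holds, effAll, eff, val_var, val_one, Store.set_v, if_true] at h1
    refine HT.blk (by simp; omega) (by simp) ⟨Keep.set (Keep.refl _ _ _ _) (by simp), ?_⟩
    rw [if_neg (fun h => h1 h.1)]
    simp [h24, h6]

theorem followStep_spec {σ : Store} {n K : ℕ} (h22 : σ.v 22 < (σ.l 12).length)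
    (hK : (σ.l 12).getD (σ.v 22) 0 ≤ K)
    (h9 : σ.v 21 + (σ.l 12).getD (σ.v 22) 0 < (σ.l 9).length) (h24 : σ.v 24 = 1)
    (hn : K * 7 + 40 ≤ n) :
    HT followStep σ n (fun τ => Keep 20 [] [14] σ τ ∧
      (((σ.l 9).getD (σ.v 21 + (σ.l 12).getD (σ.v 22) 0) 0 = 0 ∧ τ.v 24 = 0) ∨
        (σ.l 9).getD (σ.v 21 + (σ.l 12).getD (σ.v 22) 0) 0 = τ.v 21 + 1 ∧
        τ.l 14 = σ.l 14 ++ [(σ.l 12).getD (σ.v 22) 0] ∧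
        ((σ.v 22 + 1 < (σ.l 12).length ∧ τ.v 22 = σ.v 22 + 1 ∧ τ.v 23 = σ.v 23 ∧ τ.v 24 = 1) ∨
          (σ.v 22 + 1 = (σ.l 12).length ∧ τ.v 22 = 0 ∧ τ.v 23 = σ.v 23 + 1 ∧
            -- Scalar 23 counts completed rounds. The last alternative is excluded by the loop
            -- invariant of `followProg_spec`.
            ((τ.v 23 ≤ (σ.l 6).length ∧ τ.v 24 = 1) ∨ (τ.v 23 = (σ.l 6).length + 1 ∧ τ.v 24 = 0)
              ∨ (σ.l 6).length < σ.v 23))))) := by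
  obtain ⟨d, hd⟩ : ∃ d, d = (σ.l 12).getD (σ.v 22) 0 := ⟨_, rfl⟩
  rw [← hd] at hK h9 ⊢
  refine HT.blk_seq (by simp; omega) (by simpa using h22) ?_
  have e25 : (effAll [get 25 12 22, mov 26 (var 21)] σ).v 25 = d := by
    simp only [effAll, eff, Store.set_v, ← hd, Nat.reduceEqDiff, if_true, if_false]
  refine HT.seq (addProg_spec (by simp) (by simp) (by simp) le_rfl) (by rw [e25]; simp; omega) ?_
  rw [e25]
  rintro υ ⟨hi, hl, hv⟩
  have f26 : υ.v 26 = σ.v 21 + d := by rw [hv 26 (by simp)]; simp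
  have f25 : υ.v 25 = d := by rw [hv 25 (by simp), if_neg (by simp), e25]
  have fv : ∀ x, x < 25 → υ.v x = σ.v x := by
    intro x hx
    rw [hv x (by omega), if_neg (by omega)]
    simp [show x ≠ 25 by omega, show x ≠ 26 by omega]
  have fl : ∀ b, υ.l b = σ.l b := hl
  have k1 : Keep 20 [] [14] σ υ := ⟨hi, fun x hx _ => fv x (by omega), fun b _ => fl b⟩
  obtain ⟨x, hx⟩ : ∃ x, x = (σ.l 9).getD (σ.v 21 + d) 0 := ⟨_, rfl⟩
  rw [← hx]
  refine HT.blk_seq (by simp; omega) (by simpa [f26, fl] using h9) ?_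
  have e27 : (effAll [get 27 9 26] υ).v 27 = x := by
    simp only [effAll, eff, Store.set_v, f26, fl, hx, if_true]
  obtain ⟨ψ, hψ⟩ : ∃ ψ, ψ = effAll [get 27 9 26] υ := ⟨_, rfl⟩
  have k2 : Keep 20 [] [14] σ ψ := by rw [hψ]; exact Keep.set k1 (by simp)
  have gv : ∀ x, x < 25 → ψ.v x = σ.v x := by
    intro x hx; rw [hψ, ← fv x hx]; simp [show x ≠ 27 by omega]
  have gl : ∀ b, ψ.l b = σ.l b := by intro b; rw [hψ, ← fl]; rfl
  have g25 : ψ.v 25 = d := by rw [hψ, ← f25]; simp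
  rw [← hψ] at e27 ⊢
  clear hψ
  refine HT.cond (by simp; omega) (fun h1 => ?_) (fun h1 => ?_)
  · simp only [Cond.Holds, val_var, val_zero, e27] at h1
    exact HT.blk (by simp; omega) (by simp) ⟨Keep.set k2 (by simp), .inl ⟨h1, by simp⟩⟩
  · simp only [Cond.Holds, val_var, val_zero, e27] at h1
    refine HT.blk_seq (by simp; omega) (by simp) ?_
    obtain ⟨ω, hω⟩ : ∃ ω, ω = effAll [push 14 (var 25), mov 21 (var 27), dec 21, inc 22] ψ := ⟨_, rfl⟩
    have k3 : Keep 20 [] [14] σ ω := by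
      rw [hω]
      exact Keep.set (Keep.set (Keep.set (Keep.setL k2 (by simp)) (by simp)) (by simp)) (by simp)
    have w21 : x = ω.v 21 + 1 := by rw [hω]; simp [e27]; omega
    have w22 : ω.v 22 = σ.v 22 + 1 := by rw [hω]; simp [gv]
    have w23 : ω.v 23 = σ.v 23 := by rw [hω]; simp [gv]
    have w24 : ω.v 24 = 1 := by rw [hω]; simp [gv, h24]
    have w14 : ω.l 14 = σ.l 14 ++ [d] := by rw [hω]; simp [gl, g25]
    have wl : ∀ b ≠ 14, ω.l b = σ.l b := by intro b hb; rw [hω]; simp [gl, hb]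
    rw [← hω]
    clear hω
    refine HT.cond (by simp; omega) (fun h2 => ?_) (fun h2 => ?_)
    · simp only [Cond.Holds, val_var, val_len, w22, wl 12 (by simp)] at h2
      refine HT.blk_seq (by simp; omega) (by simp) ?_
      refine HT.cond (by simp; omega) (fun h3 => ?_) (fun h3 => ?_)
      · simp [w23, wl] at h3
        refine HT.blk (by simp; omega) (by simp) ⟨?_, .inr ⟨by simpa using w21, by simpa using w14,
          .inr ⟨h2, by simp, by simp [w23], .inr ?_⟩⟩⟩
        · exact Keep.set (Keep.set (Keep.set k3 (by simp)) (by simp)) (by simp)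
        · simp [w23]; omega
      · simp [w23, wl] at h3
        refine HT.blk (by simp; omega) (by simp) ⟨?_, .inr ⟨by simpa using w21, by simpa using w14,
          .inr ⟨h2, by simp, by simp [w23], .inl ?_⟩⟩⟩
        · exact Keep.set (Keep.set k3 (by simp)) (by simp)
        · simp [w23, w24]; omega
    · simp only [Cond.Holds, val_var, val_len, w22, wl 12 (by simp)] at h2
      exact HT.blk (by simp; omega) (by simp) ⟨k3, .inr ⟨w21, w14, .inl ⟨by omega, w22, w23, w24⟩⟩⟩

/-- Time is kept as a number of rounds and a position in the round, which avoids division. Bounding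
the rounds by the number of edges plus one loses no hits, by `exists_hit_lt`. -/
theorem followProg_spec {σ : Store} {n K : ℕ} (hD : σ.l 12 ≠ [])
    (hFL : (σ.l 13).length = (σ.l 12).length) (hK : ∀ d ∈ σ.l 12, d < K)
    (hT : ∀ x, (σ.l 9).getD x 0 ≠ 0 → (σ.l 9).getD x 0 - 1 ∈ σ.l 8)
    (h8 : ∀ x ∈ σ.l 8, x + K ≤ (σ.l 9).length) (h2 : σ.v 2 + K ≤ (σ.l 9).length)
    (h68 : (σ.l 8).length = (σ.l 6).length) (h6 : σ.v 6 = 0)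
    (hn : ((σ.l 6).length + 1) * (σ.l 12).length * (K * 7 + 60) + 20 ≤ n) :
    HT followProg σ n (fun τ => Keep 20 [6] [14] σ τ ∧
      ((τ.v 6 = 1 ∧ ∃ t ≤ ((σ.l 6).length + 1) * (σ.l 12).length,
        Hit (σ.l 9) (σ.l 12) (σ.l 13) (σ.v 2) (σ.v 3) t ∧ τ.l 14 = cycle (σ.l 12) t) ∨
      (τ.v 6 = 0 ∧ ∀ t, ¬ Hit (σ.l 9) (σ.l 12) (σ.l 13) (σ.v 2) (σ.v 3) t))) := by
  obtain ⟨D, hDeq⟩ : ∃ D, D = σ.l 12 := ⟨_, rfl⟩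
  obtain ⟨FL, hFLeq⟩ : ∃ FL, FL = σ.l 13 := ⟨_, rfl⟩
  obtain ⟨T, hTeq⟩ : ∃ T, T = σ.l 9 := ⟨_, rfl⟩
  obtain ⟨m, hm⟩ : ∃ m, m = (σ.l 6).length := ⟨_, rfl⟩
  obtain ⟨C, hC⟩ : ∃ C, C = K * 7 + 60 := ⟨_, rfl⟩
  rw [← hDeq] at hD hFL hK hn ⊢
  rw [← hFLeq] at hFL ⊢
  rw [← hTeq] at hT h8 h2 ⊢
  rw [← hm] at h68 hn ⊢
  rw [← hC] at hn
  have hpos := List.length_pos_iff.2 hD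
  refine HT.blk_seq (by simp; omega) (by simp) ?_
  refine HT.mono (m := (m + 1) * D.length * C + 1) ?_ (by simp; omega) (fun τ h => h)
  refine HT.loop (fun n τ => Keep 20 [6] [14] σ τ ∧
    ((τ.v 24 = 1 ∧ τ.v 6 = 0 ∧ ∃ t, t = D.length * τ.v 23 + τ.v 22 ∧ τ.v 22 < D.length ∧
        τ.v 23 ≤ m ∧ walk T D (σ.v 2) t = τ.v 21 + 1 ∧ τ.v 21 + K ≤ T.length ∧
        τ.l 14 = cycle D t ∧ (∀ s < t, ¬ Hit T D FL (σ.v 2) (σ.v 3) s) ∧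
        n = ((m + 1) * D.length - t) * C + 1) ∨
      (τ.v 24 = 0 ∧ 1 ≤ n ∧ ((τ.v 6 = 1 ∧ ∃ t ≤ (m + 1) * D.length, Hit T D FL (σ.v 2) (σ.v 3) t ∧
        τ.l 14 = cycle D t) ∨ (τ.v 6 = 0 ∧ ∀ t, ¬ Hit T D FL (σ.v 2) (σ.v 3) t))))) ?_ ?_ ?_
  · refine ⟨?_, .inl ⟨by simp, by simp [h6], 0, by simp, by simpa using hpos, by simp, ?_, ?_,
      by simp [cycle], by simp, by simp⟩⟩
    · exact Keep.setL (Keep.set (Keep.set (Keep.set (Keep.set (Keep.refl _ _ _ _) (by simp))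
        (by simp)) (by simp)) (by simp)) (by simp)
    · simp [walk, cycle]
    · simpa using h2
  · rintro n τ ⟨k1, h⟩ hb
    simp only [Cond.Holds, val_var, val_one] at hb
    obtain ⟨-, h6', t, ht, h22, h23, hw, h21, h14, hno, rfl⟩ := h.resolve_right (by omega)
    have hmod : t % D.length = τ.v 22 := by rw [ht, Nat.mul_add_mod, Nat.mod_eq_of_lt h22]
    have htlt : t + 1 ≤ (m + 1) * D.length := by
      have := Nat.mul_le_mul_left D.length h23
      have e : (m + 1) * D.length = D.length * m + D.length := by ring
      omega
    have hcredit : C - 1 + 1 + (((m + 1) * D.length - (t + 1)) * C + 1) ≤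
        ((m + 1) * D.length - t) * C + 1 := by
      have := add_mul_le_mul (C := C)
        (show (m + 1) * D.length - t = (m + 1) * D.length - (t + 1) + 1 by omega) le_rfl
      omega
    have l12 : τ.l 12 = D := by rw [k1.l 12 (by simp), hDeq]
    have l13 : τ.l 13 = FL := by rw [k1.l 13 (by simp), hFLeq]
    have l9 : τ.l 9 = T := by rw [k1.l 9 (by simp), hTeq]
    have l6 : (τ.l 6).length = m := by rw [k1.l 6 (by simp), hm]
    refine ⟨C - 1, HT.seq (followCheck_spec (by rw [l13, hFL]; exact h22) hb h6' le_rfl)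
      (by omega) ?_⟩
    rintro υ ⟨m1, m2⟩
    have k2 : Keep 20 [6] [14] σ υ := k1.trans m1 (by simp) (by simp) (by simp)
    rw [l13, k1.v 3 (by simp) (by simp)] at m2
    have hhit : Hit T D FL (σ.v 2) (σ.v 3) t ↔ FL.getD (τ.v 22) 0 = 1 ∧ τ.v 21 = σ.v 3 := by
      rw [Hit, hmod, hw, Nat.add_right_cancel_iff]
    refine HT.cond (by omega) (fun h3 => ?_) (fun h3 => ?_)
    · simp only [Cond.Holds, val_var, val_one] at h3
      have hnot : ¬ Hit T D FL (σ.v 2) (σ.v 3) t := by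
        rw [hhit]; intro h4; rw [if_pos h4] at m2; omega
      rw [if_neg (mt hhit.2 hnot)] at m2
      have hno' : ∀ s < t + 1, ¬ Hit T D FL (σ.v 2) (σ.v 3) s := by
        intro s hs
        rcases Nat.lt_or_ge s t with h | h
        · exact hno s h
        · obtain rfl : s = t := by omega
          exact hnot
      have e22 : υ.v 22 = τ.v 22 := m1.v 22 (by simp) (by simp)
      have e21 : υ.v 21 = τ.v 21 := m1.v 21 (by simp) (by simp)
      have e23 : υ.v 23 = τ.v 23 := m1.v 23 (by simp) (by simp)
      have e12 : υ.l 12 = D := by rw [m1.l 12 (by simp), l12]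
      have e9 : υ.l 9 = T := by rw [m1.l 9 (by simp), l9]
      have e14 : υ.l 14 = cycle D t := by rw [m1.l 14 (by simp), h14]
      have e6 : (υ.l 6).length = m := by rw [m1.l 6 (by simp), l6]
      have hdK : D.getD (τ.v 22) 0 < K := by
        apply hK
        rw [List.getD_eq_getElem?_getD, List.getElem?_eq_getElem h22]
        exact List.getElem_mem h22
      have hstep : walk T D (σ.v 2) (t + 1) = T.getD (τ.v 21 + D.getD (τ.v 22) 0) 0 := by
        rw [walk_succ, hw, hmod, step, if_neg (by simp), Nat.add_sub_cancel]
      refine HT.mono (followStep_spec (K := K) (by rw [e22, e12]; exact h22) ?_ ?_ h3 le_rfl)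
        (by omega) ?_
      · rw [e12, e22]; exact hdK.le
      · rw [e12, e22, e21, e9]; omega
      rintro ω ⟨o1, o2⟩
      rw [e12, e9, e14, e22, e21, e23, e6, ← hstep] at o2
      have k3 : Keep 20 [6] [14] σ ω := k2.trans o1 le_rfl (by simp) (by simp)
      have o6 : ω.v 6 = 0 := by rw [o1.v 6 (by simp) (by simp), m2.1]
      refine ⟨_, hcredit, k3, ?_⟩
      rcases o2 with ⟨o2, o3⟩ | ⟨o2, o3, o4⟩
      · refine .inr ⟨o3, by omega, .inr ⟨o6, fun s hs => ?_⟩⟩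
        rcases Nat.lt_or_ge s (t + 1) with h | h
        · exact hno' s h hs
        · exact walk_ne_zero h (by rw [hs.2]; simp) o2
      · have o3' : ω.l 14 = cycle D (t + 1) := by rw [o3, cycle_succ, hmod]
        have o5 : ω.v 21 + K ≤ T.length := by
          have h4 := hT (τ.v 21 + D.getD (τ.v 22) 0) (by rw [← hstep, o2]; simp)
          rw [← hstep, o2, Nat.add_sub_cancel] at h4
          exact h8 _ h4
        rcases o4 with ⟨p1, p2, p3, p4⟩ | ⟨p1, p2, p3, p4⟩
        · exact .inl ⟨p4, o6, t + 1, by rw [p3, p2, ht]; ring, by omega, by omega, o2, o5, o3',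
            hno', rfl⟩
        · have ht' : t + 1 = D.length * ω.v 23 + ω.v 22 := by
            rw [p2, p3, Nat.mul_add, ht]; omega
          rcases p4 with ⟨p4, p5⟩ | ⟨p4, p5⟩ | p4
          · exact .inl ⟨p5, o6, t + 1, ht', by omega, p4, o2, o5, o3', hno', rfl⟩
          -- The rounds are used up without a hit, so by `exists_hit_lt` there is none at any time.
          · refine .inr ⟨p5, by omega, .inr ⟨o6, fun s hs => ?_⟩⟩
            obtain ⟨s', hs', hs''⟩ := exists_hit_lt hT hD ⟨s, hs⟩
            refine hno' s' ?_ hs''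
            rw [h68] at hs'
            rw [ht', p4, p2, Nat.mul_comm, Nat.add_zero]
            exact hs'
          · omega
    · simp only [Cond.Holds, val_var, val_one] at h3
      split_ifs at m2 with h4
      · refine HT.blk (by simp; omega) (by simp) ⟨_, hcredit, k2, .inr ⟨m2.2, by omega,
          .inl ⟨m2.1, t, by omega, hhit.2 h4, ?_⟩⟩⟩
        simpa [h14] using m1.l 14 (by simp)
      · omega
  · rintro n τ ⟨k1, h⟩ hb
    simp only [Cond.Holds, val_var, val_one] at hb
    obtain ⟨-, h5, h6⟩ := h.resolve_left (fun h => hb h.1)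
    exact ⟨h5, k1, h6⟩

end RAM

/-! ### The search for a conjugator -/

namespace RAM

open FreeGroup Opd Op

variable {r : ℕ}

def letterProg : Prog :=
  blk [mov 30 (var 7)] ;; conjProg 2 ;;
  cond (.eq (len 11) (len 2)) (traceProg ;; followProg) (blk [])

def searchProg : Prog :=
  blk [const 6 0, clear 14] ;; eqProg 2 3 ;;
  cond (.eq (var 35) one) (cond (.eq (var 2) (var 3)) (blk [const 6 1]) (blk [])) (blk []) ;;
  blk [const 7 2] ;; upto 7 (var 0) (cond (.eq (var 6) zero) letterProg (blk []))

variable {A : Subgroup (FreeGroup (Fin r))} {σ : Store} {G : List (ℕ × (Fin r × Bool) × ℕ)}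
  {M : List (List (Fin r × Bool) × ℕ)} {p q : List (Fin r × Bool)} {U V : List (FreeGroup (Fin r))}

/-- The tuples `U` and `V` and the folded graph `G` are stored in the lists `2`, `3` and `6` to
`9`. -/
structure SState (A : Subgroup (FreeGroup (Fin r))) (σ : Store) (U V : List (FreeGroup (Fin r)))
    (G : List (ℕ × (Fin r × Bool) × ℕ)) (M : List (List (Fin r × Bool) × ℕ))
    (p q : List (Fin r × Bool)) : Prop where
  inv : IsInv r (σ.l 1)
  card : σ.v 0 = 2 * r + 2
  left : σ.l 2 = encT U
  right : σ.l 3 = encT V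
  graph : GState A σ G ((p, σ.v 2) :: (q, σ.v 3) :: M)
  table : Table (σ.l 9) G
  length : (σ.l 9).length = σ.v 4 + (2 * r + 2)

/-- `SState` depends only on lists below 10 and on scalars below 6, whereas the search works outside
this range. -/
theorem Keep.sState {τ : Store} {ls : List ℕ} (h : Keep 20 [6, 7] ls σ τ)
    (hs : SState A σ U V G M p q) (hls : ∀ a ∈ ls, 10 ≤ a) : SState A τ U V G M p q := by
  have hl : ∀ a < 10, τ.l a = σ.l a := fun a ha => h.l a fun hm => by have := hls a hm; omega
  have hv : ∀ x < 6, τ.v x = σ.v x := fun x hx => h.v x (by omega) (by simp; omega)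
  constructor
  · rw [hl 1 (by simp)]; exact hs.inv
  · rw [hv 0 (by simp)]; exact hs.card
  · rw [hl 2 (by simp)]; exact hs.left
  · rw [hl 3 (by simp)]; exact hs.right
  · rw [hv 2 (by simp), hv 3 (by simp)]
    exact hs.graph.congr (hv 1 (by simp)) (hv 4 (by simp)) (hl 6 (by simp)) (hl 7 (by simp))
      (hl 8 (by simp))
  · rw [hl 9 (by simp)]; exact hs.table
  · rw [hl 9 (by simp), hv 4 (by simp)]; exact hs.length

/-- The scalar `6` tells whether a conjugator of bounded length has been found in the list `14`. -/
def Found (σ τ : Store) (U V : List (FreeGroup (Fin r))) (G : List (ℕ × (Fin r × Bool) × ℕ)) :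
    Prop :=
  τ.v 6 = 1 ∧ ∃ y : List (Fin r × Bool), y.length ≤ (G.length + 1) * (3 * size U + 1) ∧
    τ.l 14 = y.map cd ∧ Reads G y (σ.v 2) (σ.v 3) ∧ cjT (mk y) U = V

/-- A first letter that changes the size starts no flat path and is skipped. For the others, a
failed search excludes every suitable flat path that begins with `c`. -/
theorem letterProg_spec {c : Fin r × Bool} {n : ℕ} (hs : SState A σ U V G M p q)
    (h7 : σ.v 7 = cd c) (h6 : σ.v 6 = 0) (hU : ∃ g ∈ U, g ≠ 1)
    (hn : (size U + U.length) * 40 + (3 * size U + 1) * ((2 * r + 2) *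
      ((size U + U.length) * 60 + 150)) + (G.length + 1) * (3 * size U + 1) *
        ((2 * r + 2) * 7 + 60) + 60 ≤ n) :
    HT letterProg σ n (fun τ => Keep 20 [6] [10, 11, 12, 13, 14] σ τ ∧
      (Found σ τ U V G ∨ (τ.v 6 = 0 ∧ ∀ y, Flat U y → Reads G y (σ.v 2) (σ.v 3) →
        cjT (mk y) U = V → y.head? ≠ some c))) := by
  refine HT.blk_seq (by simp; omega) (by simp) ?_
  refine HT.seq (conjProg_encT (U := U) (x := c) (by simp) hs.inv hs.left (by simp [h7]) le_rfl)
    (by simp; omega) fun υ hυ => ?_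
  have k1 : Keep 20 [6] [10, 11, 12, 13, 14] σ υ :=
    (Keep.set (Keep.refl _ _ _ _) (x := 30) (n := σ.v 7) (by simp)).trans hυ.keep (by simp)
      (by simp) (by simp)
  have e6 : υ.v 6 = 0 := by simp [hυ.frame.v, h6]
  have k1' : Keep 20 [6, 7] [10, 11, 12, 13, 14] σ υ :=
    ⟨k1.inp, fun x hx hx' => k1.v x hx (by simp at hx' ⊢; omega), k1.l⟩
  have hs1 : SState A υ U V G M p q := k1'.sState hs (by simp)
  have hc : (υ.l 11).length = (υ.l 2).length ↔ size (cjT (mk [c]) U) = size U := by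
    simp [hυ.l, length_encT, hs.left]
  refine HT.cond (by simp; omega) (fun h1 => ?_) (fun h1 => ?_)
  · replace h1 := hc.1 h1
    refine HT.seq (traceProg_spec hs1.inv hs1.card hU hs1.left hs1.right
      (by rw [k1.v 7 (by simp) (by simp), h7]) h1 le_rfl) (by simp; omega) ?_
    rintro ω ⟨m1, m2, m3⟩
    obtain ⟨t1, t2, t3⟩ := m2.ne_nil
    have k2 : Keep 20 [6] [10, 11, 12, 13, 14] σ ω := k1.trans m1 le_rfl (by simp) (by simp)
    have k2' : Keep 20 [6, 7] [10, 11, 12, 13, 14] σ ω :=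
      ⟨k2.inp, fun x hx hx' => k2.v x hx (by simp at hx' ⊢; omega), k2.l⟩
    have hs2 : SState A ω U V G M p q := k2'.sState hs (by simp)
    have hG := hs2.graph
    have hE : ∀ e ∈ G, 2 * r + 2 ∣ e.1 ∧ 2 * r + 2 ∣ e.2.2 := fun e he =>
      ⟨(hG.vert e he).1.2, (hG.vert e he).2.2⟩
    have hα := hG.mark (p, ω.v 2) (by simp)
    have l6 : (ω.l 6).length = G.length := by simp [hG.src]
    have hle : (G.length + 1) * (ω.l 12).length ≤ (G.length + 1) * (3 * size U + 1) :=
      Nat.mul_le_mul_left _ m3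
    refine HT.mono (followProg_spec (K := 2 * r + 2) t1 t2 t3 ?_ ?_ ?_ (by simp [hG.src, hG.tgt])
      (by rw [m1.v 6 (by simp) (by simp), e6]) le_rfl) ?_ ?_
    · intro x hx
      obtain ⟨e, he, -, h2⟩ := hs2.table.of_ne x hx
      rw [h2, hG.tgt]
      exact List.mem_map.2 ⟨e, he, rfl⟩
    · intro x hx
      rw [hG.tgt] at hx
      obtain ⟨e, he, rfl⟩ := List.mem_map.1 hx
      have := (hG.vert e he).2.1
      rw [hs2.length]
      omega
    · have := hα.1
      rw [hs2.length]
      simp only at this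
      omega
    · have := Nat.mul_le_mul_right ((2 * r + 2) * 7 + 60) hle
      rw [l6]
      simp
      omega
    rintro ψ ⟨o1, o2⟩
    have e2 : ω.v 2 = σ.v 2 := k2.v 2 (by simp) (by simp)
    have e3 : ω.v 3 = σ.v 3 := k2.v 3 (by simp) (by simp)
    rw [e2, e3, l6] at o2
    refine ⟨k2.trans o1 le_rfl (by simp) (by simp), ?_⟩
    rcases o2 with ⟨o2, t, o3, o4, o5⟩ | ⟨o2, o3⟩
    · obtain ⟨y, h2, h3, h4⟩ := m2.reads_of_hit hs2.table hE (by rw [← e2]; exact hα.2) o4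
      refine .inl ⟨o2, y, ?_, by rw [o5, h2], h3, h4⟩
      have := congrArg List.length h2
      simp [cycle] at this
      omega
    · exact .inr ⟨o2, fun y h2 h3 h4 h5 => o3 _ (m2.exists_hit hU hs2.table hE
        (by rw [← e2]; exact hα.2) h2 h5 h4 h3)⟩
  · replace h1 := mt hc.2 h1
    refine HT.blk (by simp; omega) (by simp) ⟨k1, .inr ⟨e6, fun y h2 _ _ h3 => h1 ?_⟩⟩
    obtain ⟨y', rfl⟩ : ∃ y', y = c :: y' := by
      rcases y with _ | ⟨d, y'⟩ <;> simp at h3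
      exact ⟨y', by rw [h3]⟩
    simpa using h2.2 1 (by simp)

/-- The empty word is tested first; all other candidates are sorted by first letter. The hypothesis
`htriv` settles tuples of trivial elements, to which the rigidity of flat paths does not apply, by
the test for the empty word. -/
theorem searchProg_spec {n : ℕ} (hs : SState A σ U V G M p q)
    (hsol : ∃ y, Flat U y ∧ Reads G y (σ.v 2) (σ.v 3) ∧ cjT (mk y) U = V)
    (htriv : (∀ g ∈ U, g = 1) → U = V ∧ σ.v 2 = σ.v 3)
    (hn : (2 * r + 2) * ((size U + U.length) * 40 + (3 * size U + 1) * ((2 * r + 2) *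
      ((size U + U.length) * 60 + 150)) + (G.length + 1) * (3 * size U + 1) *
        ((2 * r + 2) * 7 + 60) + 110) ≤ n) :
    HT searchProg σ n (fun τ => Keep 20 [6, 7] [10, 11, 12, 13, 14] σ τ ∧ Found σ τ U V G) := by
  obtain ⟨C, hC⟩ : ∃ C, C = (size U + U.length) * 40 + (3 * size U + 1) * ((2 * r + 2) *
      ((size U + U.length) * 60 + 150)) + (G.length + 1) * (3 * size U + 1) *
        ((2 * r + 2) * 7 + 60) + 60 := ⟨_, rfl⟩
  have hn' : 2 * r * (C + 5) + 2 * C + 100 ≤ n := by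
    refine le_trans ?_ hn
    rw [show ∀ x, x + 110 = x + 60 + 50 from fun x => by omega, ← hC]
    nlinarith
  have hCS : (size U + U.length) * 40 + 60 ≤ C := by
    rw [hC, Nat.add_assoc, Nat.add_assoc]
    exact Nat.add_le_add_left (by omega) _
  replace hC := hC.ge
  clear hn
  have l2 : (σ.l 2).length = size U + U.length + 1 := by rw [hs.left, length_encT]
  refine HT.blk_seq (by simp; omega) (by simp) ?_
  refine HT.seq (eqProg_spec le_rfl) (by simp [l2]; omega) ?_
  rintro υ ⟨hυ, h35⟩
  have k1 : Keep 20 [6, 7] [10, 11, 12, 13, 14] σ υ :=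
    (Keep.setL (Keep.set (Keep.refl _ _ _ _) (x := 6) (n := 0) (by simp)) (a := 14) (L := [])
      (by simp)).trans (j := 30) (xs' := []) (ls' := [])
          ⟨hυ.frame.inp, fun x hx _ => hυ.frame.v x hx, fun c _ => hυ.l c⟩ (by simp) (by simp)
          (by simp)
  have e6 : υ.v 6 = 0 := by simp [hυ.frame.v]
  have e14 : υ.l 14 = [] := by simp [hυ.l]
  have h35' : υ.v 35 = 1 ↔ U = V := by
    rw [h35]
    simp [hs.left, hs.right, encT_injective.eq_iff]
  refine HT.seq (m := 6) (P := fun τ => Keep 20 [6, 7] [10, 11, 12, 13, 14] σ τ ∧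
    (Found σ τ U V G ∨ (τ.v 6 = 0 ∧ ¬ (U = V ∧ σ.v 2 = σ.v 3)))) ?_ (by simp [l2]; omega) ?_
  · refine HT.cond (by simp) (fun h1 => ?_) (fun h1 => ?_)
    · simp only [Cond.Holds, val_var, val_one, h35'] at h1
      refine HT.cond (by simp) (fun h2 => ?_) (fun h2 => ?_)
      · simp only [Cond.Holds, val_var] at h2
        rw [k1.v 2 (by simp) (by simp), k1.v 3 (by simp) (by simp)] at h2
        refine HT.blk (by simp) (by simp) ⟨Keep.set k1 (by simp), .inl ⟨by simp, [], by simp,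
          by simpa using e14, h2, ?_⟩⟩
        rw [← one_eq_mk, cjT_one, h1]
      · refine HT.blk (by simp) (by simp) ⟨k1, .inr ⟨e6, fun h3 => h2 ?_⟩⟩
        simp only [Cond.Holds, val_var]
        rw [k1.v 2 (by simp) (by simp), k1.v 3 (by simp) (by simp), h3.2]
    · simp only [Cond.Holds, val_var, val_one, h35'] at h1
      exact HT.blk (by simp) (by simp) ⟨k1, .inr ⟨e6, fun h3 => h1 h3.1⟩⟩
  rintro ω ⟨k2, h1⟩
  refine HT.blk_seq (by simp [l2]; omega) (by simp) ?_
  refine HT.upto (k₀ := 2) (m := 2 * r + 2) (c := C + 1)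
    (fun k τ => Keep 20 [6, 7] [10, 11, 12, 13, 14] σ τ ∧ (Found σ τ U V G ∨ (τ.v 6 = 0 ∧
      ¬ (U = V ∧ σ.v 2 = σ.v 3) ∧ ∀ y, Flat U y → Reads G y (σ.v 2) (σ.v 3) →
        cjT (mk y) U = V → ∀ c, y.head? = some c → k ≤ cd c)))
    ⟨Keep.set k2 (by simp), ?_⟩ (by simp) (by omega) (fun k τ h => ?_) ?_ ?_ ?_
  · rcases h1 with h1 | h1
    · exact .inl ⟨by simp [h1.1], by simpa using h1.2⟩
    · exact .inr ⟨by simp [h1.1], h1.2, fun y _ _ _ c _ => two_le_cd c⟩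
  · rw [val_var, h.1.v 0 (by simp) (by simp), hs.card]
  · rintro k τ hk2 hk ⟨k3, h3⟩ hv
    obtain ⟨c, hc⟩ := exists_cd hk2 hk
    refine HT.cond (by simp) (fun h4 => ?_) (fun h4 => ?_)
    · simp only [Cond.Holds, val_var, val_zero] at h4
      obtain ⟨-, h5, h6⟩ := h3.resolve_left fun h => by have := h.1; omega
      have hU : ∃ g ∈ U, g ≠ 1 := by
        -- A trivial tuple would already have been solved by the empty word.
        by_contra! h
        exact h5 (htriv h)
      refine HT.mono (letterProg_spec (c := c) (k3.sState hs (by simp)) (by rw [hv, hc]) h4 hU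
        hC) (by simp) ?_
      have e2 : τ.v 2 = σ.v 2 := k3.v 2 (by simp) (by simp)
      have e3 : τ.v 3 = σ.v 3 := k3.v 3 (by simp) (by simp)
      rw [e2, e3]
      rintro ψ ⟨o1, o2⟩
      refine ⟨by rw [o1.v 7 (by simp) (by simp), hv],
        Keep.set (k3.trans o1 le_rfl (by simp) (by simp)) (by simp), ?_⟩
      rcases o2 with ⟨o2, o3⟩ | ⟨o2, o3⟩
      · rw [e2, e3] at o3
        exact .inl ⟨by simp [o2], by simpa using o3⟩
      · refine .inr ⟨by simp [o2], h5, fun y y1 y2 y3 d hd => ?_⟩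
        refine Nat.succ_le_of_lt (lt_of_le_of_ne (h6 y y1 y2 y3 d hd) fun h7 => o3 y y1 y2 y3 ?_)
        rw [hd, cd_injective (by omega : cd d = cd c)]
    · simp only [Cond.Holds, val_var, val_zero] at h4
      have h5 := h3.resolve_right fun h => h4 h.1
      exact HT.blk (by simp; omega) (by simp) ⟨hv, Keep.set k3 (by simp), .inl ⟨by simp [h5.1],
        by simpa using h5.2⟩⟩
  · have e : (2 * r + 2 - 2) * (C + 1 + 4) = 2 * r * (C + 5) := by
      rw [Nat.add_sub_cancel]
    rw [e]
    simp [l2]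
    omega
  · rintro τ ⟨k3, h3⟩ -
    refine ⟨k3, h3.resolve_right ?_⟩
    rintro ⟨h4, h5, h6⟩
    obtain ⟨y, y1, y2, y3⟩ := hsol
    rcases y with _ | ⟨c, y⟩
    · rw [← one_eq_mk, cjT_one] at y3
      exact h5 ⟨y3, y2⟩
    · have := h6 _ y1 y2 y3 c rfl
      have := cd_lt c
      omega

end RAM

/-! ### The whole program -/

namespace RAM

open FreeGroup Opd Op

variable {r : ℕ}

/-- Set up the table of inverses and read the first symbol of the input. -/
def initProg (r : ℕ) : Prog :=
  blk [const 0 (2 * r + 2), push 1 zero, push 1 zero, const 20 2] ;;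
  loop (.lt (var 20) (var 0)) (blk [mov 21 (var 20), inc 21, push 1 (var 21), push 1 (var 20),
    inc 20, inc 20]) ;;
  blk [input 11 10]

/-- The initial store. -/
def Store.init (inp : List ℕ) : Store := ⟨inp, fun _ => 0, fun _ => []⟩

theorem isInv_of_pairs {J : List ℕ} (hlen : J.length = 2 * r + 2)
    (hJ : ∀ i < r, J.getD (2 * i + 2) 0 = 2 * i + 3 ∧ J.getD (2 * i + 3) 0 = 2 * i + 2)
    (h1 : 1 ∉ J) : IsInv r J where
  length := hlen
  get := by
    rintro ⟨⟨i, hi⟩, b⟩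
    cases b
    · simpa [cd, linv] using (hJ i hi).1
    · simpa [cd, linv] using (hJ i hi).2
  ne c h := by
    rw [List.getD_eq_getElem?_getD] at h
    rcases Nat.lt_or_ge c J.length with hc | hc
    · rw [List.getElem?_eq_getElem hc] at h
      simp only [Option.getD_some] at h
      exact h1 (h ▸ List.getElem_mem hc)
    · simp [hc] at h

theorem initProg_spec {inp : List ℕ} {n : ℕ} (hn : r * 14 + 20 ≤ n) :
    HT (initProg r) (Store.init inp) n (fun τ => τ.inp = inp ∧ At τ inp ∧ τ.v 0 = 2 * r + 2 ∧
      IsInv r (τ.l 1) ∧ (∀ a ≠ 1, τ.l a = []) ∧ ∀ x < 10, x ≠ 0 → τ.v x = 0) := by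
  refine HT.blk_seq (by simp; omega) (by simp) ?_
  refine HT.seq (m := r * 14 + 1) (P := fun τ => Keep 20 [0] [1] (Store.init inp) τ ∧
    τ.v 0 = 2 * r + 2 ∧ IsInv r (τ.l 1)) ?_ (by simp; omega) ?_
  · refine HT.loop (fun n τ => Keep 20 [0] [1] (Store.init inp) τ ∧ τ.v 0 = 2 * r + 2 ∧
      ∃ k ≤ r, τ.v 20 = 2 * k + 2 ∧ (τ.l 1).length = 2 * k + 2 ∧ 1 ∉ τ.l 1 ∧
        (∀ i < k, (τ.l 1).getD (2 * i + 2) 0 = 2 * i + 3 ∧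
          (τ.l 1).getD (2 * i + 3) 0 = 2 * i + 2) ∧ n = (r - k) * 14 + 1) ?_ ?_ ?_
    · refine ⟨?_, by simp, 0, by simp, by simp, by simp [Store.init], by simp [Store.init],
        by simp, by simp⟩
      exact Keep.set (Keep.setL (Keep.setL (Keep.set (Keep.refl _ _ _ _) (by simp)) (by simp))
        (by simp)) (by simp)
    · rintro n τ ⟨k1, h0, k, hk, h20, hlen, h1, hJ, rfl⟩ hb
      simp only [Cond.Holds, val_var, h0, h20] at hb
      refine ⟨13, HT.blk (by simp) (by simp) ⟨(r - (k + 1)) * 14 + 1, by omega, ?_, by simp [h0],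
        k + 1, by omega, by simp [h20]; ring, by simp [hlen]; ring, ?_, ?_, rfl⟩⟩
      · exact Keep.set (Keep.set (Keep.setL (Keep.setL (Keep.set (Keep.set k1 (by simp)) (by simp))
          (by simp)) (by simp)) (by simp)) (by simp)
      · simp [h1, h20]
      · intro i hi
        have e : (effAll [mov 21 (var 20), inc 21, push 1 (var 21), push 1 (var 20), inc 20, inc 20]
            τ).l 1 = τ.l 1 ++ [2 * k + 3, 2 * k + 2] := by simp [h20]
        rw [e]
        rcases Nat.lt_or_ge i k with h | h
        · rw [List.getD_append _ _ _ _ (by omega), List.getD_append _ _ _ _ (by omega)]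
          exact hJ i h
        · obtain rfl : i = k := by omega
          rw [List.getD_append_right _ _ _ _ (by omega), List.getD_append_right _ _ _ _ (by omega),
            hlen, Nat.sub_self, show 2 * i + 3 - (2 * i + 2) = 1 by omega]
          exact ⟨rfl, rfl⟩
    · rintro n τ ⟨k1, h0, k, hk, h20, hlen, h1, hJ, rfl⟩ hb
      simp only [Cond.Holds, val_var, h0, h20] at hb
      obtain rfl : k = r := by omega
      exact ⟨by omega, k1, h0, isInv_of_pairs hlen hJ h1⟩
  · rintro τ ⟨k1, h0, hJ⟩
    have e10 : τ.v 10 = 0 := k1.v 10 (by simp) (by simp)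
    have einp : τ.inp = inp := k1.inp
    refine HT.blk (by simp; omega) (by simp) ⟨einp, ⟨by simp [e10, einp], ?_⟩, by simp [h0],
      by simpa using hJ, fun a ha => ?_, fun x hx hx0 => ?_⟩
    · simp [e10, einp, List.headD_eq_head?_getD, List.head?_eq_getElem?, List.getD_eq_getElem?_getD]
    · have := k1.l a (by simpa using ha)
      simpa [Store.init] using this
    · have := k1.v x (by omega) (by simpa using hx0)
      simpa [show x ≠ 11 by omega, Store.init] using this

/-! ### Writing the output. -/

def appendProg (a b : ℕ) : Prog :=
  blk [const 20 0] ;; upto 20 (len b) (blk [get 21 b 20, push a (var 21)])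

theorem appendProg_spec {a b : ℕ} (hab : b ≠ a) {σ : Store} {n : ℕ}
    (hn : (σ.l b).length * 9 + 4 ≤ n) :
    HT (appendProg a b) σ n (Upd 20 σ a (σ.l a ++ σ.l b)) := by
  refine HT.blk_seq (by simp; omega) (by simp) ?_
  refine HT.upto (k₀ := 0) (m := (σ.l b).length) (c := 5)
    (fun k τ => Upd 20 σ a (σ.l a ++ (σ.l b).take k) τ) ⟨by simp [Frame.refl], ?_⟩ (by simp) (by simp)
    (fun k τ h => by simp [h.l, hab]) ?_ (by simp; omega) (fun τ h _ => by simpa using h)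
  · intro c
    by_cases hc : c = a <;> simp [hc]
  · rintro k τ - hk ⟨h1, h2⟩ hv
    refine HT.blk (by simp) (by simp [h2, hab, hv, hk]) ⟨by simp [hv], by simpa using h1, ?_⟩
    intro c
    by_cases hc : c = a
    · rw [List.take_succ_eq_append_getElem hk]
      simp [hc, h2, hab, hv, hk]
    · simp [hc, h2]

/-- Append the inverse of the word in the list `5` to the list `0`. -/
def appendInvProg : Prog :=
  loop (.lt zero (len 5)) (blk [mov 20 (len 5), dec 20, get 21 5 20, get 21 1 21, push 0 (var 21),
    pop 5])

theorem appendInvProg_spec {σ : Store} {q : List (Fin r × Bool)} {n : ℕ} (hJ : IsInv r (σ.l 1))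
    (hq : σ.l 5 = q.map cd) (hn : q.length * 15 + 1 ≤ n) :
    HT appendInvProg σ n (fun τ => τ.l 0 = σ.l 0 ++ (FreeGroup.invRev q).map cd) := by
  refine HT.mono (m := q.length * 15 + 1) ?_ hn fun τ h => h
  refine HT.loop (fun n τ => τ.l 1 = σ.l 1 ∧ ∃ q₁ q₂, q = q₁ ++ q₂ ∧ τ.l 5 = q₁.map cd ∧
    τ.l 0 = σ.l 0 ++ (FreeGroup.invRev q₂).map cd ∧ n = q₁.length * 15 + 1)
    ⟨rfl, q, [], by simp, hq, by simp [FreeGroup.invRev], rfl⟩ ?_ ?_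
  · rintro n τ ⟨h1, q₁, q₂, rfl, h5, h0, rfl⟩ hb
    rcases List.eq_nil_or_concat q₁ with rfl | ⟨s, c, rfl⟩
    · simp [h5] at hb
    have e : (τ.l 5).getD ((τ.l 5).length - 1) 0 = cd c := by
      simp [h5, List.getD_eq_getElem?_getD]
    have hcl := cd_lt c
    have e' : (τ.l 5)[(τ.l 5).length - 1]?.getD 0 = cd c := by
      rwa [← List.getD_eq_getElem?_getD]
    have hpos : 0 < (τ.l 5).length := by simp [h5]
    have hj : (τ.l 1)[cd c]?.getD 0 = cd (linv c) := by
      rw [← List.getD_eq_getElem?_getD, h1, hJ.get]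
    refine ⟨13, HT.blk (by simp) ?_ ⟨s.length * 15 + 1, by simp; omega, by simp [h1], s, c :: q₂,
      by simp, ?_, ?_, rfl⟩⟩
    · simp [e', h1, hJ.length, hcl]
      omega
    · simp [h5]
    · simp [e', hj, h0, FreeGroup.invRev, linv]
  · rintro n τ ⟨h1, q₁, q₂, rfl, h5, h0, rfl⟩ hb
    rcases List.eq_nil_or_concat q₁ with rfl | ⟨s, c, rfl⟩
    · exact ⟨by omega, by simpa using h0⟩
    · simp [h5] at hb

def outputProg : Prog := appendProg 0 4 ;; appendProg 0 14 ;; appendInvProg ;; blk [push 0 zero]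

theorem outputProg_spec {σ : Store} {p y q : List (Fin r × Bool)} {n : ℕ} (hJ : IsInv r (σ.l 1))
    (h0 : σ.l 0 = []) (hp : σ.l 4 = p.map cd) (hy : σ.l 14 = y.map cd) (hq : σ.l 5 = q.map cd)
    (hn : (p.length + y.length + q.length) * 15 + 20 ≤ n) :
    HT outputProg σ n (fun τ => τ.l 0 = (p ++ y ++ FreeGroup.invRev q).map cd ++ [0]) := by
  refine HT.seq (appendProg_spec (by simp) le_rfl) (by simp [hp]; omega) fun υ hυ => ?_
  refine HT.seq (appendProg_spec (by simp) le_rfl) (by simp [hυ.l, hp, hy]; omega) fun ω hω => ?_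
  refine HT.seq (appendInvProg_spec (q := q) (by simpa [hω.l, hυ.l] using hJ)
    (by simp [hω.l, hυ.l, hq]) le_rfl) (by simp [hυ.l, hp, hy]; omega) fun ψ hψ => ?_
  refine HT.blk (by simp [hυ.l, hp, hy]; omega) (by simp) ?_
  simp [hψ, hω.l, hυ.l, h0, hp, hy]

end RAM

/-! ### Assembling the program and its quadratic bound. -/

namespace RAM

open FreeGroup Opd Op

variable {r : ℕ}

def prepProg : Prog :=
  readGens ;; next ;; readEqns ;; descendProg 2 4 ;; descendProg 3 5 ;; addTail 5 3 ;;
  addTail 4 2 ;; foldProg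

/-- The numbers that occur in the time bounds, compared with `M = (2 * r + 2) ^ 2 * N ^ 2`. -/
structure Bounds (R N M : ℕ) : Prop where
  one : 1 ≤ M
  card : R ≤ M
  size : N ≤ M
  card_size : R * N ≤ M
  size_sq : N * N ≤ M
  card_size_sq : R * (N * N) ≤ M

theorem bounds {R N : ℕ} (hR : 1 ≤ R) (hN : 1 ≤ N) : Bounds R N (R * R * (N * N)) where
  one := Nat.mul_pos (Nat.mul_pos hR hR) (Nat.mul_pos hN hN)
  card := by
    calc R = R * 1 * (1 * 1) := by ring
      _ ≤ R * R * (N * N) := by gcongr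
  size := by
    calc N = 1 * 1 * (1 * N) := by ring
      _ ≤ R * R * (N * N) := by gcongr
  card_size := by
    calc R * N = R * 1 * (1 * N) := by ring
      _ ≤ R * R * (N * N) := by gcongr
  size_sq := by
    calc N * N = 1 * 1 * (N * N) := by ring
      _ ≤ R * R * (N * N) := by gcongr
  card_size_sq := by
    calc R * (N * N) = R * 1 * (N * N) := by ring
      _ ≤ R * R * (N * N) := by gcongr

/-- Reduction only shortens words, and each equation contributes two separators to the input. -/
theorem size_add_size_le (E : List (GroupWord r × GroupWord r)) :
    size (E.map fun e => mk e.1) + size (E.map fun e => mk e.2) + 2 * E.length ≤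
      (encE E).length := by
  induction E with
  | nil => simp [size]
  | cons e E ih =>
    have h1 : norm (mk e.1) ≤ e.1.length := norm_mk_le
    have h2 : norm (mk e.2) ≤ e.2.length := norm_mk_le
    simp only [size, encE, List.map_cons, List.sum_cons, List.length_cons, List.flatMap_cons,
      List.length_append, code_eq, List.length_map, List.length_nil] at ih ⊢
    omega

theorem encode_eq (I : SCSPInput r) : I.encode = encG I.gens ++ 0 :: (encE I.eqns ++ [0]) := by
  simp [SCSPInput.encode, encG, encE]

variable {I : SCSPInput r} {σ : Store} {M n : ℕ}

theorem descend_bound {R N s l : ℕ} (hM : Bounds R N M) (hs : s + l + 1 ≤ N) :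
    ((s + 1) * R) * ((s + l) * 60 + 70) + 6 ≤ 136 * M := by
  have h1 : ((s + 1) * R) * ((s + l) * 60 + 70) ≤ (N * R) * (N * 60 + N * 70) := by
    gcongr <;> omega
  have h2 : (N * R) * (N * 60 + N * 70) = 130 * (R * (N * N)) := by ring
  have := hM.card_size_sq
  have := hM.one
  omega

theorem tail_bound {R N p : ℕ} (hM : Bounds R N M) (hp : p ≤ N) :
    p * (R * 7 + 40) + 20 ≤ 67 * M := by
  have h1 : p * (R * 7 + 40) ≤ N * (R * 7 + 40) := by gcongr
  have h2 : N * (R * 7 + 40) = 7 * (R * N) + 40 * N := by ring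
  have := hM.card_size
  have := hM.size
  have := hM.one
  omega

theorem fold_bound {N g : ℕ} (hM : Bounds (2 * r + 2) N M) (hg : g + 1 ≤ 2 * N) :
    (g + 1) * (g * (21 * r + 120) + (2 * r + 2) * 21 + 150) + 10 ≤ 800 * M := by
  obtain ⟨R, hR⟩ : ∃ R, R = 2 * r + 2 := ⟨_, rfl⟩
  rw [← hR] at hM ⊢
  have h1 : (g + 1) * (g * (21 * r + 120) + R * 21 + 150) ≤
      (2 * N) * ((2 * N) * (R * 80) + R * 21 + R * 75) := by
    gcongr <;> omega
  have h2 : (2 * N) * ((2 * N) * (R * 80) + R * 21 + R * 75) =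
      320 * (R * (N * N)) + 192 * (R * N) := by ring
  have h3 := hM.card_size
  have h4 := hM.card_size_sq
  have h5 := hM.one
  refine (Nat.add_le_add_right (h1.trans_eq h2) 10).trans ?_
  clear h1 h2
  omega

/-- The square of `2 * r + 2` arises because the trace for each first letter tries all letters at
each of its steps. -/
theorem search_bound {N s l g : ℕ} (hM : M = (2 * r + 2) * (2 * r + 2) * (N * N))
    (hs : s + l + 1 ≤ N) (hg : g + 1 ≤ 2 * N) :
    (2 * r + 2) * ((s + l) * 40 + (3 * s + 1) * ((2 * r + 2) * ((s + l) * 60 + 150)) +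
      (g + 1) * (3 * s + 1) * ((2 * r + 2) * 7 + 60) + 110) ≤ 1100 * M := by
  obtain ⟨R, hR⟩ : ∃ R, R = 2 * r + 2 := ⟨_, rfl⟩
  rw [← hR] at hM ⊢
  have hb := bounds (R := R) (N := N) (by omega) (by omega)
  rw [← hM] at hb
  have h1 : R * ((s + l) * 40 + (3 * s + 1) * (R * ((s + l) * 60 + 150)) +
      (g + 1) * (3 * s + 1) * (R * 7 + 60) + 110) ≤ R * (N * 40 + (3 * N) * (R * (N * 60 + N * 150)) +
      (2 * N) * (3 * N) * (R * 7 + R * 30) + 110) := by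
    gcongr <;> omega
  have h2 : R * (N * 40 + (3 * N) * (R * (N * 60 + N * 150)) +
      (2 * N) * (3 * N) * (R * 7 + R * 30) + 110) =
      40 * (R * N) + 852 * (R * R * (N * N)) + 110 * R := by ring
  have := hb.card_size
  have := hb.card
  omega

theorem prepProg_spec (hσ : At σ I.encode) (hK : σ.v 0 = 2 * r + 2)
    (hJ : IsInv r (σ.l 1)) (hl : ∀ a ≠ 1, σ.l a = []) (hv : ∀ x < 10, x ≠ 0 → σ.v x = 0)
    (hM : Bounds (2 * r + 2) I.size M) (hn : 2000 * M ≤ n) :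
    HT prepProg σ n (fun τ => ∃ p q G, let U := cjT (mk p) (I.eqns.map fun e => mk e.1)
      let V := cjT (mk q) (I.eqns.map fun e => mk e.2)
      SState I.subgroup τ U V G (I.gens.map fun a => (a, τ.v 1)) p q ∧
      τ.l 0 = [] ∧ τ.l 4 = p.map cd ∧ τ.l 5 = q.map cd ∧ LocalMin U ∧ LocalMin V ∧
      p.length + size U ≤ size (I.eqns.map fun e => mk e.1) ∧
      q.length + size V ≤ size (I.eqns.map fun e => mk e.2) ∧ G.length + 1 ≤ 2 * I.size) := by
  obtain ⟨N, hN⟩ : ∃ N, N = I.size := ⟨_, rfl⟩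
  rw [← hN] at hM ⊢
  obtain ⟨U₀, hU₀⟩ : ∃ U, U = I.eqns.map fun e => mk e.1 := ⟨_, rfl⟩
  obtain ⟨V₀, hV₀⟩ : ∃ V, V = I.eqns.map fun e => mk e.2 := ⟨_, rfl⟩
  have hUV := size_add_size_le I.eqns
  rw [← hU₀, ← hV₀] at hUV
  have lU : U₀.length = I.eqns.length := by simp [hU₀]
  have lV : V₀.length = I.eqns.length := by simp [hV₀]
  have hlen : N = (encG I.gens).length + (encE I.eqns).length + 2 := by
    rw [hN, SCSPInput.size, encode_eq]; simp; omega
  rw [encode_eq] at hσ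
  have M1 := hM.one
  have hA : ∀ a ∈ I.gens, mk a ∈ I.subgroup := fun a ha =>
    Subgroup.subset_closure ⟨a, ha, rfl⟩
  have hG0 : GState I.subgroup σ [] [([], σ.v 5)] := by
    have h1 := hv 1 (by simp) (by simp)
    have h4 := hv 4 (by simp) (by simp)
    have h5 := hv 5 (by simp) (by simp)
    refine ⟨by simp [hl], by simp [hl], by simp [hl], ⟨fun _ => 1, ?_⟩, by simp [h4], by simp [h4],
      by simp [h1], by simp, by simp [h5]⟩
    rw [h1, h5]
    exact graphInv_nil _
  refine HT.seq (readGens_spec (n := 188 * M) hA hG0 hσ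
    (by rw [hv 5 (by simp) (by simp), hv 1 (by simp) (by simp)]) hJ hK ?_) (by omega) ?_
  · have h1 : (encG I.gens).length * ((2 * r + 2) * 7 + 80 * (encG I.gens).length + 100) ≤
        N * ((2 * r + 2) * 7 + 80 * N + 100) := by gcongr <;> omega
    have h2 : N * ((2 * r + 2) * 7 + 80 * N + 100) =
        7 * ((2 * r + 2) * N) + 80 * (N * N) + 100 * N := by ring
    have := hM.card_size
    have := hM.size_sq
    have := hM.size
    omega
  rintro σ₁ ⟨k1, at1, G₁, hG₁, s1⟩
  refine HT.blk_seq (by simp; omega) (by simp) ?_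
  have at2 := at1.next
  refine HT.seq (readEqns_spec (n := 50 * M) (by simpa [k1.l] using hJ) at2 ?_) (by simp; omega) ?_
  · have := hM.size; omega
  rintro σ₂ ⟨k2, -, hU, hV⟩
  rw [← hU₀] at hU
  rw [← hV₀] at hV
  have k3 : Keep 20 [1, 2, 3, 4, 5, 10, 11] [2, 3, 6, 7, 8] σ σ₂ := by
    refine Keep.trans (Keep.set (Keep.set (Keep.trans (Keep.refl _ _ _ _) k1 ?_ ?_ ?_) ?_) ?_) k2
      ?_ ?_ ?_ <;> simp
  have s2 : GState I.subgroup σ₂ G₁ (I.gens.map fun a => (a, σ₂.v 1)) := by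
    have h1 : σ₂.v 1 = σ₁.v 1 := by simp [k2.v]
    rw [h1]
    exact s1.congr h1 (by simp [k2.v]) (by simp [k2.l]) (by simp [k2.l]) (by simp [k2.l])
  refine HT.seq (descendProg_spec (n := 136 * M) (by simp) (by simp) (by simp) (by simp) (by simp)
    (by rw [k3.l 1 (by simp)]; exact hJ) (by rw [k3.v 0 (by simp) (by simp), hK]) hU
    (descend_bound hM (by omega))) (by simp; omega) ?_
  rintro σ₃ ⟨f3, l3, p, p4, pU, plen, pmin⟩
  refine HT.seq (descendProg_spec (n := 136 * M) (by simp) (by simp) (by simp) (by simp) (by simp)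
    (by rw [l3 1 (by simp) (by simp) (by simp), k3.l 1 (by simp)]; exact hJ)
    (by rw [f3.v 0 (by simp), k3.v 0 (by simp) (by simp), hK])
    (by rw [l3 3 (by simp) (by simp) (by simp)]; exact hV)
    (descend_bound hM (by omega))) (by simp; omega) ?_
  rintro σ₄ ⟨f4, l4, q, q4, qV, qlen, qmin⟩
  have k4 : Keep 20 [] [2, 3, 4, 5, 11] σ₂ σ₄ := by
    refine ⟨f4.inp.trans f3.inp, fun x hx _ => (f4.v x hx).trans (f3.v x hx), fun b hb => ?_⟩
    simp at hb
    rw [l4 b (by omega) (by omega) (by omega), l3 b (by omega) (by omega) (by omega)]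
  have k5 : Keep 20 [1, 2, 3, 4, 5, 10, 11] [2, 3, 4, 5, 6, 7, 8, 11] σ σ₄ := by
    refine Keep.trans (Keep.trans (Keep.refl _ _ _ _) k3 ?_ ?_ ?_) k4 ?_ ?_ ?_ <;> simp
  have s4 : GState I.subgroup σ₄ G₁ (I.gens.map fun a => (a, σ₄.v 1)) := by
    have h1 : σ₄.v 1 = σ₂.v 1 := by simp [k4.v]
    rw [h1]
    exact s2.congr h1 (by simp [k4.v]) (by simp [k4.l]) (by simp [k4.l]) (by simp [k4.l])
  refine HT.seq (addTail_spec (n := 67 * M) (by simp) (by simp) s4 q4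
    (by rw [k5.l 1 (by simp)]; exact hJ) (by rw [k5.v 0 (by simp) (by simp), hK])
    (tail_bound hM (by omega))) (by simp; omega) ?_
  rintro σ₅ ⟨m5, G₅, hG₅, s5⟩
  have e15 : σ₅.v 1 = σ₄.v 1 := by simp [m5.v]
  rw [← e15] at s5
  refine HT.seq (addTail_spec (n := 67 * M) (p := p) (by simp) (by simp) s5 ?_
    (by rw [m5.l 1 (by simp), k5.l 1 (by simp)]; exact hJ)
    (by rw [m5.v 0 (by simp) (by simp), k5.v 0 (by simp) (by simp), hK])
    (tail_bound hM (by omega))) (by simp; omega) ?_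
  · rw [m5.l 4 (by simp), l4 4 (by simp) (by simp) (by simp), p4]
  rintro σ₆ ⟨m6, G₆, hG₆, s6⟩
  have e16 : σ₆.v 1 = σ₅.v 1 := by simp [m6.v]
  have e36 : σ₆.v 3 = σ₅.v 3 := by simp [m6.v]
  rw [← e16, ← e36] at s6
  have k6 : Keep 20 [1, 2, 3, 4, 5, 10, 11] [2, 3, 4, 5, 6, 7, 8, 11] σ σ₆ := by
    refine Keep.trans (Keep.trans k5 m5 ?_ ?_ ?_) m6 ?_ ?_ ?_ <;> simp
  -- Each letter of a generator or of a tail contributes two edges, and the tails are no longer than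
  -- the left and right sides of the equations.
  have hG6 : G₆.length + 1 ≤ 2 * N := by omega
  refine HT.mono (foldProg_spec (n := 800 * M) (by rw [k6.v 0 (by simp) (by simp), hK]) s6
    (fold_bound hM hG6)) (by simp; omega) ?_
  rintro τ ⟨m7, G, hG, s7, t7, len7⟩
  have l46 : ∀ b, b ∉ [6, 7, 8, 9] → τ.l b = σ₄.l b := by
    intro b hb
    simp at hb
    rw [m7.l b (by simp; omega), m6.l b (by simp; omega), m5.l b (by simp; omega)]
  refine ⟨p, q, G, ⟨?_, ?_, ?_, ?_, s7, t7, len7⟩, ?_, ?_, ?_, ?_, ?_, ?_, ?_, by omega⟩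
  · rw [l46 1 (by simp), k5.l 1 (by simp)]; exact hJ
  · rw [m7.v 0 (by simp) (by simp), k6.v 0 (by simp) (by simp), hK]
  · rw [l46 2 (by simp), l4 2 (by simp) (by simp) (by simp), pU, hU₀]
  · rw [l46 3 (by simp), qV, hV₀]
  · rw [l46 0 (by simp), k5.l 0 (by simp), hl 0 (by simp)]
  · rw [l46 4 (by simp), l4 4 (by simp) (by simp) (by simp), p4]
  · rw [l46 5 (by simp), q4]
  · rw [← hU₀]; exact pmin
  · rw [← hV₀]; exact qmin
  · rw [← hU₀]; exact plen
  · rw [← hV₀]; exact qlen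

theorem eq_of_forall_eq_one {U V : List (FreeGroup (Fin r))} {x : FreeGroup (Fin r)}
    (hU : ∀ g ∈ U, g = 1) (h : cjT x U = V) : U = V := by
  rw [← h, cjT]
  conv_lhs => rw [← List.map_id U]
  exact List.map_congr_left fun g hg => by simp [hU g hg]

theorem size_eq_zero {U : List (FreeGroup (Fin r))} {x : FreeGroup (Fin r)}
    (h : ∀ g ∈ cjT x U, g = 1) : size U = 0 := by
  rw [size, List.sum_eq_zero_iff]
  intro k hk
  obtain ⟨g, hg, rfl⟩ := List.mem_map.1 hk
  have h1 := h _ (List.mem_map.2 ⟨g, hg, rfl⟩)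
  have : g = 1 := by
    by_contra h2
    exact cj_ne_one h2 h1
  simp [this]

theorem isSolution_iff {x : FreeGroup (Fin r)} : I.IsSolution x ↔ x ∈ I.subgroup ∧
    cjT x (I.eqns.map fun e => mk e.1) = I.eqns.map fun e => mk e.2 := by
  rw [SCSPInput.IsSolution, cjT, List.map_map, List.map_inj_left]
  rfl

def solveProg (r : ℕ) : Prog := initProg r ;; prepProg ;; searchProg ;; outputProg

/-- A given solution is used only to show that the search succeeds; the solution in the output may
be a different one. -/
theorem solveProg_spec (hI : ∃ x, I.IsSolution x)
    (hM : M = (2 * r + 2) * (2 * r + 2) * (I.size * I.size)) (hn : 4000 * M ≤ n) :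
    HT (solveProg r) (Store.init I.encode) n
      (fun τ => ∃ w : GroupWord r, τ.l 0 = w.code ++ [0] ∧ I.IsSolution (mk w)) := by
  have hsz : 2 ≤ I.size := by rw [SCSPInput.size, encode_eq]; simp; omega
  have hb := bounds (R := 2 * r + 2) (N := I.size) (by omega) (by omega)
  rw [← hM] at hb
  have M1 := hb.one
  have MR := hb.card
  refine HT.seq (initProg_spec (n := 20 * M) (by omega)) (by omega) ?_
  rintro σ₁ ⟨-, at1, hK, hJ, hl, hv⟩
  refine HT.seq (prepProg_spec at1 hK hJ hl hv hb le_rfl) (by omega) ?_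
  rintro σ₂ ⟨p, q, G, hs, l0, l4, l5, hU, hV, hp, hq, hG⟩
  obtain ⟨U₀, hU₀⟩ : ∃ U, U = I.eqns.map fun e => mk e.1 := ⟨_, rfl⟩
  obtain ⟨V₀, hV₀⟩ : ∃ V, V = I.eqns.map fun e => mk e.2 := ⟨_, rfl⟩
  have hUV := size_add_size_le I.eqns
  have lU : U₀.length = I.eqns.length := by simp [hU₀]
  have hlen : I.size = (encG I.gens).length + (encE I.eqns).length + 2 := by
    rw [SCSPInput.size, encode_eq]; simp; omega
  simp only [isSolution_iff] at hI ⊢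
  rw [← hU₀, ← hV₀] at hI hUV ⊢
  rw [← hU₀] at hs hU hp
  rw [← hV₀] at hs hV hq
  obtain ⟨φ, hφ⟩ := hs.graph.inv
  obtain ⟨x, hxA, hxUV⟩ := hI
  -- The given solution, transported to the minimal tuples. Being reduced, this word is a flat path
  -- and is read by the folded graph.
  obtain ⟨y, hy⟩ : ∃ y, y = ((mk p)⁻¹ * x * mk q).toWord := ⟨_, rfl⟩
  have hmk : mk y = (mk p)⁻¹ * x * mk q := by rw [hy, mk_toWord]
  have hyr : IsReduced y := hy ▸ isReduced_toWord
  have hyUV : cjT (mk y) (cjT (mk p) U₀) = cjT (mk q) V₀ := by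
    rw [hmk, cjT_cjT, ← hxUV, cjT_cjT]
    simp [mul_assoc, -mul_mk, -inv_mk]
  have hyR : Reads G y (σ₂.v 2) (σ₂.v 3) := by
    refine (hφ.mem_iff_reads hs.table.folded (gens := I.gens) rfl ?_ (p := p) (q := q) ?_ ?_ hyr).1 ?_
    · intro a ha
      simp [ha]
    · simp
    · simp
    · rw [hmk]
      simpa [mul_assoc, -mul_mk, -inv_mk] using hxA
  refine HT.seq (searchProg_spec (n := 1100 * M) hs ⟨y, hU.flat hV hyr hyUV, hyR, hyUV⟩ ?_ ?_)
    (by omega) ?_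
  -- If all entries are trivial, then both descents are empty. The two tails then end at the base,
  -- so the empty word is a solution.
  · intro h1
    refine ⟨eq_of_forall_eq_one h1 hyUV, ?_⟩
    have hU0 := size_eq_zero h1
    have h2 : ∀ g ∈ cjT (mk q) V₀, g = 1 := eq_of_forall_eq_one h1 hyUV ▸ h1
    have hV0 := size_eq_zero h2
    obtain rfl : p = [] := List.length_eq_zero_iff.1 (by omega)
    obtain rfl : q = [] := List.length_eq_zero_iff.1 (by omega)
    have r1 : Reads G [] (σ₂.v 1) (σ₂.v 2) := hφ.reads _ _ (by simp)
    have r2 : Reads G [] (σ₂.v 1) (σ₂.v 3) := hφ.reads _ _ (by simp)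
    exact r1.symm.trans r2
  · refine search_bound hM ?_ hG
    rw [length_cjT]
    omega
  rintro σ₃ ⟨k3, h6, z, hz, h14, hzR, hzUV⟩
  refine HT.mono (outputProg_spec (p := p) (y := z) (q := q) (by rw [k3.l 1 (by simp)]; exact hs.inv)
    (by rw [k3.l 0 (by simp), l0]) (by rw [k3.l 4 (by simp), l4]) h14
    (by rw [k3.l 5 (by simp), l5]) le_rfl) ?_ ?_
  -- The word that was found, and hence the output, is bounded only quadratically, so writing it
  -- also takes quadratic time.
  · have h1 : (G.length + 1) * (3 * size (cjT (mk p) U₀) + 1) ≤ (2 * I.size) * (3 * I.size) := by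
      gcongr
      omega
    have h2 : (2 * I.size) * (3 * I.size) = 6 * (I.size * I.size) := by ring
    have := hb.size_sq
    have := hb.size
    omega
  · intro τ hτ
    -- Membership follows from the path for `z` and the marks at its ends, and the equations by
    -- undoing the descent of `V₀`.
    refine ⟨p ++ z ++ FreeGroup.invRev q, hτ, ?_, ?_⟩
    · have h1 := hφ.mark p (σ₂.v 2) (by simp)
      have h2 := hφ.mem_of_reads hzR
      have h3 := hφ.mark q (σ₂.v 3) (by simp)
      have h4 := mul_mem (mul_mem h1 h2) (inv_mem h3)
      rw [← mul_mk, ← mul_mk, ← inv_mk]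
      simpa [mul_assoc, -mul_mk, -inv_mk] using h4
    · rw [← mul_mk, ← mul_mk, ← inv_mk, ← cjT_cjT, ← cjT_cjT, hzUV]
      exact cjT_inv_eq rfl

/-- The operand `one` needs a register containing 1, whereas all registers are zero initially; one
instruction makes up for this. -/
theorem rep_init (inp : List ℕ) : Rep (Store.init inp) ((Instr.const 3 1).exec (State.init inp)) where
  opd o := by
    rcases o with x | a | _ | _
    · simp [Opd.reg, Instr.exec, State.init, Store.init]
    · have : 2 * a ≠ 3 := by omega
      simp [Opd.reg, Instr.exec, State.init, Store.init, this]
    · simp [Opd.reg, Instr.exec, State.init]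
    · simp [Opd.reg, Instr.exec]
  inp i := by simp [Instr.exec, State.init, Store.init]
  arr a i hi := by simp [Store.init] at hi

end RAM

theorem mainTheorem11 (r : ℕ) :
    ∃ (P : RAM.Prog) (C : ℕ), ∀ I : SCSPInput r, (∃ x, I.IsSolution x) →
      ∃ (t : ℕ) (s : RAM.State) (w : GroupWord r),
        RAM.Run P (RAM.State.init I.encode) t s ∧ t ≤ C * I.size ^ 2 ∧
        s.Outputs w.code ∧ I.IsSolution (FreeGroup.mk w) := by
  -- The additional unit in 4001 pays for the instruction that sets up the constant one.
  refine ⟨.seq (.instr (.const 3 1)) (RAM.solveProg r), 4001 * ((2 * r + 2) * (2 * r + 2)), ?_⟩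
  intro I hI
  obtain ⟨t, s, τ, h1, h2, h3, w, h4, h5⟩ :=
    RAM.solveProg_spec hI rfl le_rfl _ (RAM.rep_init I.encode)
  refine ⟨1 + t, s, w, .seq (.instr _ _) h1, ?_, ?_, h5⟩
  · have hsz : 1 ≤ I.size := by rw [SCSPInput.size, RAM.encode_eq]; simp; omega
    have hb := (RAM.bounds (R := 2 * r + 2) (N := I.size) (by omega) hsz).one
    have e : 4001 * ((2 * r + 2) * (2 * r + 2)) * I.size ^ 2 =
        4001 * ((2 * r + 2) * (2 * r + 2) * (I.size * I.size)) := by ring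
    omega
  · intro i hi
    -- List `0` is kept in array `1`, the output array. The zero pushed at the end is the terminator
    -- that `Outputs` demands, since cells beyond the list are unconstrained.
    rw [h3.arr 0 i (by rw [h4, List.length_append]; exact Nat.lt_succ_of_le hi), h4]
    rcases Nat.lt_or_ge i w.code.length with h | h
    · rw [List.getD_append _ _ _ _ h]
    · obtain rfl : i = w.code.length := by omega
      simp [List.getD_eq_getElem?_getD]
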